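/- **Model.** There are $N\ge 1$ queues in slotted time $t=0,1,2,\dots$. $A_i(t)\in\{0,1,2,\dots\}$ packets arrive to queue $i$ in slot $t$, and channel $i$ is ON ($S_i(t)=1$) or OFF ($S_i(t)=0$), with $\Pr[S_i(t)=1]=p_i$. All variables $A_i(t)$, $S_i(t)$ are mutually independent, the processes are i.i.d. over slots, $\lambda_i=\mathbb E[A_i(t)]$ and $\mathbb E[A_i(t)^2]<\infty$. Put $A_{tot}(t)=\sum_i A_i(t)$, $\lambda_{tot}=\sum_i\lambda_i$ and $p_{min}=\min_i p_i$, and assume $0<p_{min}<1$. In each slot at most one link is selected; $\mu_i(t)=S_i(t)$ if link $i$ is selected and $\mu_i(t)=0$ otherwise, and $Q_i(t+1)=\max[Q_i(t)-\mu_i(t),0]+A_i(t)$. The initial backlogs have finite second moments and are independent of the arrivals and channels. Queue $i$ is *strongly stable* if $\limsup_{t\to\infty}\frac1t\sum_{\tau<t}\mathbb E[Q_i(\tau)]<\infty$. The capacity region $\Lambda$ is the closure of the set of rate vectors $\lambda=(\lambda_1,\dots,\lambda_N)$ for which some causal, possibly randomized, control policy makes all queues strongly stable. The *max-weight (LCQ)*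 policy selects in each slot a link with the largest product $Q_i(t)S_i(t)$, with a stationary probabilistic tie breaking rule. Let $\overline Q_i$ be the time average number of packets in queue $i$: the limit of $\frac1t\sum_{\tau<t}\mathbb E[Q_i(\tau)]$, which is also the almost sure limit of $\frac1t\sum_{\tau<t}Q_i(\tau)$. The delay of a packet is the slot in which it is transmitted minus the slot in which it arrives, where each queue serves its packets in order of arrival. Let $\overline W$ be the average delay: the almost sure limit, as $T\to\infty$, of the average of the delays of all packets that arrive in slots $0,\dots,T-1$. For positive integers $K$ let $r_K=1-(1-p_{min})^K$ and $\mu_K^{sym}=r_K/K$. For $0<\rho<1$ define $$\theta=\begin{cases}\dfrac{(1-\rho)(\mu^{sym}_K-\mu^{sym}_N)}{r_{K+1}} & K<N\\[1ex] 0 & K\ge N,\end{cases}\qquad C=\begin{cases}\dfrac{r_{K+1}}{\frac{r_NK\lambda_{tot}}{N(1-\rho)}+\frac{r_K(r_{K+1}-\lambda_{tot})}{1-\rho}} & K<N\\[1ex] 1/r_N & K\ge N,\end{cases}$$ $$B_\theta=\frac{\lambda_{tot}}2+\frac12\sum_i\mathbb E[A_i(t)^2]-\sum_i\lambda_i^2+\frac\theta2\left[\mathbb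 E[A_{tot}(t)^2]+\lambda_{tot}-2\lambda_{tot}^2\right],$$ and let $B_0$ be the value of this expression with $\theta=0$. **Theorem (Delay Bound for LCQ).** (1) Let $0<\rho<1$ and $\lambda\in\rho\Lambda$, and let $K\ge1$ be any integer with $1-(1-p_{min})^{K+1}>\lambda_{tot}$. Then under the LCQ policy all queues are strongly stable, the time averages $\overline Q_i$ exist, and $$\sum_{i=1}^N\overline Q_i\le\frac{KB_\theta C}{(1-\rho)^2}.$$ If $\lambda_{tot}>0$, then the average delay $\overline W$ exists and $$\overline W\le\min\left[\frac{KB_\theta C}{\lambda_{tot}(1-\rho)^2},\ \frac{NB_0}{\lambda_{tot}r_N(1-\rho)}\right].$$ (2) For all $p_{min},\rho_0\in(0,1)$ and all $\beta$ there are positive constants $c_0,c_1,c_2$, depending only on $p_{min},\rho_0,\beta$ (not on $N$ or $\rho$), such that the following holds for every such system, with any number $N$ of queues, with this value of $p_{min}$, with $\lambda_{tot}>0$ and $\sum_i\mathbb E[A_i(t)^2]\le\beta\lambda_{tot}$ (which holds in particular if $\mathbb E[A_{tot}(t)^2]\le\beta\lambda_{tot}$), and every $\rho_0\le\rho<1$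 with $\lambda\in\rho\Lambda$. The integer $$K=\max\left[1,\left\lceil\frac{\log(2/(1-\rho))}{\log(1/(1-p_{min}))}\right\rceil-1\right]$$ satisfies $1-(1-p_{min})^{K+1}>\lambda_{tot}$ and $K\le c_0\log\frac1{1-\rho}$. Under the LCQ policy $\overline W$ exists and is at most the minimum in (1) for this $K$, and that minimum is at most $$\min\left[\frac{c_1\log(1/(1-\rho))}{(1-\rho)^2},\ \frac{c_2N}{1-\rho}\right].$$ -/

import Mathlib

open MeasureTheory ProbabilityTheory Filter Topology
open scoped ENNReal NNReal Pointwise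

/-- The information available to the network controller when it makes the decision of slot `t`:
the initial backlogs, the arrivals of all earlier slots, and the channel states and
randomization seeds up to and including slot `t`. (Backlogs up to slot `t` and decisions of
earlier slots are determined by these data.) -/
@[reducible] def causalInfo {N : ℕ} {Ω : Type*} (A : Fin N → ℕ → Ω → ℕ) (S : Fin N → ℕ → Ω → Bool)
    (U : ℕ → Ω → ℝ) (Q₀ : Fin N → Ω → ℕ) (t : ℕ) : MeasurableSpace Ω :=
  (⨆ i, MeasurableSpace.comap (Q₀ i) inferInstance) ⊔
  (⨆ s, ⨆ _ : s < t, ⨆ i, MeasurableSpace.comap (A i s) inferInstance) ⊔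
  (⨆ s, ⨆ _ : s ≤ t, ⨆ i, MeasurableSpace.comap (S i s) inferInstance) ⊔
  (⨆ s, ⨆ _ : s ≤ t, MeasurableSpace.comap (U s) inferInstance)

/-- The transmission rate `μ_i(t)` of link `i`: the channel state (`1` if ON, `0` if OFF) if link
`i` is the selected one, and `0` otherwise. -/
def linkRate {N : ℕ} (sel : Option (Fin N)) (s : Fin N → Bool) (i : Fin N) : ℕ :=
  if sel = some i then (s i).toNat else 0

/-- A slotted system of `N` queues with ON/OFF channels, operated by some causal (possibly
randomized and history dependent) control policy that selects at most one link per slot.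
Arrivals and channel states are independent of each other, across links, and i.i.d. over slots. -/
structure OnOffSystem (N : ℕ) (Ω : Type*) [MeasurableSpace Ω] where
  /-- the underlying probability measure -/
  P : Measure Ω
  isProb : IsProbabilityMeasure P
  /-- ON probabilities of the channels -/
  p : Fin N → ℝ
  /-- `A i t` is the number of packets that arrive to link `i` during slot `t` -/
  A : Fin N → ℕ → Ω → ℕ
  /-- `S i t` is the state of channel `i` in slot `t` (`true` is ON) -/
  S : Fin N → ℕ → Ω → Bool
  /-- `U t` is the source of randomness for the controller's randomized decision in slot `t` -/
  U : ℕ → Ω → ℝ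
  /-- the link selected in slot `t`, if any -/
  sel : ℕ → Ω → Option (Fin N)
  /-- `Q i t` is the backlog of queue `i` at the beginning of slot `t` -/
  Q : Fin N → ℕ → Ω → ℕ
  measurable_A : ∀ i t, Measurable (A i t)
  measurable_S : ∀ i t, Measurable (S i t)
  measurable_U : ∀ t, Measurable (U t)
  measurable_init : ∀ i, Measurable (Q i 0)
  /-- arrivals are i.i.d. over slots ... -/
  identDistrib_A : ∀ i t, IdentDistrib (A i t) (A i 0) P P
  /-- ... with finite second moments, -/
  memLp_A : ∀ i t, MemLp (fun ω => (A i t ω : ℝ)) 2 P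
  /-- and independent over links and slots. -/
  indep_A : iIndepFun (fun k : Fin N × ℕ => A k.1 k.2) P
  prob_on : ∀ i t, P.real {ω | S i t ω = true} = p i
  indep_S : iIndepFun (fun k : Fin N × ℕ => S k.1 k.2) P
  identDistrib_U : ∀ t, IdentDistrib (U t) (U 0) P P
  indep_U : iIndepFun U P
  /-- The arrival processes, the channel processes, the seeds and the initial backlogs are
  mutually independent. -/
  indep_A_S : IndepFun (fun ω i t => A i t ω) (fun ω i t => S i t ω) P
  indep_AS_U : IndepFun (fun ω => ((fun i t => A i t ω), (fun i t => S i t ω)))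
    (fun ω t => U t ω) P
  indep_ASU_init : IndepFun
    (fun ω => ((fun i t => A i t ω), (fun i t => S i t ω), (fun t => U t ω)))
    (fun ω i => Q i 0 ω) P
  memLp_init : ∀ i, MemLp (fun ω => (Q i 0 ω : ℝ)) 2 P
  /-- Decisions are causal. -/
  sel_causal : ∀ t i, MeasurableSet[causalInfo A S U (fun i => Q i 0) t] {ω | sel t ω = some i}
  /-- `Q_i(t+1) = max[Q_i(t) - μ_i(t), 0] + A_i(t)` (the subtraction of naturals truncates) -/
  dynamics : ∀ i t ω,
    Q i (t + 1) ω = (Q i t ω - linkRate (sel t ω) (fun j => S j t ω) i) + A i t ω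

/-- The average over the first `T` slots of a sequence of extended nonnegative numbers. -/
noncomputable def slotAverage (x : ℕ → ℝ≥0∞) (T : ℕ) : ℝ≥0∞ :=
  (∑ τ ∈ Finset.range T, x τ) / T

namespace OnOffSystem

variable {N : ℕ} {Ω : Type*} [MeasurableSpace Ω]

/-- Strong stability of queue `i`: `limsup_t (1/t) ∑_{τ<t} E[Q_i(τ)] < ∞`. -/
def StronglyStable (sys : OnOffSystem N Ω) (i : Fin N) : Prop :=
  limsup (slotAverage fun τ => ∫⁻ ω, (sys.Q i τ ω : ℝ≥0∞) ∂sys.P) atTop < ⊤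

/-- `m` is the time average number of packets in queue `i`: it is the limit of the expected time
averages, and almost surely also the limit of the time averages along the sample path. -/
def HasTimeAverage (sys : OnOffSystem N Ω) (i : Fin N) (m : ℝ≥0) : Prop :=
  Tendsto (slotAverage fun τ => ∫⁻ ω, (sys.Q i τ ω : ℝ≥0∞) ∂sys.P) atTop (𝓝 (m : ℝ≥0∞)) ∧
  ∀ᵐ ω ∂sys.P, Tendsto (slotAverage fun τ => (sys.Q i τ ω : ℝ≥0∞)) atTop (𝓝 (m : ℝ≥0∞))

/-- The arrival rate `λ_i = E[A_i(t)]`. -/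
noncomputable def lam (sys : OnOffSystem N Ω) (i : Fin N) : ℝ :=
  ∫ ω, (sys.A i 0 ω : ℝ) ∂sys.P

/-- `λ_tot = ∑ λ_i`. -/
noncomputable def lamTot (sys : OnOffSystem N Ω) : ℝ := ∑ i, sys.lam i

/-- `E[A_i(t)^2]`. -/
noncomputable def secondMoment (sys : OnOffSystem N Ω) (i : Fin N) : ℝ :=
  ∫ ω, (sys.A i 0 ω : ℝ) ^ 2 ∂sys.P

/-- `E[A_tot(t)^2]`, where `A_tot(t) = ∑ A_i(t)`. -/
noncomputable def secondMomentTot (sys : OnOffSystem N Ω) : ℝ :=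
  ∫ ω, (∑ i, (sys.A i 0 ω : ℝ)) ^ 2 ∂sys.P

/-- The smallest ON probability. (It is `0` by convention if `N = 0`.) -/
noncomputable def pMin (sys : OnOffSystem N Ω) : ℝ := ⨅ i, sys.p i

/-- The system is operated by the max-weight (longest connected queue) policy with a stationary
probabilistic tie breaking rule: the selected link is a time-independent function of the current
backlogs, the current channel states and the current seed, and it always has
the largest product `Q_i(t) S_i(t)`. -/
def IsLCQ (sys : OnOffSystem N Ω) : Prop :=
  ∃ g : (Fin N → ℕ) → (Fin N → Bool) → ℝ → Fin N,
    (∀ q s, Measurable (g q s)) ∧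
    (∀ (q : Fin N → ℕ) (s : Fin N → Bool) (u : ℝ) (j : Fin N),
      q j * (s j).toNat ≤ q (g q s u) * (s (g q s u)).toNat) ∧
    ∀ t ω, sys.sel t ω = some (g (fun i => sys.Q i t ω) (fun i => sys.S i t ω) (sys.U t ω))

/-- The number of packets that have joined queue `i` before slot `t`, including
the initial backlog. -/
def joined (sys : OnOffSystem N Ω) (i : Fin N) (t : ℕ) (ω : Ω) : ℕ :=
  sys.Q i 0 ω + ∑ s ∈ Finset.range t, sys.A i s ω

/-- The number of packets that have left queue `i` before slot `t`;
in slot `s` the number of departures is `min[Q_i(s), μ_i(s)]`. -/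
def departed (sys : OnOffSystem N Ω) (i : Fin N) (t : ℕ) (ω : Ω) : ℕ :=
  ∑ s ∈ Finset.range t, min (sys.Q i s ω) (linkRate (sys.sel s ω) (fun j => sys.S j s ω) i)

/-- The slot in which packet number `n` of queue `i` is transmitted (`⊤` if it never is). Packets of
a queue are numbered `0, 1, 2, …` in their order of arrival and are served in that order. -/
noncomputable def departureSlot (sys : OnOffSystem N Ω) (i : Fin N) (n : ℕ) (ω : Ω) : ℕ∞ :=
  ⨅ t : ℕ, ⨅ _ : n < sys.departed i (t + 1) ω, (t : ℕ∞)

/-- The total delay of all packets that arrive during the first `T` slots. The packets that arrive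
to queue `i` during slot `s` have the numbers `n` with `joined i s ≤ n < joined i (s + 1)`, and the
delay of a packet is its departure slot minus its arrival slot. -/
noncomputable def totalDelay (sys : OnOffSystem N Ω) (T : ℕ) (ω : Ω) : ℝ≥0∞ :=
  ∑ i, ∑ s ∈ Finset.range T, ∑ n ∈ Finset.Ico (sys.joined i s ω) (sys.joined i (s + 1) ω),
    ((sys.departureSlot i n ω - (s : ℕ∞) : ℕ∞) : ℝ≥0∞)

/-- The average delay of packets is `w`: almost surely, the average of the delays of
all packets that arrive during the first `T` slots converges to `w`. -/
def HasAverageDelay (sys : OnOffSystem N Ω) (w : ℝ≥0) : Prop :=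
  ∀ᵐ ω ∂sys.P, Tendsto
    (fun T : ℕ => sys.totalDelay T ω /
      ((∑ i, ∑ s ∈ Finset.range T, sys.A i s ω : ℕ) : ℝ≥0∞)) atTop (𝓝 (w : ℝ≥0∞))

end OnOffSystem

/-- The network capacity region `Λ` for ON probabilities `p`: the closure of the set of all arrival
rate vectors for which some control policy strongly stabilizes all queues. -/
def capacityRegion {N : ℕ} (p : Fin N → ℝ) : Set (Fin N → ℝ) :=
  closure {l | ∃ (Ω : Type) (_ : MeasurableSpace Ω) (sys : OnOffSystem N Ω),
    sys.p = p ∧ sys.lam = l ∧ ∀ i, sys.StronglyStable i}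

/-- `r_K = 1 - (1 - p_min)^K`. -/
noncomputable def rK (pmin : ℝ) (K : ℕ) : ℝ := 1 - (1 - pmin) ^ K

/-- `μ_K^sym = (1/K) [1 - (1 - p_min)^K]`, for positive `K`. -/
noncomputable def muSym (pmin : ℝ) (K : ℕ) : ℝ := 1 / (K : ℝ) * (1 - (1 - pmin) ^ K)

/-- The constant `θ`. -/
noncomputable def thetaConst (ρ pmin : ℝ) (N K : ℕ) : ℝ :=
  if K < N then (1 - ρ) * (muSym pmin K - muSym pmin N) / rK pmin (K + 1) else 0

/-- The constant `C`. -/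
noncomputable def cConst (ρ pmin lamTot : ℝ) (N K : ℕ) : ℝ :=
  if K < N then
    rK pmin (K + 1) / (rK pmin N * K * lamTot / (N * (1 - ρ)) +
      rK pmin K * (rK pmin (K + 1) - lamTot) / (1 - ρ))
  else 1 / rK pmin N

namespace OnOffSystem

variable {N : ℕ} {Ω : Type*} [MeasurableSpace Ω]

/-- The constant `B_θ`. -/
noncomputable def bConst (sys : OnOffSystem N Ω) (θ : ℝ) : ℝ :=
  sys.lamTot / 2 + 1 / 2 * ∑ i, sys.secondMoment i - ∑ i, sys.lam i ^ 2 +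
    θ / 2 * (sys.secondMomentTot + sys.lamTot - 2 * sys.lamTot ^ 2)

/-- The backlog bound `K B_θ C / (1 - ρ)^2`. -/
noncomputable def backlogBound (sys : OnOffSystem N Ω) (ρ : ℝ) (K : ℕ) : ℝ :=
  K * sys.bConst (thetaConst ρ sys.pMin N K) * cConst ρ sys.pMin sys.lamTot N K / (1 - ρ) ^ 2

/-- The delay bound
`min[K B_θ C / (λ_tot (1 - ρ)^2), N B_0 / (λ_tot r_N (1 - ρ))]`. -/
noncomputable def delayBound (sys : OnOffSystem N Ω) (ρ : ℝ) (K : ℕ) : ℝ :=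
  min (K * sys.bConst (thetaConst ρ sys.pMin N K) * cConst ρ sys.pMin sys.lamTot N K /
      (sys.lamTot * (1 - ρ) ^ 2))
    (N * sys.bConst 0 / (sys.lamTot * rK sys.pMin N * (1 - ρ)))

end OnOffSystem

/-- The choice `K = max[1, ⌈log(2/(1-ρ)) / log(1/(1-p_min))⌉ - 1]`. -/
noncomputable def logK (ρ pmin : ℝ) : ℕ :=
  max 1 (⌈Real.log (2 / (1 - ρ)) / Real.log (1 / (1 - pmin))⌉₊ - 1)

/-! The bounds come from an exact quadratic drift identity for LCQ, and the existence of the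
averages comes from regeneration at the empty state.

Capacity. In one slot a set `M` of queues loses at most one packet, and only if some channel of `M`
is ON. Strong stability therefore forces the total rate on `M` to be at most `onProb p M`, a
condition that survives the closure. Only this necessary half of the description of the capacity
region is needed. For rates in `ρΛ` every `M` has slack at least `(1 - ρ) * onProb p M`, which is at
least `(1 - ρ) r_{|M|}`, hence at least `(1 - ρ) |M| μ_n^sym` when `|M| ≤ n`, because `r_m / m`
decreases in `m`.

Drift. For LCQ the expected service weighted by backlog is the sum over levels `v` of the
probability that some queue longer than `v` is ON (`weight_eq_sum_levelSet`). Adding the slacks of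
the level sets gives `weighted_drift_ge`: a drift of at least `(1 - ρ) μ_n^sym q_tot`, where `n`
bounds the number of nonempty queues. With `n = N` this yields the bound of order `N / (1 - ρ)`. To
remove `N`, the potential receives `θ` times a quadratic in the total backlog. If more than `K`
queues are nonempty, the total service rate is at least `r_{K+1} > λ_tot` and the new term helps;
otherwise `n = K` is available and the new term costs at most `θ λ_tot q_tot`. The value of `θ`
balances the two cases (`weighted_drift_ge_of_card_lt`). Telescoping the drift bounds the time
averages (`IsDrivingNoise.timeAverage_le`).

Existence. Backlogs under LCQ form a countable chain driven by i.i.d. noise.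
`exists_hitting_lyapunov` modifies the potential to have negative drift at every nonempty state, so
the cycles between visits to the empty state have finite expected length and backlog. These cycles
are i.i.d.; the strong law together with Fatou's lemma and a Wald identity gives both kinds of time
averages (`IsDrivingNoise.exists_timeAverage`). Little's law is pathwise: counting packets by slot
turns total delay into total backlog, with negligible boundary terms since the empty state recurs
with positive frequency.

Order. The logarithmic `K` makes `r_{K+1} ≥ (1 + ρ) / 2`, so `r_{K+1} - λ_tot` is at least half of
`1 - ρ` and `C` stays bounded. -/

/-! ### Regeneration cycles along a deterministic path. -/

/-- The reward collected by the path `x` in its `k`-th cycle: the slots `t` such that `z` is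
visited exactly `k` times up to and including slot `t`. -/
noncomputable def cycleReward {σ : Type*} [DecidableEq σ] (f : σ → ℝ≥0∞) (z : σ) (x : ℕ → σ)
    (k : ℕ) : ℝ≥0∞ :=
  ∑' t, if Nat.count (x · = z) (t + 1) = k then f (x t) else 0

section Path

variable {σ : Type*} [DecidableEq σ] (f : σ → ℝ≥0∞) (z : σ) (x : ℕ → σ)

theorem sum_range_ite_eq_lt (m n : ℕ) (c : ℝ≥0∞) :
    (∑ k ∈ Finset.range n, if m = k then c else 0) = if m < n then c else 0 := by
  simp

theorem sum_cycleReward (n : ℕ) :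
    ∑ k ∈ Finset.range n, cycleReward f z x k =
      ∑' t, if Nat.count (x · = z) (t + 1) < n then f (x t) else 0 := by
  unfold cycleReward
  rw [← Summable.tsum_finsetSum (fun _ _ => ENNReal.summable)]
  exact tsum_congr fun t => sum_range_ite_eq_lt _ _ _

/-- Cycles with index below the number of visits before `T` are over by time `T`. Together with
`le_sum_cycleReward`, this traps the reward up to `T` between sums that differ by one cycle. -/
theorem sum_cycleReward_le (T : ℕ) :
    ∑ k ∈ Finset.range (Nat.count (x · = z) T), cycleReward f z x k ≤
      ∑ t ∈ Finset.range T, f (x t) := by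
  rw [sum_cycleReward, tsum_eq_sum (s := Finset.range T)]
  · exact Finset.sum_le_sum fun t _ => by split_ifs <;> simp
  · intro t ht
    rw [if_neg]
    have := Nat.count_monotone (x · = z) (a := T) (b := t + 1) (by simp at ht; omega)
    omega

theorem le_sum_cycleReward (T : ℕ) :
    ∑ t ∈ Finset.range T, f (x t) ≤
      ∑ k ∈ Finset.range (Nat.count (x · = z) T + 1), cycleReward f z x k := by
  rw [sum_cycleReward]
  refine le_trans (Finset.sum_le_sum fun t ht => ?_) (ENNReal.sum_le_tsum (Finset.range T))
  rw [if_pos]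
  have := Nat.count_monotone (x · = z) (a := t + 1) (b := T) (by simp at ht; omega)
  omega

theorem tsum_eq_tsum_nat_add (g : ℕ → ℝ≥0∞) (s : ℕ) (h : ∀ t < s, g t = 0) :
    ∑' t, g t = ∑' t, g (s + t) := by
  rw [← (ENNReal.summable (f := fun n => g (n + s))).sum_add_tsum_nat_add']
  rw [Finset.sum_eq_zero (fun t ht => h t (Finset.mem_range.1 ht)), zero_add]
  simp only [add_comm s]

theorem cycleReward_shift {s k : ℕ} (hk : Nat.count (x · = z) s = k) :
    cycleReward f z x (k + 1) = cycleReward f z (fun t => x (s + t)) 1 := by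
  unfold cycleReward
  rw [tsum_eq_tsum_nat_add _ s]
  · refine tsum_congr fun t => ?_
    rw [add_assoc, Nat.count_add, hk]
    simp
  · intro t ht
    rw [if_neg]
    have := Nat.count_monotone (x · = z) (a := t + 1) (b := s) (by omega)
    omega

theorem cycleReward_one_shift (hx : x 0 = z) :
    cycleReward f z x 1 = f z + cycleReward f z (fun t => x (t + 1)) 0 := by
  unfold cycleReward
  rw [tsum_eq_zero_add' ENNReal.summable]
  have h1 : Nat.count (x · = z) 1 = 1 := by simp [Nat.count_succ, hx]
  congr 1
  · simp [h1, hx]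
  · refine tsum_congr fun t => ?_
    rw [add_comm (t + 1) 1, Nat.count_add, h1]
    simp [add_comm]

/-- Cycles up to index `k` have ended when the visit at `s` starts cycle `k + 1`. The finite sum
shows that their rewards are determined by the path before `s`, which is what makes distinct cycles
independent. -/
theorem cycleReward_eq_of_le {s j k : ℕ} (hs : x s = z) (hk : Nat.count (x · = z) s = k)
    (hjk : j ≤ k) :
    cycleReward f z x j =
      ∑ t ∈ Finset.range s, if Nat.count (x · = z) (t + 1) = j then f (x t) else 0 := by
  unfold cycleReward
  rw [tsum_eq_sum (s := Finset.range s)]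
  intro t ht
  rw [if_neg]
  have := Nat.count_monotone (x · = z) (a := s + 1) (b := t + 1) (by simp at ht; omega)
  rw [Nat.count_succ, if_pos hs] at this
  omega

theorem exists_visit (hinf : ∀ s, ∃ t, x (s + t) = z) (k : ℕ) :
    ∃ s, x s = z ∧ Nat.count (x · = z) s = k := by
  have hI : {t | x t = z}.Infinite := by
    refine Set.infinite_of_not_bddAbove fun ⟨b, hb⟩ => ?_
    obtain ⟨t, ht⟩ := hinf (b + 1)
    have := hb (show b + 1 + t ∈ {t | x t = z} from ht)
    omega
  exact ⟨Nat.nth (x · = z) k, Nat.nth_mem_of_infinite hI k, Nat.count_nth_of_infinite hI k⟩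

theorem tendsto_count_atTop (hinf : ∀ s, ∃ t, x (s + t) = z) :
    Tendsto (fun T => Nat.count (x · = z) T) atTop atTop := by
  refine tendsto_atTop_atTop.2 fun k => ?_
  obtain ⟨s, -, hs⟩ := exists_visit z x hinf k
  exact ⟨s, fun T hT => hs ▸ Nat.count_monotone _ hT⟩

/-- If the averages of the cycle rewards converge, then so do the slot averages. -/
theorem tendsto_slotAverage_of_cycles (hinf : ∀ s, ∃ t, x (s + t) = z) {y l : ℝ≥0∞}
    (hy0 : cycleReward f z x 0 ≠ ⊤) (hl0 : cycleReward (fun _ => 1) z x 0 ≠ ⊤)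
    (hytop : y ≠ ⊤) (hl : l ≠ 0) (hltop : l ≠ ⊤)
    (hy : Tendsto (fun n : ℕ => (∑ k ∈ Finset.range n, cycleReward f z x (k + 1)) / (n : ℝ≥0∞))
      atTop (𝓝 y))
    (hlim : Tendsto (fun n : ℕ =>
      (∑ k ∈ Finset.range n, cycleReward (fun _ => 1) z x (k + 1)) / (n : ℝ≥0∞)) atTop (𝓝 l)) :
    Tendsto (slotAverage fun t => f (x t)) atTop (𝓝 (y / l)) ∧
    Tendsto (fun T : ℕ => (Nat.count (x · = z) T : ℝ≥0∞) / T) atTop (𝓝 l⁻¹) := by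
  have hcount := tendsto_count_atTop z x hinf
  -- Normalized by the number of visits, the reward is squeezed between cycle averages; cycle `0`
  -- has a different law but is finite and washes out. Using this for `f` and for the constant `1`
  -- and dividing gives reward per slot.
  have key : ∀ (g : σ → ℝ≥0∞) (y : ℝ≥0∞), cycleReward g z x 0 ≠ ⊤ → y ≠ ⊤ →
      Tendsto (fun n : ℕ => (∑ k ∈ Finset.range n, cycleReward g z x (k + 1)) / (n : ℝ≥0∞))
        atTop (𝓝 y) →
      Tendsto (fun T : ℕ => (∑ t ∈ Finset.range T, g (x t)) / (Nat.count (x · = z) T : ℝ≥0∞))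
        atTop (𝓝 y) := by
    intro g y h0 hytop hy
    have hupper : Tendsto (fun n : ℕ =>
        (∑ k ∈ Finset.range (n + 1), cycleReward g z x k) / (n : ℝ≥0∞)) atTop (𝓝 y) := by
      simp only [Finset.sum_range_succ', ENNReal.add_div]
      have h1 : Tendsto (fun n : ℕ => cycleReward g z x 0 / (n : ℝ≥0∞)) atTop (𝓝 0) :=
        ENNReal.Tendsto.const_div ENNReal.tendsto_nat_nhds_top (Or.inr h0) |>.trans (by simp)
      simpa using hy.add h1
    have hlower : Tendsto (fun n : ℕ =>
        (∑ k ∈ Finset.range n, cycleReward g z x k) / (n : ℝ≥0∞)) atTop (𝓝 y) := by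
      rw [← tendsto_add_atTop_iff_nat 1]
      have h2 : Tendsto (fun n : ℕ => (n : ℝ≥0∞) / ((n + 1 : ℕ) : ℝ≥0∞)) atTop (𝓝 1) := by
        have := ENNReal.tendsto_ofReal (tendsto_natCast_div_add_atTop (1 : ℝ))
        rw [ENNReal.ofReal_one] at this
        refine this.congr fun n => ?_
        rw [ENNReal.ofReal_div_of_pos (by positivity)]
        norm_cast
      have h3 := ENNReal.Tendsto.mul hupper (Or.inr ENNReal.one_ne_top) h2 (Or.inr hytop)
      rw [mul_one] at h3
      refine h3.congr' ?_
      filter_upwards [eventually_gt_atTop 0] with n hn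
      have hn' : (n : ℝ≥0∞) ≠ 0 := by exact_mod_cast hn.ne'
      rw [div_eq_mul_inv, div_eq_mul_inv, mul_assoc, ← mul_assoc (n : ℝ≥0∞)⁻¹,
        ENNReal.inv_mul_cancel hn' (by simp), one_mul, ← div_eq_mul_inv]
    refine tendsto_of_tendsto_of_tendsto_of_le_of_le (hlower.comp hcount) (hupper.comp hcount)
      (fun T => ?_) (fun T => ?_)
    · exact ENNReal.div_le_div_right (sum_cycleReward_le g z x T) _
    · exact ENNReal.div_le_div_right (le_sum_cycleReward g z x T) _
  have hf := key f y hy0 hytop hy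
  have h1 := key (fun _ => 1) l hl0 hltop hlim
  simp only [Finset.sum_const, Finset.card_range, nsmul_eq_mul, mul_one] at h1
  have hinv : Tendsto (fun T : ℕ => (Nat.count (x · = z) T : ℝ≥0∞) / T) atTop (𝓝 l⁻¹) := by
    refine (tendsto_inv_iff.2 h1).congr' ?_
    filter_upwards [eventually_gt_atTop 0] with T hT
    rw [ENNReal.inv_div (Or.inl (by simp)) (Or.inr (by simpa using hT.ne'))]
  refine ⟨?_, hinv⟩
  have := ENNReal.Tendsto.div hf (Or.inr hl) h1 (Or.inl hltop)
  refine this.congr' ?_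
  filter_upwards [hcount.eventually_gt_atTop 0] with T hT
  unfold slotAverage
  have hn' : (Nat.count (x · = z) T : ℝ≥0∞) ≠ 0 := by exact_mod_cast hT.ne'
  rw [div_eq_mul_inv _ (Nat.count (x · = z) T : ℝ≥0∞), div_eq_mul_inv _ (Nat.count (x · = z) T : ℝ≥0∞),
    ENNReal.mul_div_mul_right _ _ (by simp) (by simpa using hn')]

end Path

/-! ### Chains driven by stationary noise, and rewards before hitting a state. -/

/-- The path of the dynamical system `q ↦ F q e` started at `q` and driven by the sequence `e`. -/
def chainPath {σ E : Type*} (F : σ → E → σ) (q : σ) (e : ℕ → E) : ℕ → σ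
  | 0 => q
  | t + 1 => F (chainPath F q e t) (e t)

theorem chainPath_add {σ E : Type*} (F : σ → E → σ) (q : σ) (e : ℕ → E) (s t : ℕ) :
    chainPath F q e (s + t) = chainPath F (chainPath F q e s) (fun r => e (s + r)) t := by
  induction t with
  | zero => rfl
  | succ t ih => rw [← add_assoc, chainPath, ih, chainPath]

theorem chainPath_succ' {σ E : Type*} (F : σ → E → σ) (q : σ) (e : ℕ → E) (t : ℕ) :
    chainPath F q e (t + 1) = chainPath F (F q (e 0)) (fun r => e (r + 1)) t := by
  rw [add_comm, chainPath_add]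
  simp only [add_comm 1, chainPath]

/-- The sequence `ξ` is adapted to the filtration `𝓕` with a delay of one slot, and at all times
`s` its future from time `s` on is independent of `𝓕 s` and has the law `κ`. -/
structure IsDrivingNoise {Ω E : Type*} [mΩ : MeasurableSpace Ω] [MeasurableSpace E] (P : Measure Ω)
    (𝓕 : ℕ → MeasurableSpace Ω) (ξ : ℕ → Ω → E) (κ : Measure (ℕ → E)) : Prop where
  le : ∀ s, 𝓕 s ≤ mΩ
  mono : Monotone 𝓕
  meas : ∀ t, Measurable[𝓕 (t + 1)] (ξ t)
  law : ∀ s, P.map (fun ω t => ξ (s + t) ω) = κ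
  indep : ∀ s, Indep (𝓕 s) (MeasurableSpace.comap (fun ω t => ξ (s + t) ω) inferInstance) P

theorem measurable_count_path {Ω σ : Type*} {m : MeasurableSpace Ω} [MeasurableSpace σ]
    [MeasurableSingletonClass σ] [DecidableEq σ] {X : ℕ → Ω → σ} (z : σ) (s : ℕ)
    (hX : ∀ r < s, Measurable (X r)) : Measurable fun ω => Nat.count (X · ω = z) s := by
  induction s with
  | zero => simp
  | succ s ih =>
    simp only [Nat.count_succ]
    refine (ih fun r hr => hX r (by omega)).add ?_
    exact Measurable.ite (hX s (by omega) (measurableSet_singleton z)) measurable_const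
      measurable_const

theorem measurable_cycleReward {Ω σ : Type*} {m : MeasurableSpace Ω} [MeasurableSpace σ]
    [MeasurableSingletonClass σ] [Countable σ] [DecidableEq σ] {X : ℕ → Ω → σ} (f : σ → ℝ≥0∞)
    (z : σ) (k : ℕ) (hX : ∀ r, Measurable (X r)) :
    Measurable fun ω => cycleReward f z (X · ω) k := by
  unfold cycleReward
  refine Measurable.tsum fun t => ?_
  refine Measurable.ite ?_ ((measurable_of_countable f).comp (hX t)) measurable_const
  exact measurable_count_path z (t + 1) (fun r _ => hX r) (measurableSet_singleton k)

theorem measurable_chainPath {Ω σ E : Type*} {m : MeasurableSpace Ω} [MeasurableSpace E]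
    [MeasurableSpace σ] [MeasurableSingletonClass σ] [Countable σ] {F : σ → E → σ}
    (hF : ∀ q, Measurable (F q)) {X₀ : Ω → σ} {ξ : ℕ → Ω → E} (hX₀ : Measurable X₀) (t : ℕ)
    (hξ : ∀ r < t, Measurable (ξ r)) :
    Measurable fun ω => chainPath F (X₀ ω) (ξ · ω) t := by
  induction t with
  | zero => exact hX₀
  | succ t ih =>
    have hF' : Measurable (fun x : σ × E => F x.1 x.2) :=
      measurable_from_prod_countable_right hF
    exact hF'.comp ((ih fun r hr => hξ r (by omega)).prodMk (hξ t (by omega)))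

namespace IsDrivingNoise

variable {Ω E : Type*} [mΩ : MeasurableSpace Ω] [MeasurableSpace E] {P : Measure Ω}
  {𝓕 : ℕ → MeasurableSpace Ω} {ξ : ℕ → Ω → E} {κ : Measure (ℕ → E)}

theorem measurable (h : IsDrivingNoise P 𝓕 ξ κ) (t : ℕ) : Measurable (ξ t) := (h.meas t).mono (h.le _) le_rfl

theorem measurable_future (h : IsDrivingNoise P 𝓕 ξ κ) (s : ℕ) : Measurable fun ω t => ξ (s + t) ω :=
  measurable_pi_lambda _ fun t => h.measurable (s + t)

theorem isProbabilityMeasure [IsProbabilityMeasure P] (h : IsDrivingNoise P 𝓕 ξ κ) :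
    IsProbabilityMeasure κ :=
  h.law 0 ▸ Measure.isProbabilityMeasure_map (h.measurable_future 0).aemeasurable

theorem map_prod_future [IsProbabilityMeasure P] (h : IsDrivingNoise P 𝓕 ξ κ) {β : Type*} [MeasurableSpace β] (s : ℕ) {Y : Ω → β}
    (hY : Measurable[𝓕 s] Y) :
    P.map (fun ω => (Y ω, fun t => ξ (s + t) ω)) = (P.map Y).prod κ := by
  have hind : IndepFun Y (fun ω t => ξ (s + t) ω) P := by
    rw [IndepFun_iff_Indep]
    exact indep_of_indep_of_le_left (h.indep s) hY.comap_le
  rw [(indepFun_iff_map_prod_eq_prod_map_map (hY.mono (h.le s) le_rfl).aemeasurable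
    (h.measurable_future s).aemeasurable).1 hind, h.law s]

/-- This is the Markov property: by independence and Fubini, the noise from `s` on can be replaced
by a fresh copy with law `κ`. -/
theorem lintegral_future [IsProbabilityMeasure P] (h : IsDrivingNoise P 𝓕 ξ κ) {β : Type*} [MeasurableSpace β] (s : ℕ) {Y : Ω → β}
    (hY : Measurable[𝓕 s] Y) {G : β → (ℕ → E) → ℝ≥0∞} (hG : Measurable (Function.uncurry G)) :
    ∫⁻ ω, G (Y ω) (fun t => ξ (s + t) ω) ∂P = ∫⁻ ω, ∫⁻ e, G (Y ω) e ∂κ ∂P := by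
  have := h.isProbabilityMeasure
  have hYm := hY.mono (h.le s) le_rfl
  have h1 : ∫⁻ x, Function.uncurry G x ∂(P.map (fun ω => (Y ω, fun t => ξ (s + t) ω))) =
      ∫⁻ x, Function.uncurry G x ∂((P.map Y).prod κ) := by rw [h.map_prod_future s hY]
  rw [lintegral_map hG (hYm.prodMk (h.measurable_future s)), lintegral_prod _ hG.aemeasurable,
    lintegral_map hG.lintegral_prod_right' hYm] at h1
  exact h1

theorem lintegral_first_step [IsProbabilityMeasure P] (h : IsDrivingNoise P 𝓕 ξ κ) {G : E → (ℕ → E) → ℝ≥0∞} (hG : Measurable (Function.uncurry G)) :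
    ∫⁻ e, G (e 0) (fun t => e (t + 1)) ∂κ = ∫⁻ ω, ∫⁻ e, G (ξ 0 ω) e ∂κ ∂P := by
  rw [← h.lintegral_future 1 (h.meas 0) hG]
  conv_lhs => rw [← h.law 0]
  have hG' : Measurable fun e : ℕ → E => G (e 0) (fun t => e (t + 1)) :=
    hG.comp (f := fun e : ℕ → E => (e 0, fun t => e (t + 1))) (by fun_prop)
  rw [lintegral_map hG' (h.measurable_future 0)]
  simp only [zero_add, add_comm 1]

theorem ae_future (h : IsDrivingNoise P 𝓕 ξ κ) {p : (ℕ → E) → Prop} (hp : ∀ᵐ e ∂κ, p e) (s : ℕ) :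
    ∀ᵐ ω ∂P, p fun t => ξ (s + t) ω := by
  rw [← h.law s] at hp
  exact ae_of_ae_map (h.measurable_future s).aemeasurable hp

variable {σ : Type*} [MeasurableSpace σ] [MeasurableSingletonClass σ] [Countable σ] [DecidableEq σ]
  {F : σ → E → σ} {z : σ}

/-- Foster's criterion: `V` pays for the reward `f` of each slot before the first visit to `z`. For
a finite horizon this follows by conditioning on the first step, with an induction over all starting
states at once; the horizon then goes to infinity by monotone convergence. -/
theorem lintegral_cycleReward_zero_le [IsProbabilityMeasure P] (h : IsDrivingNoise P 𝓕 ξ κ) (hF : ∀ q, Measurable (F q))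
    {f V : σ → ℝ≥0∞} (hV : ∀ q, q ≠ z → f q + ∫⁻ ω, V (F q (ξ 0 ω)) ∂P ≤ V q) (q : σ) :
    ∫⁻ e, cycleReward f z (chainPath F q e) 0 ∂κ ≤ V q := by
  have hpath : ∀ q t, Measurable fun e : ℕ → E => chainPath F q e t := fun q t =>
    measurable_chainPath hF measurable_const t fun r _ => measurable_pi_apply r
  have hterm : ∀ q t, Measurable fun e : ℕ → E =>
      if Nat.count (chainPath F q e · = z) (t + 1) = 0 then f (chainPath F q e t) else 0 := by
    intro q t
    refine Measurable.ite ?_ ((measurable_of_countable f).comp (hpath q t)) measurable_const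
    exact measurable_count_path z (t + 1) (fun r _ => hpath q r) (measurableSet_singleton 0)
  have hpartial : ∀ (n : ℕ) (q : σ), ∫⁻ e, ∑ t ∈ Finset.range n,
      (if Nat.count (chainPath F q e · = z) (t + 1) = 0 then f (chainPath F q e t) else 0) ∂κ
        ≤ V q := by
    intro n
    induction n with
    | zero => simp
    | succ n ih =>
      intro q
      by_cases hq : q = z
      -- Started at `z`, cycle `0` is empty, so no drift condition at `z` is required.
      · have h0 : ∀ e : ℕ → E, ∀ t, Nat.count (chainPath F q e · = z) (t + 1) ≠ 0 := by
          intro e t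
          rw [add_comm, Nat.count_add]
          simp [Nat.count_succ, chainPath, hq]
        simp [h0]
      · refine le_trans (le_of_eq ?_) (le_trans (add_le_add_right
          (lintegral_mono fun ω => ih (F q (ξ 0 ω))) (f q)) (hV q hq))
        have := h.isProbabilityMeasure
        let G : E → (ℕ → E) → ℝ≥0∞ := fun a e => ∑ t ∈ Finset.range n,
          (if Nat.count (chainPath F (F q a) e · = z) (t + 1) = 0
            then f (chainPath F (F q a) e t) else 0)
        have hG : Measurable (Function.uncurry G) := by
          have hp : ∀ t, Measurable fun x : E × (ℕ → E) => chainPath F (F q x.1) x.2 t :=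
            fun t => measurable_chainPath (ξ := fun t (x : E × (ℕ → E)) => x.2 t) hF
              ((hF q).comp measurable_fst) t
              fun r _ => (measurable_pi_apply r).comp measurable_snd
          refine Finset.measurable_sum _ fun t _ => ?_
          refine Measurable.ite ?_ ((measurable_of_countable f).comp (hp t)) measurable_const
          exact measurable_count_path z (t + 1) (fun r _ => hp r) (measurableSet_singleton 0)
        rw [← h.lintegral_first_step hG]
        calc _ = ∫⁻ e, (f q + G (e 0) fun t => e (t + 1)) ∂κ := by
              refine lintegral_congr fun e => ?_
              have h1 : Nat.count (chainPath F q e · = z) 1 = 0 := by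
                simp [Nat.count_succ, chainPath, hq]
              rw [Finset.sum_range_succ', add_comm]
              congr 1
              · simp [h1, chainPath]
              · refine Finset.sum_congr rfl fun t _ => ?_
                rw [add_comm (t + 1) 1, Nat.count_add, h1, zero_add]
                simp only [add_comm 1, chainPath_succ']
          _ = _ := by
              rw [lintegral_add_left measurable_const]
              simp
  unfold cycleReward
  rw [lintegral_tsum fun t => (hterm q t).aemeasurable]
  refine ENNReal.tsum_le_of_sum_range_le fun n => ?_
  rw [← lintegral_finsetSum _ fun t _ => hterm q t]
  exact hpartial n q

end IsDrivingNoise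

/-! ### The strong Markov property at visits and the renewal reward theorem. -/

/-- The strong law of large numbers for pairwise independent extended nonnegative variables. -/
theorem strong_law_ae_ennreal {Ω : Type*} [MeasurableSpace Ω] {P : Measure Ω} (X : ℕ → Ω → ℝ≥0∞)
    (hm : ∀ i, Measurable (X i)) (hint : ∫⁻ ω, X 0 ω ∂P ≠ ⊤)
    (hindep : Pairwise (Function.onFun (IndepFun · · P) X))
    (hident : ∀ i, IdentDistrib (X i) (X 0) P P) :
    ∀ᵐ ω ∂P, Tendsto (fun n : ℕ => (∑ i ∈ Finset.range n, X i ω) / (n : ℝ≥0∞)) atTop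
      (𝓝 (∫⁻ ω, X 0 ω ∂P)) := by
  have hfin : ∀ᵐ ω ∂P, ∀ i, X i ω < ⊤ := ae_all_iff.2 fun i =>
    ae_lt_top (hm i) ((hident i).lintegral_eq ▸ hint)
  have hslln := strong_law_ae_real (fun i ω => (X i ω).toReal)
    (integrable_toReal_of_lintegral_ne_top (hm 0).aemeasurable hint)
    (fun i j hij => (hindep hij).comp ENNReal.measurable_toReal ENNReal.measurable_toReal)
    (fun i => (hident i).comp ENNReal.measurable_toReal)
  have hreal : ∫ ω, (X 0 ω).toReal ∂P = (∫⁻ ω, X 0 ω ∂P).toReal :=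
    integral_toReal (hm 0).aemeasurable (hfin.mono fun ω h => h 0)
  filter_upwards [hfin, hslln] with ω hω hlim
  rw [hreal] at hlim
  have := ENNReal.tendsto_ofReal hlim
  rw [ENNReal.ofReal_toReal hint] at this
  refine this.congr' ?_
  filter_upwards [eventually_gt_atTop 0] with n hn
  rw [ENNReal.ofReal_div_of_pos (by exact_mod_cast hn), ENNReal.ofReal_natCast,
    ENNReal.ofReal_sum_of_nonneg fun _ _ => ENNReal.toReal_nonneg]
  simp only [ENNReal.ofReal_toReal (hω _).ne]

namespace IsDrivingNoise

variable {Ω E : Type*} [mΩ : MeasurableSpace Ω] [MeasurableSpace E] {P : Measure Ω}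
  {𝓕 : ℕ → MeasurableSpace Ω} {ξ : ℕ → Ω → E} {κ : Measure (ℕ → E)}
  {σ : Type*} [MeasurableSpace σ] [MeasurableSingletonClass σ] [Countable σ]
  {F : σ → E → σ}

theorem measurable_path (h : IsDrivingNoise P 𝓕 ξ κ) (hF : ∀ q, Measurable (F q)) {X₀ : Ω → σ}
    (hX₀ : Measurable[𝓕 0] X₀) {s t : ℕ} (hst : t ≤ s) :
    Measurable[𝓕 s] fun ω => chainPath F (X₀ ω) (ξ · ω) t :=
  measurable_chainPath (m := 𝓕 s) hF (hX₀.mono (h.mono (Nat.zero_le s)) le_rfl) t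
    fun r hr => (h.meas r).mono (h.mono (by omega)) le_rfl

theorem measurable_path' (h : IsDrivingNoise P 𝓕 ξ κ) (hF : ∀ q, Measurable (F q)) {X₀ : Ω → σ}
    (hX₀ : Measurable[𝓕 0] X₀) (t : ℕ) :
    Measurable fun ω => chainPath F (X₀ ω) (ξ · ω) t :=
  (h.measurable_path hF hX₀ le_rfl).mono (h.le t) le_rfl

variable [DecidableEq σ] {z : σ}

theorem measurable_cycleReward_chainPath (hF : ∀ q, Measurable (F q)) (f : σ → ℝ≥0∞) (k : ℕ) :
    Measurable fun x : σ × (ℕ → E) => cycleReward f z (chainPath F x.1 x.2) k := by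
  refine measurable_cycleReward f z k fun r => ?_
  exact measurable_chainPath (ξ := fun t (x : σ × (ℕ → E)) => x.2 t) hF measurable_fst r
    fun r _ => (measurable_pi_apply r).comp measurable_snd

/-- If `z` is visited infinitely often, then the law of the reward of the cycle that starts with
the visit number `k` is not affected by conditioning on the past of that visit. -/
theorem measure_inter_cycleReward [IsProbabilityMeasure P] (h : IsDrivingNoise P 𝓕 ξ κ)
    (hF : ∀ q, Measurable (F q)) {X₀ : Ω → σ} (hX₀ : Measurable[𝓕 0] X₀)
    (hinf : ∀ᵐ ω ∂P, ∀ s, ∃ t, chainPath F (X₀ ω) (ξ · ω) (s + t) = z)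
    (f : σ → ℝ≥0∞) (k : ℕ) {B : Set Ω} (hB : MeasurableSet B)
    (hBs : ∀ s, MeasurableSet[𝓕 s] (B ∩ {ω | chainPath F (X₀ ω) (ξ · ω) s = z ∧
      Nat.count (chainPath F (X₀ ω) (ξ · ω) · = z) s = k}))
    {D : Set ℝ≥0∞} (hD : MeasurableSet D) :
    P (B ∩ {ω | cycleReward f z (chainPath F (X₀ ω) (ξ · ω)) (k + 1) ∈ D}) =
      P B * κ {e | cycleReward f z (chainPath F z e) 1 ∈ D} := by
  set X : ℕ → Ω → σ := fun t ω => chainPath F (X₀ ω) (ξ · ω) t with hX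
  set A : ℕ → Set Ω := fun s => {ω | X s ω = z ∧ Nat.count (X · ω = z) s = k} with hA
  have hXm : ∀ t, Measurable (X t) := fun t => h.measurable_path' hF hX₀ t
  have hAm : ∀ s, MeasurableSet (A s) := fun s =>
    (hXm s (measurableSet_singleton z)).inter
      (measurable_count_path z s (fun r _ => hXm r) (measurableSet_singleton k))
  have hdisj : Pairwise (Function.onFun Disjoint A) := by
    have key : ∀ ω, ∀ i j, i < j → ω ∈ A i → ω ∈ A j → False := by
      rintro ω i j hij ⟨hi, hi'⟩ ⟨-, hj'⟩
      have h1 := Nat.count_monotone (X · ω = z) (show i + 1 ≤ j from hij)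
      rw [Nat.count_succ, if_pos hi] at h1
      omega
    intro i j hij
    refine Set.disjoint_left.2 fun ω hi hj => ?_
    rcases lt_or_gt_of_ne hij with hlt | hlt
    · exact key ω i j hlt hi hj
    · exact key ω j i hlt hj hi
  -- The slot `s` of visit number `k` partitions the space up to a null set, so the strong Markov
  -- property reduces to the Markov property at each fixed `s`.
  have hdecomp : ∀ C : Set Ω, MeasurableSet C → P C = ∑' s, P (C ∩ A s) := by
    intro C hC
    rw [← measure_iUnion (fun i j hij => (hdisj hij).mono Set.inter_subset_right
      Set.inter_subset_right) (fun s => hC.inter (hAm s)), ← Set.inter_iUnion]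
    refine (measure_congr ?_)
    filter_upwards [hinf] with ω hω
    obtain ⟨s, hs⟩ := exists_visit z (X · ω) hω k
    refine propext ⟨fun hc => ⟨hc, Set.mem_iUnion.2 ⟨s, hs⟩⟩, fun hc => hc.1⟩
  have hRm : Measurable fun ω => cycleReward f z (X · ω) (k + 1) :=
    measurable_cycleReward f z (k + 1) hXm
  have hR1 : Measurable fun e : ℕ → E => cycleReward f z (chainPath F z e) 1 :=
    (measurable_cycleReward_chainPath (z := z) hF f 1).comp measurable_prodMk_left
  refine (hdecomp _ (hB.inter (hRm hD))).trans ?_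
  rw [hdecomp B hB, ← ENNReal.tsum_mul_right]
  refine tsum_congr fun s => ?_
  -- Given that the visit occurs at `s`, cycle `k + 1` is a function of the noise from `s` on alone,
  -- since the chain restarts at `z`.
  have hset : (B ∩ {ω | cycleReward f z (X · ω) (k + 1) ∈ D}) ∩ A s =
      (B ∩ A s) ∩ (fun ω t => ξ (s + t) ω) ⁻¹' {e | cycleReward f z (chainPath F z e) 1 ∈ D} := by
    ext ω
    have : ω ∈ A s → cycleReward f z (X · ω) (k + 1) =
        cycleReward f z (chainPath F z fun t => ξ (s + t) ω) 1 := by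
      rintro ⟨h1, h2⟩
      rw [cycleReward_shift f z (X · ω) h2]
      simp only [hX] at h1 ⊢
      simp only [chainPath_add, h1]
    simp only [Set.mem_inter_iff, Set.mem_ofPred_eq, Set.mem_preimage]
    constructor
    · rintro ⟨⟨hb, hd⟩, ha⟩
      exact ⟨⟨hb, ha⟩, this ha ▸ hd⟩
    · rintro ⟨⟨hb, ha⟩, hd⟩
      exact ⟨⟨hb, (this ha).symm ▸ hd⟩, ha⟩
  refine (congrArg P hset).trans ?_
  refine ((Indep_iff _ _ _).1 (h.indep s) _ _ (hBs s) ⟨_, hR1 hD, rfl⟩).trans ?_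
  rw [← h.law s]
  congr 1
  exact (Measure.map_apply (h.measurable_future s) (hR1 hD)).symm

section Recurrent

variable [IsProbabilityMeasure P] {w V : σ → ℝ≥0∞} {X₀ : Ω → σ}

/-- A path that avoids `z` collects at least `1` per slot forever in cycle `0`, contradicting its
finite expected reward. Countability of the state space makes this hold for all restarting states
simultaneously. -/
theorem ae_forall_exists_visit (h : IsDrivingNoise P 𝓕 ξ κ) (hF : ∀ q, Measurable (F q))
    (hw : ∀ q, 1 ≤ w q) (hVtop : ∀ q, V q ≠ ⊤)
    (hV : ∀ q, q ≠ z → w q + ∫⁻ ω, V (F q (ξ 0 ω)) ∂P ≤ V q) :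
    ∀ᵐ ω ∂P, ∀ s, ∃ t, chainPath F (X₀ ω) (ξ · ω) (s + t) = z := by
  have hκ : ∀ᵐ e ∂κ, ∀ q, ∃ t, chainPath F q e t = z := by
    refine ae_all_iff.2 fun q => ?_
    have hint := ((h.lintegral_cycleReward_zero_le hF hV q).trans_lt (hVtop q).lt_top).ne
    have hm : Measurable fun e : ℕ → E => cycleReward w z (chainPath F q e) 0 :=
      (measurable_cycleReward_chainPath hF w 0).comp measurable_prodMk_left
    filter_upwards [ae_lt_top hm hint] with e he
    by_contra! hne
    refine he.ne (top_unique ?_)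
    have hcount : ∀ t, Nat.count (chainPath F q e · = z) t = 0 := by
      intro t
      rw [Nat.count_eq_card_filter_range]
      simp [hne]
    unfold cycleReward
    simp only [hcount, if_true]
    calc (⊤ : ℝ≥0∞) = ∑' _ : ℕ, 1 := by simp
      _ ≤ _ := ENNReal.tsum_le_tsum fun t => hw _
  have := ae_all_iff.2 fun s => h.ae_future hκ s
  filter_upwards [this] with ω hω s
  obtain ⟨t, ht⟩ := hω s (chainPath F (X₀ ω) (ξ · ω) s)
  exact ⟨t, by rw [chainPath_add]; exact ht⟩

theorem lintegral_cycleReward_one_ne_top (h : IsDrivingNoise P 𝓕 ξ κ) (hF : ∀ q, Measurable (F q))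
    {f : σ → ℝ≥0∞} (hfz : f z ≠ ⊤) (hz : ∫⁻ ω, V (F z (ξ 0 ω)) ∂P ≠ ⊤)
    (hV : ∀ q, q ≠ z → f q + ∫⁻ ω, V (F q (ξ 0 ω)) ∂P ≤ V q) :
    ∫⁻ e, cycleReward f z (chainPath F z e) 1 ∂κ ≠ ⊤ := by
  have := h.isProbabilityMeasure
  have h1 : ∀ e : ℕ → E, cycleReward f z (chainPath F z e) 1 =
      f z + cycleReward f z (chainPath F (F z (e 0)) fun t => e (t + 1)) 0 := by
    intro e
    rw [cycleReward_one_shift f z _ rfl]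
    simp only [chainPath_succ']
  simp only [h1]
  rw [lintegral_add_left measurable_const]
  have hm : Measurable (Function.uncurry fun (a : E) (e : ℕ → E) =>
      cycleReward f z (chainPath F (F z a) e) 0) :=
    (measurable_cycleReward_chainPath hF f 0).comp
      (((hF z).comp measurable_fst).prodMk measurable_snd)
  rw [h.lintegral_first_step hm]
  refine ENNReal.add_ne_top.2 ⟨by simpa using hfz, ne_top_of_le_ne_top hz ?_⟩
  exact lintegral_mono fun ω => h.lintegral_cycleReward_zero_le hF hV _

theorem lintegral_cycleReward_zero_ne_top (h : IsDrivingNoise P 𝓕 ξ κ) (hF : ∀ q, Measurable (F q))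
    (hX₀ : Measurable[𝓕 0] X₀) {f : σ → ℝ≥0∞} (h0 : ∫⁻ ω, V (X₀ ω) ∂P ≠ ⊤)
    (hV : ∀ q, q ≠ z → f q + ∫⁻ ω, V (F q (ξ 0 ω)) ∂P ≤ V q) :
    ∫⁻ ω, cycleReward f z (chainPath F (X₀ ω) (ξ · ω)) 0 ∂P ≠ ⊤ := by
  have := h.lintegral_future 0 hX₀ (G := fun q e => cycleReward f z (chainPath F q e) 0)
    (measurable_cycleReward_chainPath hF f 0)
  simp only [zero_add] at this
  rw [this]
  refine ne_top_of_le_ne_top h0 ?_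
  exact lintegral_mono fun ω => h.lintegral_cycleReward_zero_le hF hV _

/-- A chain driven by an i.i.d. sequence that has negative drift `-w` off the state `z` has time
averages of all functions dominated by `w`. -/
theorem exists_timeAverage (h : IsDrivingNoise P 𝓕 ξ κ) (hF : ∀ q, Measurable (F q))
    (hX₀ : Measurable[𝓕 0] X₀) (hw : ∀ q, 1 ≤ w q) (hwz : w z ≠ ⊤) (hVtop : ∀ q, V q ≠ ⊤)
    (hV : ∀ q, q ≠ z → w q + ∫⁻ ω, V (F q (ξ 0 ω)) ∂P ≤ V q)
    (hz : ∫⁻ ω, V (F z (ξ 0 ω)) ∂P ≠ ⊤) (h0 : ∫⁻ ω, V (X₀ ω) ∂P ≠ ⊤) :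
    (∃ π : ℝ≥0∞, π ≠ 0 ∧ π ≠ ⊤ ∧ ∀ᵐ ω ∂P,
      (∀ s, ∃ t, chainPath F (X₀ ω) (ξ · ω) (s + t) = z) ∧
      Tendsto (fun T : ℕ => (Nat.count (chainPath F (X₀ ω) (ξ · ω) · = z) T : ℝ≥0∞) / T)
        atTop (𝓝 π)) ∧
    ∀ (f : σ → ℝ≥0∞) (c : ℝ≥0∞), c ≠ ⊤ → (∀ q, f q ≤ c * w q) → ∃ m : ℝ≥0,
      Tendsto (slotAverage fun t => ∫⁻ ω, f (chainPath F (X₀ ω) (ξ · ω) t) ∂P) atTop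
        (𝓝 (m : ℝ≥0∞)) ∧
      ∀ᵐ ω ∂P, Tendsto (slotAverage fun t => f (chainPath F (X₀ ω) (ξ · ω) t)) atTop
        (𝓝 (m : ℝ≥0∞)) := by
  have hκ := h.isProbabilityMeasure
  have hinf := h.ae_forall_exists_visit hF hw hVtop hV (X₀ := X₀)
  have hXm := h.measurable_path' hF hX₀
  have hR1 : ∀ f : σ → ℝ≥0∞, Measurable fun e : ℕ → E => cycleReward f z (chainPath F z e) 1 :=
    fun f => (measurable_cycleReward_chainPath (z := z) hF f 1).comp measurable_prodMk_left
  have hRm : ∀ (f : σ → ℝ≥0∞) k,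
      Measurable fun ω => cycleReward f z (chainPath F (X₀ ω) (ξ · ω)) k :=
    fun f k => measurable_cycleReward f z k hXm
  have hAm : ∀ s k, MeasurableSet[𝓕 s] {ω | chainPath F (X₀ ω) (ξ · ω) s = z ∧
      Nat.count (chainPath F (X₀ ω) (ξ · ω) · = z) s = k} := fun s k =>
    MeasurableSet.inter (h.measurable_path hF hX₀ le_rfl (measurableSet_singleton z))
      (measurable_count_path (m := 𝓕 s) z s (fun r hr => h.measurable_path hF hX₀ hr.le)
        (measurableSet_singleton k))
  have hlaw : ∀ (f : σ → ℝ≥0∞) k {B : Set Ω}, MeasurableSet B →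
      (∀ s, MeasurableSet[𝓕 s] (B ∩ {ω | chainPath F (X₀ ω) (ξ · ω) s = z ∧
        Nat.count (chainPath F (X₀ ω) (ξ · ω) · = z) s = k})) →
      (P.restrict B).map (fun ω => cycleReward f z (chainPath F (X₀ ω) (ξ · ω)) (k + 1)) =
        P B • κ.map (fun e => cycleReward f z (chainPath F z e) 1) := by
    intro f k B hB hBs
    ext D hD
    rw [Measure.map_apply (hRm f _) hD, Measure.restrict_apply (hRm f _ hD), Set.inter_comm,
      Measure.smul_apply, Measure.map_apply (hR1 f) hD, smul_eq_mul]
    exact h.measure_inter_cycleReward hF hX₀ hinf f k hB hBs hD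
  have hlaw_univ : ∀ (f : σ → ℝ≥0∞) k,
      P.map (fun ω => cycleReward f z (chainPath F (X₀ ω) (ξ · ω)) (k + 1)) =
        κ.map (fun e => cycleReward f z (chainPath F z e) 1) := by
    intro f k
    have := hlaw f k MeasurableSet.univ fun s => by simpa using hAm s k
    simpa using this
  have hslln : ∀ (f : σ → ℝ≥0∞), ∫⁻ e, cycleReward f z (chainPath F z e) 1 ∂κ ≠ ⊤ →
      ∀ᵐ ω ∂P, Tendsto (fun n : ℕ => (∑ k ∈ Finset.range n,
        cycleReward f z (chainPath F (X₀ ω) (ξ · ω)) (k + 1)) / (n : ℝ≥0∞)) atTop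
        (𝓝 (∫⁻ e, cycleReward f z (chainPath F z e) 1 ∂κ)) := by
    intro f hf
    have hmean : ∫⁻ ω, cycleReward f z (chainPath F (X₀ ω) (ξ · ω)) (0 + 1) ∂P =
        ∫⁻ e, cycleReward f z (chainPath F z e) 1 ∂κ := by
      have := lintegral_map (μ := P) measurable_id (hRm f (0 + 1))
      rw [hlaw_univ, lintegral_map measurable_id (hR1 f)] at this
      exact this.symm
    rw [← hmean] at hf ⊢
    refine strong_law_ae_ennreal
      (fun k ω => cycleReward f z (chainPath F (X₀ ω) (ξ · ω)) (k + 1)) (fun k => hRm f _) hf ?_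
      fun k => ⟨(hRm f _).aemeasurable, (hRm f _).aemeasurable, by rw [hlaw_univ, hlaw_univ]⟩
    -- On the event that visit number `k` occurs at `s`, cycle `j + 1` is already over and hence
    -- measurable with respect to `𝓕 s`. The strong Markov property then gives independence from
    -- cycle `k + 1`.
    have hlt : ∀ j k, j < k →
        IndepFun (fun ω => cycleReward f z (chainPath F (X₀ ω) (ξ · ω)) (j + 1))
          (fun ω => cycleReward f z (chainPath F (X₀ ω) (ξ · ω)) (k + 1)) P := by
      intro j k hjk
      refine indepFun_iff_measure_inter_preimage_eq_mul.2 fun D' D hD' hD => ?_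
      have h2 : P ((fun ω => cycleReward f z (chainPath F (X₀ ω) (ξ · ω)) (k + 1)) ⁻¹' D) =
          κ {e | cycleReward f z (chainPath F z e) 1 ∈ D} := by
        rw [← Measure.map_apply (hRm f _) hD, hlaw_univ, Measure.map_apply (hR1 f) hD]
        rfl
      rw [h2]
      refine h.measure_inter_cycleReward hF hX₀ hinf f k (hRm f _ hD') (fun s => ?_) hD
      have hset : (fun ω => cycleReward f z (chainPath F (X₀ ω) (ξ · ω)) (j + 1)) ⁻¹' D' ∩
          {ω | chainPath F (X₀ ω) (ξ · ω) s = z ∧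
            Nat.count (chainPath F (X₀ ω) (ξ · ω) · = z) s = k} =
          (fun ω => ∑ t ∈ Finset.range s,
            if Nat.count (chainPath F (X₀ ω) (ξ · ω) · = z) (t + 1) = j + 1
              then f (chainPath F (X₀ ω) (ξ · ω) t) else 0) ⁻¹' D' ∩
          {ω | chainPath F (X₀ ω) (ξ · ω) s = z ∧
            Nat.count (chainPath F (X₀ ω) (ξ · ω) · = z) s = k} := by
        ext ω
        refine and_congr_left fun hω => ?_
        simp only [Set.mem_preimage]
        rw [cycleReward_eq_of_le f z _ hω.1 hω.2 hjk]
      rw [hset]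
      refine MeasurableSet.inter (Finset.measurable_sum _ (fun t ht => ?_) hD') (hAm s k)
      have hts : t < s := Finset.mem_range.1 ht
      refine Measurable.ite ?_ ((measurable_of_countable f).comp
        (h.measurable_path hF hX₀ hts.le)) measurable_const
      exact measurable_count_path (m := 𝓕 s) z (t + 1)
        (fun r hr => h.measurable_path hF hX₀ (by omega)) (measurableSet_singleton _)
    intro j k hjk
    rcases lt_or_gt_of_ne hjk with hlt' | hlt'
    · exact hlt j k hlt'
    · exact (hlt k j hlt').symm
  -- Domination of `f` by `c * w` makes `c * V` a Lyapunov function for the reward `f`.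
  have hscaled : ∀ (f : σ → ℝ≥0∞) (c : ℝ≥0∞), (∀ q, f q ≤ c * w q) → ∀ q, q ≠ z →
      f q + ∫⁻ ω, c * V (F q (ξ 0 ω)) ∂P ≤ c * V q := by
    intro f c hfc q hq
    rw [lintegral_const_mul]
    · calc _ ≤ c * w q + c * ∫⁻ ω, V (F q (ξ 0 ω)) ∂P := by gcongr; exact hfc q
        _ = c * (w q + ∫⁻ ω, V (F q (ξ 0 ω)) ∂P) := by rw [mul_add]
        _ ≤ _ := by gcongr; exact hV q hq
    · exact (measurable_of_countable V).comp ((hF q).comp (h.measurable 0))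
  have hone : ∀ (f : σ → ℝ≥0∞) (c : ℝ≥0∞), c ≠ ⊤ → (∀ q, f q ≤ c * w q) →
      ∫⁻ e, cycleReward f z (chainPath F z e) 1 ∂κ ≠ ⊤ := by
    intro f c hc hfc
    refine h.lintegral_cycleReward_one_ne_top hF (V := fun q => c * V q)
      (ne_top_of_le_ne_top (ENNReal.mul_ne_top hc hwz) (hfc z)) ?_ (hscaled f c hfc)
    have hm : Measurable fun ω => V (F z (ξ 0 ω)) :=
      (measurable_of_countable V).comp ((hF z).comp (h.measurable 0))
    rw [lintegral_const_mul _ hm]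
    exact ENNReal.mul_ne_top hc hz
  have hzero : ∀ (f : σ → ℝ≥0∞) (c : ℝ≥0∞), c ≠ ⊤ → (∀ q, f q ≤ c * w q) →
      ∫⁻ ω, cycleReward f z (chainPath F (X₀ ω) (ξ · ω)) 0 ∂P ≠ ⊤ := by
    intro f c hc hfc
    refine h.lintegral_cycleReward_zero_ne_top hF hX₀ (V := fun q => c * V q) ?_ (hscaled f c hfc)
    have hm : Measurable fun ω => V (X₀ ω) := (measurable_of_countable V).comp (hXm 0)
    rw [lintegral_const_mul _ hm]
    exact ENNReal.mul_ne_top hc h0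
  set l := ∫⁻ e, cycleReward (fun _ => 1) z (chainPath F z e) 1 ∂κ with hl
  have hw1 : ∀ q, (fun _ => 1 : σ → ℝ≥0∞) q ≤ 1 * w q := fun q => by simpa using hw q
  have hltop : l ≠ ⊤ := hone _ 1 ENNReal.one_ne_top hw1
  have hl0 : l ≠ 0 := by
    have : (1 : ℝ≥0∞) ≤ l := by
      calc (1 : ℝ≥0∞) = ∫⁻ _ : ℕ → E, 1 ∂κ := by simp
        _ ≤ l := lintegral_mono fun e => by
          rw [cycleReward_one_shift _ z _ rfl]
          exact le_self_add
    exact (lt_of_lt_of_le one_pos this).ne'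
  have hpath : ∀ (f : σ → ℝ≥0∞) (c : ℝ≥0∞), c ≠ ⊤ → (∀ q, f q ≤ c * w q) → ∀ᵐ ω ∂P,
      Tendsto (slotAverage fun t => f (chainPath F (X₀ ω) (ξ · ω) t)) atTop
        (𝓝 ((∫⁻ e, cycleReward f z (chainPath F z e) 1 ∂κ) / l)) ∧
      Tendsto (fun T : ℕ => (Nat.count (chainPath F (X₀ ω) (ξ · ω) · = z) T : ℝ≥0∞) / T) atTop
        (𝓝 l⁻¹) := by
    intro f c hc hfc
    filter_upwards [hinf, hslln f (hone f c hc hfc), hslln _ hltop,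
      ae_lt_top (hRm f 0) (hzero f c hc hfc),
      ae_lt_top (hRm (fun _ => 1) 0) (hzero _ 1 ENNReal.one_ne_top hw1)] with ω h1 h2 h3 h4 h5
    exact tendsto_slotAverage_of_cycles f z _ h1 h4.ne h5.ne (hone f c hc hfc) hl0 hltop h2 h3
  refine ⟨⟨l⁻¹, ENNReal.inv_ne_zero.2 hltop, ENNReal.inv_ne_top.2 hl0, ?_⟩, fun f c hc hfc => ?_⟩
  · filter_upwards [hinf, hpath _ 1 ENNReal.one_ne_top hw1] with ω h1 h2
    exact ⟨h1, h2.2⟩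
  set y := ∫⁻ e, cycleReward f z (chainPath F z e) 1 ∂κ with hy
  have hytop : y ≠ ⊤ := hone f c hc hfc
  have hm : y / l ≠ ⊤ := ENNReal.div_ne_top hytop hl0
  refine ⟨(y / l).toNNReal, ?_, ?_⟩
  swap
  · rw [ENNReal.coe_toNNReal hm]
    exact (hpath f c hc hfc).mono fun ω hω => hω.1
  rw [ENNReal.coe_toNNReal hm]
  have hcm : ∀ T, Measurable fun ω => (Nat.count (chainPath F (X₀ ω) (ξ · ω) · = z) T : ℝ≥0∞) :=
    fun T => (measurable_of_countable (fun n : ℕ => (n : ℝ≥0∞))).comp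
      (measurable_count_path z T fun r _ => hXm r)
  have hfm : ∀ t, Measurable fun ω => f (chainPath F (X₀ ω) (ξ · ω) t) := fun t =>
    (measurable_of_countable f).comp (hXm t)
  have hswap : ∀ T, slotAverage (fun t => ∫⁻ ω, f (chainPath F (X₀ ω) (ξ · ω) t) ∂P) T =
      ∫⁻ ω, slotAverage (fun t => f (chainPath F (X₀ ω) (ξ · ω) t)) T ∂P := by
    intro T
    unfold slotAverage
    simp only [div_eq_mul_inv]
    rw [lintegral_mul_const _ (Finset.measurable_sum _ fun t _ => hfm t),
      lintegral_finsetSum _ fun t _ => hfm t]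
  have hsam : ∀ T, Measurable fun ω => slotAverage (fun t => f (chainPath F (X₀ ω) (ξ · ω) t)) T :=
    fun T => (Finset.measurable_sum _ fun t _ => hfm t).div_const _
  have hcount : Tendsto (fun T : ℕ =>
      ∫⁻ ω, (Nat.count (chainPath F (X₀ ω) (ξ · ω) · = z) T : ℝ≥0∞) / T ∂P) atTop (𝓝 l⁻¹) := by
    have := tendsto_lintegral_of_dominated_convergence (μ := P) (f := fun _ => l⁻¹)
      (fun _ => 1) (fun T => (hcm T).div_const (T : ℝ≥0∞)) (fun T => ?_) (by simp)
      ((hpath f c hc hfc).mono fun ω hω => hω.2)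
    · simpa using this
    · refine Eventually.of_forall fun ω => ENNReal.div_le_of_le_mul ?_
      rw [one_mul]
      exact_mod_cast Nat.count_le _
  -- This is a Wald identity: whether cycle `k + 1` starts before `T` is decided at its start, so
  -- each started cycle contributes its full mean `y`, and the expected number of started cycles is
  -- the expected number of visits.
  have hbound : ∀ T : ℕ, slotAverage (fun t => ∫⁻ ω, f (chainPath F (X₀ ω) (ξ · ω) t) ∂P) T ≤
      (∫⁻ ω, cycleReward f z (chainPath F (X₀ ω) (ξ · ω)) 0 ∂P) / T +
        y * ∫⁻ ω, (Nat.count (chainPath F (X₀ ω) (ξ · ω) · = z) T : ℝ≥0∞) / T ∂P := by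
    intro T
    set B : ℕ → Set Ω := fun k => {ω | k < Nat.count (chainPath F (X₀ ω) (ξ · ω) · = z) T} with hB
    have hBm : ∀ k, MeasurableSet (B k) := fun k =>
      measurable_count_path z T (fun r _ => hXm r) (measurableSet_Ioi (a := k))
    have hBs : ∀ k s, MeasurableSet[𝓕 s] (B k ∩ {ω | chainPath F (X₀ ω) (ξ · ω) s = z ∧
        Nat.count (chainPath F (X₀ ω) (ξ · ω) · = z) s = k}) := by
      intro k s
      -- If visit number `k` occurs at `s`, then `B k` holds exactly when `s < T`, so the
      -- intersection is trivially known at time `s`.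
      by_cases hs : s < T
      · rw [Set.inter_eq_right.2]
        · exact hAm s k
        · rintro ω ⟨hω, hω'⟩
          have := Nat.count_monotone (chainPath F (X₀ ω) (ξ · ω) · = z) (show s + 1 ≤ T from hs)
          rw [Nat.count_succ, if_pos hω] at this
          show k < _
          omega
      · convert @MeasurableSet.empty Ω (𝓕 s)
        refine Set.eq_empty_of_forall_notMem fun ω => ?_
        rintro ⟨hω, -, hω'⟩
        have := Nat.count_monotone (chainPath F (X₀ ω) (ξ · ω) · = z) (not_lt.1 hs)
        have hω : k < Nat.count (chainPath F (X₀ ω) (ξ · ω) · = z) T := hω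
        omega
    have hcyc : ∀ k, ∫⁻ ω in B k, cycleReward f z (chainPath F (X₀ ω) (ξ · ω)) (k + 1) ∂P =
        P (B k) * y := by
      intro k
      have := lintegral_map (μ := P.restrict (B k)) measurable_id (hRm f (k + 1))
      rw [hlaw f k (hBm k) (hBs k), lintegral_smul_measure, lintegral_map measurable_id (hR1 f)]
        at this
      exact this.symm
    have hPB : ∑' k, P (B k) =
        ∫⁻ ω, (Nat.count (chainPath F (X₀ ω) (ξ · ω) · = z) T : ℝ≥0∞) ∂P := by
      simp only [← lintegral_indicator_one (hBm _)]
      rw [← lintegral_tsum fun k => (measurable_one.indicator (hBm k)).aemeasurable]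
      refine lintegral_congr fun ω => ?_
      simp only [Set.indicator, hB, Set.mem_ofPred_eq, Pi.one_apply]
      rw [tsum_eq_sum (s := Finset.range (Nat.count (chainPath F (X₀ ω) (ξ · ω) · = z) T))
        (fun k hk => if_neg (by simpa using hk)),
        Finset.sum_congr rfl fun k hk => if_pos (Finset.mem_range.1 hk)]
      simp
    have hsum : ∫⁻ ω, ∑ t ∈ Finset.range T, f (chainPath F (X₀ ω) (ξ · ω) t) ∂P ≤
        ∫⁻ ω, cycleReward f z (chainPath F (X₀ ω) (ξ · ω)) 0 ∂P +
          y * ∫⁻ ω, (Nat.count (chainPath F (X₀ ω) (ξ · ω) · = z) T : ℝ≥0∞) ∂P := by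
      calc _ ≤ ∫⁻ ω, (cycleReward f z (chainPath F (X₀ ω) (ξ · ω)) 0 + ∑' k,
            (B k).indicator
              (fun ω => cycleReward f z (chainPath F (X₀ ω) (ξ · ω)) (k + 1)) ω) ∂P := by
            refine lintegral_mono fun ω => (le_sum_cycleReward f z _ T).trans ?_
            rw [Finset.sum_range_succ', add_comm]
            gcongr
            rw [← Finset.sum_congr rfl fun k hk =>
              Set.indicator_of_mem (s := B k) (Finset.mem_range.1 hk)
                (fun ω => cycleReward f z (chainPath F (X₀ ω) (ξ · ω)) (k + 1))]
            exact ENNReal.sum_le_tsum _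
        _ = _ := by
            rw [lintegral_add_left (hRm f 0),
              lintegral_tsum fun k => ((hRm f (k + 1)).indicator (hBm k)).aemeasurable]
            simp only [lintegral_indicator (hBm _), hcyc]
            rw [ENNReal.tsum_mul_right, hPB, mul_comm]
    rw [lintegral_finsetSum _ fun t _ => hfm t] at hsum
    unfold slotAverage
    simp only [div_eq_mul_inv]
    rw [lintegral_mul_const _ (hcm T), ← mul_assoc, ← add_mul]
    gcongr
  have hup : Tendsto (fun T : ℕ =>
      (∫⁻ ω, cycleReward f z (chainPath F (X₀ ω) (ξ · ω)) 0 ∂P) / T +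
        y * ∫⁻ ω, (Nat.count (chainPath F (X₀ ω) (ξ · ω) · = z) T : ℝ≥0∞) / T ∂P) atTop
      (𝓝 (y / l)) := by
    have h1 : Tendsto (fun T : ℕ =>
        (∫⁻ ω, cycleReward f z (chainPath F (X₀ ω) (ξ · ω)) 0 ∂P) / (T : ℝ≥0∞)) atTop (𝓝 0) :=
      (ENNReal.Tendsto.const_div ENNReal.tendsto_nat_nhds_top
        (Or.inr (hzero f c hc hfc))).trans (by simp)
    simpa [div_eq_mul_inv] using h1.add (ENNReal.Tendsto.const_mul hcount (Or.inr hytop))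
  -- Almost sure convergence gives the lower bound for the expectations through Fatou's lemma; the
  -- Wald bound gives the upper one.
  refine tendsto_of_le_liminf_of_limsup_le ?_ ?_
  · have := lintegral_liminf_le (μ := P) (u := atTop) hsam
    rw [lintegral_congr_ae ((hpath f c hc hfc).mono fun ω hω => hω.1.liminf_eq)] at this
    simp only [lintegral_const, measure_univ, mul_one, ← hswap] at this
    exact this
  · exact (limsup_le_limsup (Eventually.of_forall hbound)).trans hup.limsup_eq.le

end Recurrent

end IsDrivingNoise

/-! ### Little's law along a sample path. -/

section LittlePath

variable {J D : ℕ → ℕ}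

theorem sum_range_sum_Ico {M : Type*} [AddCommMonoid M] (hJ : Monotone J) (g : ℕ → M) (m : ℕ) :
    ∑ s ∈ Finset.range m, ∑ n ∈ Finset.Ico (J s) (J (s + 1)), g n =
      ∑ n ∈ Finset.Ico (J 0) (J m), g n := by
  induction m with
  | zero => simp
  | succ m ih =>
    rw [Finset.sum_range_succ, ih,
      Finset.sum_Ico_consecutive g (hJ (Nat.zero_le m)) (hJ (Nat.le_succ m))]

/-- Packet `n` departs in slot `t₀` exactly when `D τ ≤ n` is equivalent to `τ ≤ t₀`. Its delay thus
counts the slots after `s` at whose beginning it is still present, and any horizon `H` past its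
departure captures them all. -/
theorem delay_eq_sum (hD : Monotone D) (hD0 : D 0 = 0) {s n H : ℕ}
    (hH : n < D H) :
    (((⨅ t : ℕ, ⨅ _ : n < D (t + 1), (t : ℕ∞)) - (s : ℕ∞) : ℕ∞) : ℝ≥0∞) =
      ∑ τ ∈ Finset.range H, if s < τ ∧ D τ ≤ n then 1 else 0 := by
  have hex : ∃ t, n < D (t + 1) := ⟨H, hH.trans_le (hD (Nat.le_succ H))⟩
  have hspec := Nat.find_spec hex
  have hmin : ∀ t, n < D (t + 1) → Nat.find hex ≤ t := fun t ht => Nat.find_min' hex ht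
  set t₀ := Nat.find hex with ht₀
  have hd : (⨅ t : ℕ, ⨅ _ : n < D (t + 1), (t : ℕ∞)) = t₀ := by
    refine le_antisymm (iInf₂_le t₀ hspec) (le_iInf₂ fun t ht => ?_)
    exact_mod_cast hmin t ht
  have hlt : ∀ τ, D τ ≤ n ↔ τ ≤ t₀ := by
    intro τ
    constructor
    · intro hτ
      by_contra! hlt
      exact absurd (hD (show t₀ + 1 ≤ τ from hlt)) (by omega)
    · intro hτ
      rcases Nat.eq_zero_or_pos τ with rfl | hpos
      · omega
      · by_contra! hn
        have := hmin (τ - 1) (by rwa [Nat.sub_add_cancel hpos])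
        omega
  have hHt : t₀ < H := by
    have := (hlt H).not.1 (by omega)
    omega
  rw [hd, Finset.sum_boole]
  have hcard : (Finset.range H).filter (fun τ => s < τ ∧ D τ ≤ n) = Finset.Ioc s t₀ := by
    ext τ
    simp only [Finset.mem_filter, Finset.mem_range, Finset.mem_Ioc, hlt]
    omega
  rw [hcard, Nat.card_Ioc, ← ENat.natCast_sub, ENat.toENNReal_coe]

variable (hJ : Monotone J) (hD : Monotone D) (hD0 : D 0 = 0)
include hJ hD hD0

/-- Exchanging sums counts, for each slot, the packets that arrived in the first `T` slots and are
still waiting. The maximum with `J 0` excludes the initial packets. -/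
theorem totalDelay_path_eq {T H : ℕ} (hTH : J T ≤ D H) :
    ∑ s ∈ Finset.range T, ∑ n ∈ Finset.Ico (J s) (J (s + 1)),
      (((⨅ t : ℕ, ⨅ _ : n < D (t + 1), (t : ℕ∞)) - (s : ℕ∞) : ℕ∞) : ℝ≥0∞) =
    ∑ τ ∈ Finset.range H, ((J (min T τ) - max (J 0) (D τ) : ℕ) : ℝ≥0∞) := by
  have h1 : ∀ s ∈ Finset.range T, ∀ n ∈ Finset.Ico (J s) (J (s + 1)),
      (((⨅ t : ℕ, ⨅ _ : n < D (t + 1), (t : ℕ∞)) - (s : ℕ∞) : ℕ∞) : ℝ≥0∞) =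
        ∑ τ ∈ Finset.range H, if s < τ ∧ D τ ≤ n then 1 else 0 := by
    intro s hs n hn
    rw [Finset.mem_Ico] at hn
    refine delay_eq_sum hD hD0 (hn.2.trans_le ((hJ ?_).trans hTH))
    exact Finset.mem_range.1 hs
  rw [Finset.sum_congr rfl fun s hs => Finset.sum_congr rfl (h1 s hs)]
  rw [Finset.sum_congr rfl fun s _ => Finset.sum_comm, Finset.sum_comm]
  refine Finset.sum_congr rfl fun τ _ => ?_
  have h2 : ∀ s ∈ Finset.range T, (∑ n ∈ Finset.Ico (J s) (J (s + 1)),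
      if s < τ ∧ D τ ≤ n then (1 : ℝ≥0∞) else 0) =
      if s < τ then ∑ n ∈ Finset.Ico (J s) (J (s + 1)), if D τ ≤ n then (1 : ℝ≥0∞) else 0
        else 0 := by
    intro s _
    by_cases hs : s < τ <;> simp [hs]
  have h3 : (Finset.range T).filter (· < τ) = Finset.range (min T τ) := by
    ext s
    simp
  rw [Finset.sum_congr rfl h2, ← Finset.sum_filter, h3, sum_range_sum_Ico hJ, Finset.sum_boole]
  have h4 : (Finset.Ico (J 0) (J (min T τ))).filter (fun n => D τ ≤ n) =
      Finset.Ico (max (J 0) (D τ)) (J (min T τ)) := by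
    ext n
    simp only [Finset.mem_filter, Finset.mem_Ico, max_le_iff]
    tauto
  rw [h4, Nat.card_Ico]

theorem totalDelay_path_le {T H : ℕ} (hTH : J T ≤ D H) :
    ∑ s ∈ Finset.range T, ∑ n ∈ Finset.Ico (J s) (J (s + 1)),
      (((⨅ t : ℕ, ⨅ _ : n < D (t + 1), (t : ℕ∞)) - (s : ℕ∞) : ℕ∞) : ℝ≥0∞) ≤
    ∑ τ ∈ Finset.range H, ((J τ - D τ : ℕ) : ℝ≥0∞) := by
  rw [totalDelay_path_eq hJ hD hD0 hTH]
  refine Finset.sum_le_sum fun τ _ => ?_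
  have h1 := hJ (min_le_right T τ)
  have h2 := le_max_right (J 0) (D τ)
  exact_mod_cast (by omega : J (min T τ) - max (J 0) (D τ) ≤ J τ - D τ)

/-- Initial packets contribute to the backlog but not to the delay. There are `J 0` of them and all
are gone from `t₀` on, so the discrepancy is bounded independently of `T`. -/
theorem le_totalDelay_path {T H t₀ : ℕ} (hTH : J T ≤ D H) (hle : T ≤ H) (ht₀ : J 0 ≤ D t₀) :
    ∑ τ ∈ Finset.range T, ((J τ - D τ : ℕ) : ℝ≥0∞) ≤
      (∑ s ∈ Finset.range T, ∑ n ∈ Finset.Ico (J s) (J (s + 1)),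
        (((⨅ t : ℕ, ⨅ _ : n < D (t + 1), (t : ℕ∞)) - (s : ℕ∞) : ℕ∞) : ℝ≥0∞)) +
      ((t₀ * J 0 : ℕ) : ℝ≥0∞) := by
  rw [totalDelay_path_eq hJ hD hD0 hTH]
  calc ∑ τ ∈ Finset.range T, ((J τ - D τ : ℕ) : ℝ≥0∞)
      ≤ ∑ τ ∈ Finset.range T, (((J (min T τ) - max (J 0) (D τ) : ℕ) : ℝ≥0∞) +
          if τ < t₀ then (J 0 : ℝ≥0∞) else 0) := by
        refine Finset.sum_le_sum fun τ hτ => ?_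
        rw [min_eq_right (Finset.mem_range.1 hτ).le]
        have hJ0 := hJ (Nat.zero_le τ)
        split_ifs with hlt
        · rcases max_cases (J 0) (D τ) with h | h
          · exact_mod_cast (by omega : J τ - D τ ≤ J τ - max (J 0) (D τ) + J 0)
          · exact_mod_cast (by omega : J τ - D τ ≤ J τ - max (J 0) (D τ) + J 0)
        · rw [add_zero, max_eq_right (ht₀.trans (hD (not_lt.1 hlt)))]
    _ ≤ _ := by
        rw [Finset.sum_add_distrib]
        refine add_le_add (Finset.sum_le_sum_of_subset (Finset.range_mono hle)) ?_
        rw [← Finset.sum_filter, Finset.sum_const, nsmul_eq_mul]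
        push_cast
        gcongr
        calc _ ≤ (Finset.range t₀).card := Finset.card_le_card fun τ hτ => by simp at hτ ⊢; omega
          _ = t₀ := Finset.card_range t₀

end LittlePath

/-- The first visit at or after time `T` takes place at a time asymptotic to `T` if visits have a
positive frequency. -/
theorem exists_next_visit {σ : Type*} [DecidableEq σ] (z : σ) (x : ℕ → σ)
    (hinf : ∀ s, ∃ t, x (s + t) = z) {π : ℝ≥0∞} (hπ0 : π ≠ 0) (hπ : π ≠ ⊤)
    (hlim : Tendsto (fun T : ℕ => (Nat.count (x · = z) T : ℝ≥0∞) / T) atTop (𝓝 π)) :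
    ∃ H : ℕ → ℕ, (∀ T, T ≤ H T) ∧ (∀ T, x (H T) = z) ∧
      Tendsto (fun T : ℕ => (H T : ℝ≥0∞) / T) atTop (𝓝 1) := by
  set H : ℕ → ℕ := fun T => T + Nat.find (hinf T) with hH
  have hle : ∀ T, T ≤ H T := fun T => Nat.le_add_right _ _
  refine ⟨H, hle, fun T => Nat.find_spec (hinf T), ?_⟩
  have hcount : ∀ T, Nat.count (x · = z) (H T) = Nat.count (x · = z) T := by
    intro T
    rw [hH, Nat.count_add]
    simp only [Nat.add_eq_left, Nat.count_eq_card_filter_range, Finset.card_eq_zero,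
      Finset.filter_eq_empty_iff, Finset.mem_range]
    exact fun t ht => Nat.find_min (hinf T) ht
  have hHtop : Tendsto H atTop atTop := tendsto_atTop_mono hle tendsto_id
  -- No visit occurs between `T` and `H T`, so both visit counts agree and the quotient of the two
  -- frequencies is `H T / T`.
  have h1 := ENNReal.Tendsto.div hlim (Or.inl hπ0) (hlim.comp hHtop) (Or.inl hπ)
  rw [ENNReal.div_self hπ0 hπ] at h1
  refine h1.congr' ?_
  filter_upwards [(tendsto_count_atTop z x hinf).eventually_gt_atTop 0, eventually_gt_atTop 0]
    with T hT hT0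
  have hc0 : (Nat.count (x · = z) T : ℝ≥0∞) ≠ 0 := by exact_mod_cast hT.ne'
  have hH0 : (H T : ℝ≥0∞) ≠ 0 := by exact_mod_cast (hT0.trans_le (hle T)).ne'
  simp only [Function.comp, hcount]
  rw [div_eq_mul_inv (_ / _), ENNReal.inv_div (Or.inl (by simp)) (Or.inl hH0), div_eq_mul_inv,
    div_eq_mul_inv, div_eq_mul_inv, mul_comm _ (T : ℝ≥0∞)⁻¹, mul_assoc, ← mul_assoc _ _ (_⁻¹),
    mul_comm _ (H T : ℝ≥0∞), mul_assoc, ENNReal.mul_inv_cancel hc0 (by simp), mul_one, mul_comm]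

namespace OnOffSystem

variable {N : ℕ} {Ω : Type*} [MeasurableSpace Ω] (sys : OnOffSystem N Ω)

theorem joined_mono (i : Fin N) (ω : Ω) : Monotone fun t => sys.joined i t ω :=
  monotone_nat_of_le_succ fun t => by
    unfold joined
    rw [Finset.sum_range_succ]
    omega

theorem departed_mono (i : Fin N) (ω : Ω) : Monotone fun t => sys.departed i t ω :=
  monotone_nat_of_le_succ fun t => by
    unfold departed
    rw [Finset.sum_range_succ]
    omega

theorem joined_eq (i : Fin N) (t : ℕ) (ω : Ω) :
    sys.joined i t ω = sys.Q i t ω + sys.departed i t ω := by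
  induction t with
  | zero => simp [joined, departed]
  | succ t ih =>
    have h1 : sys.joined i (t + 1) ω = sys.joined i t ω + sys.A i t ω := by
      unfold joined
      rw [Finset.sum_range_succ, add_assoc]
    have h2 : sys.departed i (t + 1) ω = sys.departed i t ω +
        min (sys.Q i t ω) (linkRate (sys.sel t ω) (fun j => sys.S j t ω) i) := by
      unfold departed
      rw [Finset.sum_range_succ]
    rw [h1, h2, ih, sys.dynamics]
    omega

/-- Little's law along a sample path: if the system empties with positive frequency, then the
average delay is the average backlog divided by the average number of arrivals per slot. -/
theorem tendsto_averageDelay {ω : Ω} {π : ℝ≥0∞} (hπ0 : π ≠ 0) (hπ : π ≠ ⊤) {m : Fin N → ℝ≥0}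
    {l : ℝ≥0∞} (hl0 : l ≠ 0) (hl : l ≠ ⊤)
    (hinf : ∀ s, ∃ t, (fun i => sys.Q i (s + t) ω) = 0)
    (hcount : Tendsto (fun T : ℕ =>
      (Nat.count (fun t => (fun i => sys.Q i t ω) = 0) T : ℝ≥0∞) / T) atTop (𝓝 π))
    (hQ : ∀ i, Tendsto (slotAverage fun τ => (sys.Q i τ ω : ℝ≥0∞)) atTop (𝓝 (m i : ℝ≥0∞)))
    (hA : Tendsto (fun T : ℕ => ((∑ i, ∑ s ∈ Finset.range T, sys.A i s ω : ℕ) : ℝ≥0∞) / T)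
      atTop (𝓝 l)) :
    Tendsto (fun T : ℕ => sys.totalDelay T ω /
      ((∑ i, ∑ s ∈ Finset.range T, sys.A i s ω : ℕ) : ℝ≥0∞)) atTop
      (𝓝 ((∑ i, (m i : ℝ≥0∞)) / l)) := by
  -- The system is empty at `H T`, so every packet that joined before `T` has left by then. The
  -- total delay lies between the backlog summed to `T`, up to a constant, and the backlog summed to
  -- `H T`.
  obtain ⟨H, hle, hvisit, hlim⟩ :=
    exists_next_visit 0 (fun t i => sys.Q i t ω) hinf hπ0 hπ hcount
  have hempty : ∀ i T, sys.joined i T ω ≤ sys.departed i (H T) ω := by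
    intro i T
    have h1 : sys.Q i (H T) ω = 0 := congrFun (hvisit T) i
    have h2 := sys.joined_eq i (H T) ω
    have h3 : sys.joined i T ω ≤ sys.joined i (H T) ω := sys.joined_mono i ω (hle T)
    omega
  have hQeq : ∀ i t, sys.joined i t ω - sys.departed i t ω = sys.Q i t ω := fun i t => by
    rw [joined_eq]
    omega
  have hdep0 : ∀ i, sys.departed i 0 ω = 0 := fun i => by simp [departed]
  have hupper : ∀ i T, (∑ s ∈ Finset.range T,
      ∑ n ∈ Finset.Ico (sys.joined i s ω) (sys.joined i (s + 1) ω),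
        ((sys.departureSlot i n ω - (s : ℕ∞) : ℕ∞) : ℝ≥0∞)) ≤
      ∑ τ ∈ Finset.range (H T), (sys.Q i τ ω : ℝ≥0∞) := by
    intro i T
    have := totalDelay_path_le (sys.joined_mono i ω) (sys.departed_mono i ω) (hdep0 i)
      (hempty i T)
    simp only [hQeq] at this
    exact this
  have hlower : ∀ i T, ∑ τ ∈ Finset.range T, (sys.Q i τ ω : ℝ≥0∞) ≤
      (∑ s ∈ Finset.range T,
      ∑ n ∈ Finset.Ico (sys.joined i s ω) (sys.joined i (s + 1) ω),
        ((sys.departureSlot i n ω - (s : ℕ∞) : ℕ∞) : ℝ≥0∞)) +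
        ((H 0 * sys.joined i 0 ω : ℕ) : ℝ≥0∞) := by
    intro i T
    have := le_totalDelay_path (sys.joined_mono i ω) (sys.departed_mono i ω) (hdep0 i)
      (hempty i T) (hle T) (hempty i 0)
    simp only [hQeq] at this
    exact this
  have hHtop : Tendsto H atTop atTop := tendsto_atTop_mono hle tendsto_id
  have hi : ∀ i, Tendsto (fun T : ℕ => (∑ s ∈ Finset.range T,
      ∑ n ∈ Finset.Ico (sys.joined i s ω) (sys.joined i (s + 1) ω),
        ((sys.departureSlot i n ω - (s : ℕ∞) : ℕ∞) : ℝ≥0∞)) / (T : ℝ≥0∞)) atTop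
      (𝓝 (m i : ℝ≥0∞)) := by
    intro i
    have hup : Tendsto (fun T : ℕ => (∑ τ ∈ Finset.range (H T), (sys.Q i τ ω : ℝ≥0∞)) /
        (T : ℝ≥0∞)) atTop (𝓝 (m i : ℝ≥0∞)) := by
      have := ENNReal.Tendsto.mul ((hQ i).comp hHtop) (Or.inr ENNReal.one_ne_top) hlim
        (Or.inr ENNReal.coe_ne_top)
      rw [mul_one] at this
      refine this.congr' ?_
      filter_upwards [eventually_gt_atTop 0] with T hT
      have hH0 : (H T : ℝ≥0∞) ≠ 0 := by exact_mod_cast (hT.trans_le (hle T)).ne'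
      simp only [Function.comp, slotAverage]
      rw [div_eq_mul_inv, div_eq_mul_inv, div_eq_mul_inv, mul_assoc, ← mul_assoc _ _ (_⁻¹),
        ENNReal.inv_mul_cancel hH0 (by simp), one_mul]
    have hlow : Tendsto (fun T : ℕ => slotAverage (fun τ => (sys.Q i τ ω : ℝ≥0∞)) T -
        ((H 0 * sys.joined i 0 ω : ℕ) : ℝ≥0∞) / (T : ℝ≥0∞)) atTop (𝓝 (m i : ℝ≥0∞)) := by
      have h0 : Tendsto (fun T : ℕ => ((H 0 * sys.joined i 0 ω : ℕ) : ℝ≥0∞) / (T : ℝ≥0∞)) atTop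
          (𝓝 0) := (ENNReal.Tendsto.const_div ENNReal.tendsto_nat_nhds_top
        (Or.inr (ENNReal.natCast_ne_top _))).trans (by simp)
      simpa using ENNReal.Tendsto.sub (hQ i) h0 (Or.inl ENNReal.coe_ne_top)
    refine tendsto_of_tendsto_of_tendsto_of_le_of_le hlow hup (fun T => ?_) (fun T => ?_)
    · refine tsub_le_iff_right.2 ?_
      rw [← ENNReal.add_div]
      exact ENNReal.div_le_div_right (hlower i T) _
    · exact ENNReal.div_le_div_right (hupper i T) _
  have hsum : Tendsto (fun T : ℕ => sys.totalDelay T ω / (T : ℝ≥0∞)) atTop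
      (𝓝 (∑ i, (m i : ℝ≥0∞))) := by
    have := tendsto_finsetSum Finset.univ fun i _ => hi i
    refine this.congr fun T => ?_
    simp only [totalDelay, div_eq_mul_inv, Finset.sum_mul]
  refine (ENNReal.Tendsto.div hsum (Or.inr hl0) hA (Or.inl hl)).congr' ?_
  filter_upwards [eventually_gt_atTop 0] with T hT
  rw [div_eq_mul_inv _ (T : ℝ≥0∞), div_eq_mul_inv _ (T : ℝ≥0∞),
    ENNReal.mul_div_mul_right _ _ (by simp) (by simpa using hT.ne')]

end OnOffSystem

/-! ### Independence of the primitive variables and the driving noise. -/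

theorem iIndep_sumElim {Ω ι κ : Type*} {mΩ : MeasurableSpace Ω} {P : Measure Ω}
    {m₁ : ι → MeasurableSpace Ω} {m₂ : κ → MeasurableSpace Ω} (h₁ : iIndep m₁ P) (h₂ : iIndep m₂ P)
    (h : Indep (⨆ i, m₁ i) (⨆ j, m₂ j) P) : iIndep (Sum.elim m₁ m₂) P := by
  rw [iIndep_iff] at h₁ h₂ ⊢
  intro s f hf
  have hs : s = s.toLeft.disjSum s.toRight := Finset.toLeft_disjSum_toRight.symm
  have hinter : ⋂ i ∈ s, f i =
      (⋂ i ∈ s.toLeft, f (Sum.inl i)) ∩ ⋂ j ∈ s.toRight, f (Sum.inr j) := by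
    ext ω
    simp only [Set.mem_iInter, Set.mem_inter_iff, Finset.mem_toLeft, Finset.mem_toRight]
    exact ⟨fun hω => ⟨fun i hi => hω _ hi, fun j hj => hω _ hj⟩, fun hω k hk => by
      cases k with
      | inl i => exact hω.1 i hk
      | inr j => exact hω.2 j hk⟩
  have hl : ∀ i ∈ s.toLeft, MeasurableSet[m₁ i] (f (Sum.inl i)) := fun i hi =>
    hf (Sum.inl i) (Finset.mem_toLeft.1 hi)
  have hr : ∀ j ∈ s.toRight, MeasurableSet[m₂ j] (f (Sum.inr j)) := fun j hj =>
    hf (Sum.inr j) (Finset.mem_toRight.1 hj)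
  rw [hinter, (Indep_iff _ _ _).1 h _ _
    (Finset.measurableSet_biInter _ fun i hi => le_iSup m₁ i _ (hl i hi))
    (Finset.measurableSet_biInter _ fun j hj => le_iSup m₂ j _ (hr j hj)),
    h₁ s.toLeft hl, h₂ s.toRight hr]
  conv_rhs => rw [hs]
  rw [Finset.prod_disjSum]

theorem iIndep_of_unique {Ω ι : Type*} [Unique ι] {mΩ : MeasurableSpace Ω} {P : Measure Ω}
    [IsProbabilityMeasure P] (m : ι → MeasurableSpace Ω) : iIndep m P := by
  rw [iIndep_iff]
  intro s f _
  rcases Finset.eq_empty_or_nonempty s with rfl | hs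
  · simp
  · have : s = {default} := Finset.eq_singleton_iff_nonempty_unique_mem.2
      ⟨hs, fun x _ => Subsingleton.elim _ _⟩
    simp [this]

theorem measurable_pi_of_forall {Ω ι α : Type*} {m : MeasurableSpace Ω} {mα : MeasurableSpace α}
    {f : Ω → ι → α} (h : ∀ i, Measurable fun ω => f ω i) : Measurable f :=
  measurable_pi_lambda _ h

namespace OnOffSystem

variable {N : ℕ} {Ω : Type*} [MeasurableSpace Ω] (sys : OnOffSystem N Ω)

/-- The information carried by each primitive random variable: the arrivals, the channel states,
the seeds, and the initial backlogs. -/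
@[reducible] def source :
    ((((Fin N × ℕ) ⊕ (Fin N × ℕ)) ⊕ ℕ) ⊕ Unit) → MeasurableSpace Ω :=
  Sum.elim (Sum.elim (Sum.elim
    (fun k => MeasurableSpace.comap (sys.A k.1 k.2) inferInstance)
    (fun k => MeasurableSpace.comap (sys.S k.1 k.2) inferInstance))
    (fun t => MeasurableSpace.comap (sys.U t) inferInstance))
    (fun _ => MeasurableSpace.comap (fun ω i => sys.Q i 0 ω) inferInstance)

theorem source_le (k) : sys.source k ≤ ‹MeasurableSpace Ω› := by
  rcases k with ((k | k) | t) | u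
  · exact (sys.measurable_A _ _).comap_le
  · exact (sys.measurable_S _ _).comap_le
  · exact (sys.measurable_U _).comap_le
  · exact (measurable_pi_lambda _ fun i => sys.measurable_init i).comap_le

theorem iIndep_source : iIndep sys.source sys.P := by
  have := sys.isProb
  have hcomp : ∀ {α β : Type _} [MeasurableSpace α] [MeasurableSpace β] (X : Ω → α) (φ : α → β),
      Measurable φ → MeasurableSpace.comap (fun ω => φ (X ω)) inferInstance ≤
        MeasurableSpace.comap X inferInstance := fun X φ hφ =>
    (hφ.comp (comap_measurable X)).comap_le
  have hAS := iIndep_sumElim ((iIndepFun_iff_iIndep _ _ _).1 sys.indep_A)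
    ((iIndepFun_iff_iIndep _ _ _).1 sys.indep_S) (indep_of_indep_of_le_left
      (indep_of_indep_of_le_right ((IndepFun_iff_Indep _ _ _).1 sys.indep_A_S)
      (iSup_le fun k => hcomp (fun ω i t => sys.S i t ω) (fun x => x k.1 k.2) (by fun_prop)))
      (iSup_le fun k => hcomp (fun ω i t => sys.A i t ω) (fun x => x k.1 k.2) (by fun_prop)))
  have hASU := iIndep_sumElim hAS ((iIndepFun_iff_iIndep _ _ _).1 sys.indep_U)
    (indep_of_indep_of_le_left
      (indep_of_indep_of_le_right ((IndepFun_iff_Indep _ _ _).1 sys.indep_AS_U)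
      (iSup_le fun t => hcomp (fun ω t => sys.U t ω) (fun x => x t) (by fun_prop)))
      (iSup_le fun k => by
        rcases k with k | k
        · exact hcomp (fun ω => ((fun i t => sys.A i t ω), (fun i t => sys.S i t ω)))
            (fun x => x.1 k.1 k.2) (by fun_prop)
        · exact hcomp (fun ω => ((fun i t => sys.A i t ω), (fun i t => sys.S i t ω)))
            (fun x => x.2 k.1 k.2) (by fun_prop)))
  exact iIndep_sumElim hASU (iIndep_of_unique _) (indep_of_indep_of_le_left
      (indep_of_indep_of_le_right ((IndepFun_iff_Indep _ _ _).1 sys.indep_ASU_init)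
      (iSup_le fun _ => le_rfl))
      (iSup_le fun k => by
        rcases k with (k | k) | t
        · exact hcomp (fun ω => ((fun i t => sys.A i t ω), (fun i t => sys.S i t ω),
            (fun t => sys.U t ω))) (fun x => x.1 k.1 k.2) (by fun_prop)
        · exact hcomp (fun ω => ((fun i t => sys.A i t ω), (fun i t => sys.S i t ω),
            (fun t => sys.U t ω))) (fun x => x.2.1 k.1 k.2) (by fun_prop)
        · exact hcomp (fun ω => ((fun i t => sys.A i t ω), (fun i t => sys.S i t ω),
            (fun t => sys.U t ω))) (fun x => x.2.2 t) (by fun_prop)))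

/-- The arrivals, channel states and seed of slot `t`. -/
def noise (t : ℕ) (ω : Ω) : (Fin N → ℕ) × (Fin N → Bool) × ℝ :=
  (fun i => sys.A i t ω, fun i => sys.S i t ω, sys.U t ω)

/-- `0` for the initial backlogs, and `t + 1` for the variables of slot `t`. -/
def sourceLevel : ((((Fin N × ℕ) ⊕ (Fin N × ℕ)) ⊕ ℕ) ⊕ Unit) → ℕ :=
  Sum.elim (Sum.elim (Sum.elim (fun k => k.2 + 1) (fun k => k.2 + 1)) (fun t => t + 1)) (fun _ => 0)

/-- The information available before slot `t`. -/
@[reducible] def history (t : ℕ) : MeasurableSpace Ω :=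
  ⨆ k ∈ {k | sourceLevel (N := N) k ≤ t}, sys.source k

theorem measurable_noise_of_mem {C : Set ((((Fin N × ℕ) ⊕ (Fin N × ℕ)) ⊕ ℕ) ⊕ Unit)} {t : ℕ}
    (h : ∀ k, sourceLevel k = t + 1 → k ∈ C) :
    Measurable[⨆ k ∈ C, sys.source k] (sys.noise t) := by
  have hle : ∀ k, sourceLevel k = t + 1 → sys.source k ≤ ⨆ k ∈ C, sys.source k :=
    fun k hk => le_iSup₂ (f := fun k (_ : k ∈ C) => sys.source k) k (h k hk)
  refine Measurable.prodMk (measurable_pi_of_forall fun i => ?_)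
    (Measurable.prodMk (measurable_pi_of_forall fun i => ?_) ?_)
  · exact (comap_measurable (sys.A i t)).mono (hle (Sum.inl (Sum.inl (Sum.inl (i, t)))) rfl) le_rfl
  · exact (comap_measurable (sys.S i t)).mono (hle (Sum.inl (Sum.inl (Sum.inr (i, t)))) rfl) le_rfl
  · exact (comap_measurable (sys.U t)).mono (hle (Sum.inl (Sum.inr t)) rfl) le_rfl

theorem measurable_init_history : Measurable[sys.history 0] fun ω i => sys.Q i 0 ω :=
  (comap_measurable (fun ω i => sys.Q i 0 ω)).mono
    (le_iSup₂ (f := fun k (_ : k ∈ {k | sourceLevel (N := N) k ≤ 0}) => sys.source k)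
      (Sum.inr ()) (le_refl 0)) le_rfl

/-- Each family has a product law, and a time shift permutes factors with equal marginals. For the
channels the marginals agree because a law on `Bool` is determined by its mass at `true`. -/
theorem identDistrib_future (s : ℕ) :
    sys.P.map (fun ω t => sys.noise (s + t) ω) = sys.P.map (fun ω t => sys.noise t ω) := by
  have := sys.isProb
  have hS : ∀ i t, IdentDistrib (sys.S i t) (sys.S i 0) sys.P sys.P := by
    intro i t
    refine ⟨(sys.measurable_S _ _).aemeasurable, (sys.measurable_S _ _).aemeasurable, ?_⟩
    have h1 : ∀ t, (sys.P.map (sys.S i t)) {true} = ENNReal.ofReal (sys.p i) := by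
      intro t
      rw [Measure.map_apply (sys.measurable_S i t) (measurableSet_singleton _), ← sys.prob_on i t,
        ofReal_measureReal]
      rfl
    have hp : ∀ t, IsProbabilityMeasure (sys.P.map (sys.S i t)) := fun t =>
      Measure.isProbabilityMeasure_map (sys.measurable_S i t).aemeasurable
    have h2 : ∀ t, (sys.P.map (sys.S i t)) {false} = 1 - ENNReal.ofReal (sys.p i) := by
      intro t
      have hpt := hp t
      rw [← h1 t, ← prob_compl_eq_one_sub (measurableSet_singleton true)]
      congr 1
      ext b
      cases b <;> simp
    refine Measure.ext_of_singleton fun b => ?_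
    cases b
    · rw [h2, h2]
    · rw [h1, h1]
  have hinj : Function.Injective fun k : Fin N × ℕ => (k.1, s + k.2) := by
    rintro ⟨i, t⟩ ⟨j, u⟩ h
    simp only [Prod.mk.injEq] at h ⊢
    omega
  have gen : ∀ {ι α : Type} [MeasurableSpace α] (X : ι → Ω → α) (g : ι → ι), g.Injective →
      (∀ k, Measurable (X k)) → iIndepFun X sys.P →
      (∀ k, IdentDistrib (X (g k)) (X k) sys.P sys.P) →
      IdentDistrib (fun ω k => X (g k) ω) (fun ω k => X k ω) sys.P sys.P := by
    intro ι α _ X g hg hX hind hid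
    refine ⟨(measurable_pi_lambda _ fun k => hX (g k)).aemeasurable,
      (measurable_pi_lambda _ fun k => hX k).aemeasurable, ?_⟩
    rw [hind.map_fun_eq_infinitePi_map hX,
      (hind.precomp hg).map_fun_eq_infinitePi_map (fun k => hX (g k))]
    congr 1
    funext k
    exact (hid k).map_eq
  have h1 := gen (fun k : Fin N × ℕ => sys.A k.1 k.2) (fun k => (k.1, s + k.2)) hinj
    (fun k => sys.measurable_A _ _) sys.indep_A
    (fun k => (sys.identDistrib_A _ _).trans (sys.identDistrib_A _ _).symm)
  have h2 := gen (fun k : Fin N × ℕ => sys.S k.1 k.2) (fun k => (k.1, s + k.2)) hinj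
    (fun k => sys.measurable_S _ _) sys.indep_S
    (fun k => (hS _ _).trans (hS _ _).symm)
  have h3 := gen sys.U (fun t => s + t) (add_right_injective s) sys.measurable_U sys.indep_U
    (fun t => (sys.identDistrib_U _).trans (sys.identDistrib_U _).symm)
  have i12 : ∀ s, IndepFun (fun ω (k : Fin N × ℕ) => sys.A k.1 (s + k.2) ω)
      (fun ω (k : Fin N × ℕ) => sys.S k.1 (s + k.2) ω) sys.P := fun s =>
    sys.indep_A_S.comp (φ := fun (x : Fin N → ℕ → ℕ) (k : Fin N × ℕ) => x k.1 (s + k.2))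
      (ψ := fun (x : Fin N → ℕ → Bool) (k : Fin N × ℕ) => x k.1 (s + k.2)) (by fun_prop) (by fun_prop)
  have i123 : ∀ s, IndepFun (fun ω => ((fun (k : Fin N × ℕ) => sys.A k.1 (s + k.2) ω),
      (fun (k : Fin N × ℕ) => sys.S k.1 (s + k.2) ω))) (fun ω t => sys.U (s + t) ω) sys.P :=
    fun s => sys.indep_AS_U.comp (φ := fun x : (Fin N → ℕ → ℕ) × (Fin N → ℕ → Bool) =>
        ((fun (k : Fin N × ℕ) => x.1 k.1 (s + k.2)),
        (fun (k : Fin N × ℕ) => x.2 k.1 (s + k.2))))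
      (ψ := fun (x : ℕ → ℝ) t => x (s + t)) (by fun_prop) (by fun_prop)
  have j12 := i12 0
  have j123 := i123 0
  simp only [zero_add] at j12 j123
  have h123 := (h1.prodMk h2 (i12 s) j12).prodMk h3 (i123 s) j123
  exact (h123.comp (u := fun x : ((Fin N × ℕ → ℕ) × (Fin N × ℕ → Bool)) × (ℕ → ℝ) =>
    fun t : ℕ => ((fun i : Fin N => x.1.1 (i, t)), (fun i : Fin N => x.1.2 (i, t)), x.2 t))
    (by fun_prop)).map_eq

/-- Past and future are generated by disjoint sets of mutually independent sources, separated by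
`sourceLevel`. -/
theorem isDrivingNoise :
    IsDrivingNoise sys.P sys.history sys.noise (sys.P.map fun ω t => sys.noise t ω) where
  le s := iSup₂_le fun k _ => sys.source_le k
  mono s t hst := biSup_mono fun k (hk : sourceLevel k ≤ s) => hk.trans hst
  meas t := sys.measurable_noise_of_mem fun k hk => hk.le
  law s := sys.identDistrib_future s
  indep s := by
    refine indep_of_indep_of_le_right (indep_iSup_of_disjoint sys.source_le sys.iIndep_source
      (S := {k | sourceLevel k ≤ s}) (T := {k | s < sourceLevel k}) ?_) ?_
    · exact Set.disjoint_left.2 fun k (hk : sourceLevel k ≤ s) (hk' : s < sourceLevel k) =>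
        absurd hk (not_le.2 hk')
    · refine Measurable.comap_le (measurable_pi_of_forall fun t => ?_)
      exact sys.measurable_noise_of_mem fun k hk => by
        show s < sourceLevel k
        omega

/-- At a fixed backlog, service depends only on the channels and the seed. This independence from
the arrivals removes the cross terms in the drift. -/
theorem indepFun_arrivals (t : ℕ) :
    IndepFun (fun ω i => sys.A i t ω) (fun ω => ((fun i => sys.S i t ω), sys.U t ω)) sys.P := by
  rw [IndepFun_iff_Indep]
  have h := indep_iSup_of_disjoint sys.source_le sys.iIndep_source
      (S := Set.range fun i => Sum.inl (Sum.inl (Sum.inl (i, t))))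
      (T := (Set.range fun i => Sum.inl (Sum.inl (Sum.inr (i, t)))) ∪ {Sum.inl (Sum.inr t)})
      (Set.disjoint_left.2 (by rintro _ ⟨i, rfl⟩ (⟨j, hj⟩ | hj) <;> simp at hj))
  refine indep_of_indep_of_le_left (indep_of_indep_of_le_right h ?_) ?_
  · refine Measurable.comap_le (Measurable.prodMk (measurable_pi_of_forall fun i => ?_) ?_)
    · exact (comap_measurable (sys.S i t)).mono (le_iSup₂ (f := fun k (_ : k ∈ _) => sys.source k)
        (Sum.inl (Sum.inl (Sum.inr (i, t)))) (Or.inl ⟨i, rfl⟩)) le_rfl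
    · exact (comap_measurable (sys.U t)).mono (le_iSup₂ (f := fun k (_ : k ∈ _) => sys.source k)
        (Sum.inl (Sum.inr t)) (Or.inr rfl)) le_rfl
  · refine Measurable.comap_le (measurable_pi_of_forall fun i => ?_)
    exact (comap_measurable (sys.A i t)).mono (le_iSup₂ (f := fun k (_ : k ∈ _) => sys.source k)
        (Sum.inl (Sum.inl (Sum.inl (i, t)))) ⟨i, rfl⟩) le_rfl

end OnOffSystem

/-! ### Necessary conditions for membership in the capacity region. -/

/-- The probability that some channel of the set `M` is ON. -/
noncomputable def onProb {N : ℕ} (p : Fin N → ℝ) (M : Finset (Fin N)) : ℝ :=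
  1 - ∏ i ∈ M, (1 - p i)

theorem linkRate_le_one {N : ℕ} (o : Option (Fin N)) (s : Fin N → Bool) (i : Fin N) :
    linkRate o s i ≤ 1 := by
  unfold linkRate
  split_ifs
  · exact Bool.toNat_le _
  · exact Nat.zero_le 1

theorem sum_linkRate_le {N : ℕ} (o : Option (Fin N)) (s : Fin N → Bool) (M : Finset (Fin N)) :
    ∑ i ∈ M, linkRate o s i ≤ if ∃ i ∈ M, s i = true then 1 else 0 := by
  cases o with
  | none => simp [linkRate]
  | some j =>
    simp only [linkRate, Option.some.injEq, Finset.sum_ite_eq]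
    by_cases hj : j ∈ M
    · rw [if_pos hj]
      cases hs : s j
      · simp
      · rw [if_pos ⟨j, hj, hs⟩]
        rfl
    · simp [hj]

namespace OnOffSystem

variable {N : ℕ} {Ω : Type*} [MeasurableSpace Ω] (sys : OnOffSystem N Ω)

theorem measurableSet_sel (t : ℕ) (i : Fin N) : MeasurableSet {ω | sys.sel t ω = some i} := by
  refine (?_ : causalInfo sys.A sys.S sys.U (fun i => sys.Q i 0) t ≤ ‹_›) _ (sys.sel_causal t i)
  refine sup_le (sup_le (sup_le ?_ ?_) ?_) ?_
  · exact iSup_le fun i => (sys.measurable_init i).comap_le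
  · exact iSup_le fun s => iSup_le fun _ => iSup_le fun i => (sys.measurable_A i s).comap_le
  · exact iSup_le fun s => iSup_le fun _ => iSup_le fun i => (sys.measurable_S i s).comap_le
  · exact iSup_le fun s => iSup_le fun _ => (sys.measurable_U s).comap_le

theorem measurable_linkRate (t : ℕ) (i : Fin N) :
    Measurable fun ω => linkRate (sys.sel t ω) (fun j => sys.S j t ω) i :=
  Measurable.ite (sys.measurableSet_sel t i)
    ((measurable_of_countable Bool.toNat).comp (sys.measurable_S i t)) measurable_const

theorem measurable_Q (i : Fin N) (t : ℕ) : Measurable (sys.Q i t) := by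
  induction t with
  | zero => exact sys.measurable_init i
  | succ t ih =>
    have : sys.Q i (t + 1) = fun ω =>
        (sys.Q i t ω - linkRate (sys.sel t ω) (fun j => sys.S j t ω) i) + sys.A i t ω :=
      funext fun ω => sys.dynamics i t ω
    rw [this]
    exact (ih.sub (sys.measurable_linkRate t i)).add (sys.measurable_A i t)

theorem prob_off (i : Fin N) (t : ℕ) : sys.P.real {ω | sys.S i t ω = false} = 1 - sys.p i := by
  have := sys.isProb
  have hm : MeasurableSet {ω | sys.S i t ω = true} :=
    sys.measurable_S i t (measurableSet_singleton true)
  rw [← sys.prob_on i t, ← probReal_compl_eq_one_sub hm]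
  congr 1
  ext ω
  simp

theorem prob_exists_on (M : Finset (Fin N)) (t : ℕ) :
    sys.P.real {ω | ∃ i ∈ M, sys.S i t ω = true} = onProb sys.p M := by
  have := sys.isProb
  have hoff : sys.P.real (⋂ i ∈ M, sys.S i t ⁻¹' {false}) = ∏ i ∈ M, (1 - sys.p i) := by
    have hind : iIndepFun (fun i => sys.S i t) sys.P :=
      sys.indep_S.precomp (g := fun i : Fin N => (i, t)) fun i j h => (Prod.mk.inj h).1
    rw [measureReal_def, hind.measure_inter_preimage_eq_mul M
      (fun i _ => measurableSet_singleton false), ENNReal.toReal_prod]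
    exact Finset.prod_congr rfl fun i _ => sys.prob_off i t
  have hm : MeasurableSet (⋂ i ∈ M, sys.S i t ⁻¹' {false}) :=
    Finset.measurableSet_biInter _ fun i _ => sys.measurable_S i t (measurableSet_singleton false)
  rw [onProb, ← hoff, ← probReal_compl_eq_one_sub hm]
  congr 1
  ext ω
  simp

theorem integrable_A (i : Fin N) (t : ℕ) : Integrable (fun ω => (sys.A i t ω : ℝ)) sys.P := by
  have := sys.isProb
  exact (sys.memLp_A i t).integrable one_le_two

theorem integral_A (i : Fin N) (t : ℕ) : ∫ ω, (sys.A i t ω : ℝ) ∂sys.P = sys.lam i :=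
  ((sys.identDistrib_A i t).comp (measurable_of_countable (fun n : ℕ => (n : ℝ)))).integral_eq

theorem lam_nonneg (i : Fin N) : 0 ≤ sys.lam i :=
  integral_nonneg fun _ => Nat.cast_nonneg _

theorem lintegral_A (i : Fin N) (t : ℕ) :
    ∫⁻ ω, (sys.A i t ω : ℝ≥0∞) ∂sys.P = ENNReal.ofReal (sys.lam i) := by
  rw [← sys.integral_A i t, ofReal_integral_eq_lintegral_ofReal (sys.integrable_A i t)
    (Eventually.of_forall fun ω => Nat.cast_nonneg _)]
  simp

theorem measurable_natCast_Q (i : Fin N) (t : ℕ) : Measurable fun ω => (sys.Q i t ω : ℝ≥0∞) :=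
  (measurable_of_countable (fun n : ℕ => (n : ℝ≥0∞))).comp (sys.measurable_Q i t)

/-- Necessity in the characterization of the capacity region: the rates of a strongly stable system
satisfy `∑_{i ∈ M} λ_i ≤ 1 - ∏_{i ∈ M} (1 - p_i)` for all sets `M` of queues. -/
theorem sum_lam_le_onProb (hstab : ∀ i, sys.StronglyStable i) (M : Finset (Fin N)) :
    ∑ i ∈ M, sys.lam i ≤ onProb sys.p M := by
  have := sys.isProb
  by_contra! hlt
  set a := ENNReal.ofReal (∑ i ∈ M, sys.lam i) with ha
  set g := ENNReal.ofReal (onProb sys.p M) with hg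
  have hg0 : 0 ≤ onProb sys.p M := sys.prob_exists_on M 0 ▸ measureReal_nonneg
  have hga : g < a := (ENNReal.ofReal_lt_ofReal_iff (hg0.trans_lt hlt)).2 hlt
  set q : ℕ → ℝ≥0∞ := fun t => ∑ i ∈ M, ∫⁻ ω, (sys.Q i t ω : ℝ≥0∞) ∂sys.P with hq
  have hEm : ∀ t, MeasurableSet {ω | ∃ i ∈ M, sys.S i t ω = true} := by
    intro t
    have : {ω | ∃ i ∈ M, sys.S i t ω = true} = ⋃ i ∈ M, sys.S i t ⁻¹' {true} := by ext; simp
    rw [this]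
    exact Finset.measurableSet_biUnion _ fun i _ =>
      sys.measurable_S i t (measurableSet_singleton true)
  -- Whatever the policy, the queues of `M` together lose at most one packet, and none if all their
  -- channels are OFF. The additive form needs no finiteness of expected backlogs.
  have hstep : ∀ t, q t + a ≤ q (t + 1) + g := by
    intro t
    have h1 : a = ∑ i ∈ M, ∫⁻ ω, (sys.A i t ω : ℝ≥0∞) ∂sys.P := by
      rw [ha, ENNReal.ofReal_sum_of_nonneg fun i _ => sys.lam_nonneg i]
      exact Finset.sum_congr rfl fun i _ => (sys.lintegral_A i t).symm
    have h2 : g = ∫⁻ ω, {ω | ∃ i ∈ M, sys.S i t ω = true}.indicator 1 ω ∂sys.P := by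
      rw [lintegral_indicator_one (hEm t), hg, ← sys.prob_exists_on M t, ofReal_measureReal]
    have hAm : ∀ i, Measurable fun ω => (sys.A i t ω : ℝ≥0∞) := fun i =>
      (measurable_of_countable (fun n : ℕ => (n : ℝ≥0∞))).comp (sys.measurable_A i t)
    have hsum : ∀ t, Measurable fun ω => ∑ i ∈ M, (sys.Q i t ω : ℝ≥0∞) := fun t =>
      Finset.measurable_sum _ fun i _ => sys.measurable_natCast_Q i t
    simp only [hq]
    rw [h1, h2, ← lintegral_finsetSum _ fun i _ => sys.measurable_natCast_Q i _,
      ← lintegral_finsetSum _ fun i _ => sys.measurable_natCast_Q i _,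
      ← lintegral_finsetSum _ fun i _ => hAm i, ← lintegral_add_left (hsum t),
      ← lintegral_add_left (hsum (t + 1))]
    refine lintegral_mono fun ω => ?_
    have h3 : ∑ i ∈ M, sys.Q i t ω + ∑ i ∈ M, sys.A i t ω ≤
        ∑ i ∈ M, sys.Q i (t + 1) ω +
          ∑ i ∈ M, linkRate (sys.sel t ω) (fun j => sys.S j t ω) i := by
      rw [← Finset.sum_add_distrib, ← Finset.sum_add_distrib]
      refine Finset.sum_le_sum fun i _ => ?_
      rw [sys.dynamics]
      omega
    have h4 := h3.trans (Nat.add_le_add_left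
      (sum_linkRate_le (sys.sel t ω) (fun j => sys.S j t ω) M) _)
    have h6 := (Nat.cast_le (α := ℝ≥0∞)).2 h4
    have h5 : (((if ∃ i ∈ M, sys.S i t ω = true then 1 else 0 : ℕ)) : ℝ≥0∞) =
        {ω | ∃ i ∈ M, sys.S i t ω = true}.indicator 1 ω := by
      simp [Set.indicator]
    rw [← h5]
    rw [Nat.cast_add, Nat.cast_add, Nat.cast_sum, Nat.cast_sum, Nat.cast_sum] at h6
    exact h6
  have hlin : ∀ t : ℕ, (a - g) * t ≤ q t := by
    have : ∀ t : ℕ, a * t ≤ q t + g * t := by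
      intro t
      induction t with
      | zero => simp
      | succ t ih =>
        push_cast
        calc a * (t + 1) = a * t + a := by ring
          _ ≤ q t + g * t + a := by gcongr
          _ = (q t + a) + g * t := by ring
          _ ≤ (q (t + 1) + g) + g * t := by gcongr ?_ + _; exact hstep t
          _ = _ := by ring
    intro t
    rw [ENNReal.sub_mul fun _ _ => by simp]
    exact tsub_le_iff_right.2 (this t)
  have hbound : ∀ i, ∃ c : ℝ≥0∞, c ≠ ⊤ ∧ ∀ᶠ T in atTop,
      slotAverage (fun τ => ∫⁻ ω, (sys.Q i τ ω : ℝ≥0∞) ∂sys.P) T ≤ c := by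
    intro i
    obtain ⟨c, hc, hc'⟩ := exists_between (hstab i)
    exact ⟨c, hc'.ne, (eventually_lt_of_limsup_lt hc).mono fun T hT => hT.le⟩
  choose c hc hcT using hbound
  have hall : ∀ᶠ T : ℕ in atTop, ∀ i,
      slotAverage (fun τ => ∫⁻ ω, (sys.Q i τ ω : ℝ≥0∞) ∂sys.P) T ≤ c i :=
    eventually_all.2 hcT
  have hC : ∑ i ∈ M, c i ≠ ⊤ := ENNReal.sum_ne_top.2 fun i _ => hc i
  -- Linear growth at rate `a - g` makes the running average grow like half of that rate times `T`,
  -- against the eventual bounds given by strong stability.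
  have hlow : ∀ᶠ T : ℕ in atTop, (a - g) * ((T - 1 : ℕ) : ℝ≥0∞) ≤ 2 * ∑ i ∈ M, c i := by
    filter_upwards [hall, eventually_gt_atTop 0] with T hT hT0
    have hTn : (T : ℝ≥0∞) ≠ 0 := by exact_mod_cast hT0.ne'
    have h1 : ∑ τ ∈ Finset.range T, q τ ≤ (∑ i ∈ M, c i) * T := by
      rw [hq, Finset.sum_comm, Finset.sum_mul]
      refine Finset.sum_le_sum fun i _ => ?_
      exact (ENNReal.div_le_iff hTn (by simp)).1 (hT i)
    have h2 : (a - g) * ((∑ τ ∈ Finset.range T, τ : ℕ) : ℝ≥0∞) ≤ (∑ i ∈ M, c i) * T := by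
      refine le_trans ?_ h1
      push_cast
      rw [Finset.mul_sum]
      exact Finset.sum_le_sum fun τ _ => hlin τ
    have h3 : ((∑ τ ∈ Finset.range T, τ : ℕ) : ℝ≥0∞) * 2 = T * ((T - 1 : ℕ) : ℝ≥0∞) := by
      exact_mod_cast Finset.sum_range_id_mul_two T
    refine (ENNReal.mul_le_mul_iff_left hTn (by simp)).1 ?_
    calc (a - g) * ((T - 1 : ℕ) : ℝ≥0∞) * T
        = (a - g) * ((∑ τ ∈ Finset.range T, τ : ℕ) : ℝ≥0∞) * 2 := by
          rw [mul_assoc, mul_assoc, h3, mul_comm (T : ℝ≥0∞)]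
      _ ≤ (∑ i ∈ M, c i) * T * 2 := by gcongr
      _ = _ := by ring
  obtain ⟨n, hn⟩ := ENNReal.exists_nat_mul_gt (tsub_pos_of_lt hga).ne'
    (ENNReal.mul_ne_top ENNReal.ofNat_ne_top hC : (2 : ℝ≥0∞) * ∑ i ∈ M, c i ≠ ⊤)
  obtain ⟨T, hT, hTn⟩ := (hlow.and (eventually_ge_atTop (n + 1))).exists
  refine absurd hT (not_le.2 (hn.trans_le ?_))
  rw [mul_comm]
  gcongr
  omega

end OnOffSystem

theorem sum_le_onProb_of_mem_capacityRegion {N : ℕ} {p l : Fin N → ℝ} (hl : l ∈ capacityRegion p)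
    (M : Finset (Fin N)) : ∑ i ∈ M, l i ≤ onProb p M := by
  have hclosed : IsClosed {l : Fin N → ℝ | ∑ i ∈ M, l i ≤ onProb p M} :=
    isClosed_le (by fun_prop) continuous_const
  refine closure_minimal ?_ hclosed hl
  rintro _ ⟨Ω, _, sys, rfl, rfl, hstab⟩
  exact sys.sum_lam_le_onProb hstab M

theorem sum_le_of_mem_smul_capacityRegion {N : ℕ} {p l : Fin N → ℝ} {ρ : ℝ} (hρ : 0 ≤ ρ)
    (hl : l ∈ ρ • capacityRegion p) (M : Finset (Fin N)) : ∑ i ∈ M, l i ≤ ρ * onProb p M := by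
  obtain ⟨l', hl', rfl⟩ := hl
  simp only [Pi.smul_apply, smul_eq_mul, ← Finset.mul_sum]
  exact mul_le_mul_of_nonneg_left (sum_le_onProb_of_mem_capacityRegion hl' M) hρ

/-! ### Monotonicity and concavity of `r_K`. -/

theorem rK_le_one {pm : ℝ} (h1 : pm < 1) (k : ℕ) : rK pm k ≤ 1 :=
  sub_le_self 1 (pow_nonneg (by linarith) k)

theorem muSym_eq (pm : ℝ) (K : ℕ) : muSym pm K = rK pm K / K := by
  unfold muSym rK
  ring

theorem rK_le_onProb {pm : ℝ} {N : ℕ} {p : Fin N → ℝ} (hp : ∀ i, pm ≤ p i) (hp1 : ∀ i, p i ≤ 1)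
    (M : Finset (Fin N)) : rK pm M.card ≤ onProb p M := by
  unfold rK onProb
  refine sub_le_sub_left ?_ 1
  rw [← Finset.prod_const]
  exact Finset.prod_le_prod (fun i _ => sub_nonneg.2 (hp1 i)) fun i _ => sub_le_sub_left (hp i) 1

section RK

variable {pm : ℝ} (h0 : 0 < pm) (h1 : pm < 1)
include h0 h1

theorem rK_nonneg (k : ℕ) : 0 ≤ rK pm k :=
  sub_nonneg.2 (pow_le_one₀ (by linarith) (by linarith))

theorem rK_mono : Monotone (rK pm) := fun m n hmn =>
  sub_le_sub_left (pow_le_pow_of_le_one (by linarith) (by linarith) hmn) 1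

theorem le_rK {k : ℕ} (hk : 1 ≤ k) : pm ≤ rK pm k := by
  simpa [rK] using rK_mono h0 h1 hk

theorem rK_pos {k : ℕ} (hk : 1 ≤ k) : 0 < rK pm k := h0.trans_le (le_rK h0 h1 hk)

/-- `rK pm m` is a sum of `m` geometrically decreasing increments, each at least as large as the
next increment `pm * (1 - pm) ^ m`. -/
theorem mul_pow_le_rK (m : ℕ) : m * (pm * (1 - pm) ^ m) ≤ rK pm m := by
  induction m with
  | zero => simp [rK]
  | succ m ih =>
    have h2 : rK pm (m + 1) = rK pm m + pm * (1 - pm) ^ m := by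
      unfold rK
      ring
    have h3 : pm * (1 - pm) ^ (m + 1) ≤ pm * (1 - pm) ^ m :=
      mul_le_mul_of_nonneg_left (pow_le_pow_of_le_one (by linarith) (by linarith) (Nat.le_succ m))
        h0.le
    rw [h2]
    push_cast
    have : (m : ℝ) * (pm * (1 - pm) ^ (m + 1)) ≤ m * (pm * (1 - pm) ^ m) := by gcongr
    linarith

/-- Decreasing increments make `r` concave with `r_0 = 0`; the cross-multiplied form says that `r_m
/ m` is nonincreasing. -/
theorem mul_rK_le {m n : ℕ} (hmn : m ≤ n) : m * rK pm n ≤ n * rK pm m := by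
  induction n, hmn using Nat.le_induction with
  | base => exact le_rfl
  | succ n hmn ih =>
    have h2 : rK pm (n + 1) = rK pm n + pm * (1 - pm) ^ n := by
      unfold rK
      ring
    have h3 : (m : ℝ) * (pm * (1 - pm) ^ n) ≤ m * (pm * (1 - pm) ^ m) := by
      have := pow_le_pow_of_le_one (by linarith) (by linarith : 1 - pm ≤ 1) hmn
      gcongr
    have h4 := mul_pow_le_rK h0 h1 m
    rw [h2]
    push_cast
    linarith

theorem mul_muSym_le {m n : ℕ} (hmn : m ≤ n) : m * muSym pm n ≤ rK pm m := by
  rw [muSym_eq]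
  rcases Nat.eq_zero_or_pos n with rfl | hn
  · simpa using rK_nonneg h0 h1 m
  · rw [mul_div_assoc', div_le_iff₀ (by exact_mod_cast hn), mul_comm (rK pm m)]
    exact mul_rK_le h0 h1 hmn

theorem muSym_anti {m n : ℕ} (hm : 1 ≤ m) (hmn : m ≤ n) : muSym pm n ≤ muSym pm m := by
  rw [muSym_eq pm m, le_div_iff₀ (by exact_mod_cast hm), mul_comm]
  exact mul_muSym_le h0 h1 hmn

theorem muSym_nonneg (m : ℕ) : 0 ≤ muSym pm m := by
  rw [muSym_eq]
  exact div_nonneg (rK_nonneg h0 h1 m) (Nat.cast_nonneg m)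

theorem muSym_pos {m : ℕ} (hm : 1 ≤ m) : 0 < muSym pm m := by
  rw [muSym_eq]
  exact div_pos (rK_pos h0 h1 hm) (by exact_mod_cast hm)

end RK

/-! ### Level sets of the backlog and the slack they provide. -/

section LevelSet

variable {N : ℕ}

/-- The set of queues with more than `v` packets. -/
def levelSet (q : Fin N → ℕ) (v : ℕ) : Finset (Fin N) := Finset.univ.filter fun i => v < q i

theorem mem_levelSet {q : Fin N → ℕ} {v : ℕ} {i : Fin N} : i ∈ levelSet q v ↔ v < q i := by
  simp [levelSet]

theorem levelSet_anti (q : Fin N → ℕ) {u v : ℕ} (h : u ≤ v) : levelSet q v ⊆ levelSet q u :=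
  fun _ hi => mem_levelSet.2 (h.trans_lt (mem_levelSet.1 hi))

theorem sum_range_ite_lt {n V : ℕ} (h : n ≤ V) :
    ∑ v ∈ Finset.range V, (if v < n then 1 else 0) = n := by
  rw [← Finset.sum_filter, Finset.sum_const, smul_eq_mul, mul_one]
  have : (Finset.range V).filter (· < n) = Finset.range n := by
    ext v
    simp only [Finset.mem_filter, Finset.mem_range]
    omega
  rw [this, Finset.card_range]

theorem le_sum_coords (q : Fin N → ℕ) (i : Fin N) : q i ≤ ∑ j, q j :=
  Finset.single_le_sum (fun _ _ => Nat.zero_le _) (Finset.mem_univ i)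

/-- Layer cake formula: `q i` counts the levels `v < q i`. The total backlog serves as a common
upper limit for all queues. Weighted sums thus reduce to sums over sets, where the capacity
constraints apply. -/
theorem sum_mul_eq_levelSet (q : Fin N → ℕ) (x : Fin N → ℝ) :
    ∑ i, (q i : ℝ) * x i = ∑ v ∈ Finset.range (∑ i, q i), ∑ i ∈ levelSet q v, x i := by
  simp only [levelSet, Finset.sum_filter]
  rw [Finset.sum_comm]
  refine Finset.sum_congr rfl fun i _ => ?_
  have := sum_range_ite_lt (le_sum_coords q i)
  rw [← Finset.sum_filter, Finset.sum_const, nsmul_eq_mul]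
  rw [← Finset.sum_filter, Finset.sum_const, smul_eq_mul, mul_one] at this
  rw [this]

theorem sum_eq_levelSet (q : Fin N → ℕ) :
    ∑ i, (q i : ℝ) = ∑ v ∈ Finset.range (∑ i, q i), ((levelSet q v).card : ℝ) := by
  simpa using sum_mul_eq_levelSet q fun _ => 1

/-- The weight of the longest connected queue, decomposed into levels. -/
theorem weight_eq_sum_levelSet (q : Fin N → ℕ) (s : Fin N → Bool) (j : Fin N)
    (hj : ∀ i, q i * (s i).toNat ≤ q j * (s j).toNat) :
    q j * (s j).toNat =
      ∑ v ∈ Finset.range (∑ i, q i), if ∃ i ∈ levelSet q v, s i = true then 1 else 0 := by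
  have hle : q j * (s j).toNat ≤ ∑ i, q i :=
    (Nat.mul_le_mul_left _ (Bool.toNat_le _)).trans ((mul_one (q j)).le.trans (le_sum_coords q j))
  rw [← sum_range_ite_lt hle]
  refine Finset.sum_congr rfl fun v _ => ?_
  congr 1
  refine propext ⟨fun hv => ⟨j, ?_⟩, ?_⟩
  · cases hs : s j
    · simp [hs] at hv
    · rw [hs] at hv
      simpa [mem_levelSet] using hv
  · rintro ⟨i, hi, hs⟩
    have := hj i
    rw [hs] at this
    exact (mem_levelSet.1 hi).trans_le (by simpa using this)

end LevelSet

section DriftAlgebra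

variable {N : ℕ} {p l d : Fin N → ℝ} {q : Fin N → ℕ} {ρ pm : ℝ} (h0 : 0 < pm) (h1 : pm < 1)
  (hp : ∀ i, pm ≤ p i) (hp1 : ∀ i, p i ≤ 1) (hρ1 : ρ < 1)
  (hl : ∀ M : Finset (Fin N), ∑ i ∈ M, l i ≤ ρ * onProb p M)
  (hd : ∑ i, (q i : ℝ) * d i = ∑ v ∈ Finset.range (∑ i, q i), onProb p (levelSet q v))
include h0 h1 hp hp1 hρ1 hl hd

/-- Here `d` stands for the expected service. A level set of size `m ≤ n` has slack at least `(1 -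
ρ) r_m ≥ (1 - ρ) m μ_n^sym`, and the sizes of the level sets add up to the total backlog. -/
theorem weighted_drift_ge {n : ℕ} (hn : (levelSet q 0).card ≤ n) :
    (1 - ρ) * muSym pm n * ∑ i, (q i : ℝ) ≤ ∑ i, (q i : ℝ) * (d i - l i) := by
  simp only [mul_sub, Finset.sum_sub_distrib]
  rw [hd, sum_mul_eq_levelSet q l, sum_eq_levelSet, Finset.mul_sum, ← Finset.sum_sub_distrib]
  refine Finset.sum_le_sum fun v _ => ?_
  have h2 := rK_le_onProb hp hp1 (levelSet q v)
  have h3 := mul_muSym_le h0 h1 ((Finset.card_le_card (levelSet_anti q (Nat.zero_le v))).trans hn)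
  have h4 := hl (levelSet q v)
  have h5 : (1 - ρ) * ((levelSet q v).card * muSym pm n) ≤ (1 - ρ) * onProb p (levelSet q v) :=
    mul_le_mul_of_nonneg_left (h3.trans h2) (by linarith)
  linarith

/-- With more than `K` nonempty queues, the weighted drift uses `muSym pm N` and the total drift
gains at least `θ (r_{K+1} - λ_tot)` per packet. With at most `K`, the weighted drift uses `muSym pm
K` and the total drift loses at most `θ λ_tot`. The choice `θ r_{K+1} = (1 - ρ)(μ_K^sym - μ_N^sym)`
gives both cases the same coefficient `(1 - ρ) μ_K^sym - θ λ_tot`. -/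
theorem weighted_drift_ge_of_card_lt (hd' : ∑ i, d i = onProb p (levelSet q 0)) {K : ℕ}
    (hK : 1 ≤ K) (hKN : K < N) :
    (1 - ρ) / rK pm (K + 1) * (muSym pm N * ∑ i, l i + muSym pm K * (rK pm (K + 1) - ∑ i, l i)) *
        ∑ i, (q i : ℝ) ≤
      ∑ i, (q i : ℝ) * (d i - l i) +
        thetaConst ρ pm N K * ((∑ i, (q i : ℝ)) * (∑ i, d i - ∑ i, l i)) := by
  have hr := rK_pos h0 h1 (k := K + 1) (by omega)
  have hmu := muSym_anti h0 h1 hK hKN.le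
  have hq : (0 : ℝ) ≤ ∑ i, (q i : ℝ) := Finset.sum_nonneg fun i _ => Nat.cast_nonneg _
  have hθ : 0 ≤ thetaConst ρ pm N K := by
    rw [thetaConst, if_pos hKN]
    exact div_nonneg (mul_nonneg (by linarith) (by linarith)) hr.le
  have hθ' : thetaConst ρ pm N K * rK pm (K + 1) = (1 - ρ) * (muSym pm K - muSym pm N) := by
    rw [thetaConst, if_pos hKN, div_mul_cancel₀ _ hr.ne']
  have hε : (1 - ρ) / rK pm (K + 1) *
      (muSym pm N * ∑ i, l i + muSym pm K * (rK pm (K + 1) - ∑ i, l i)) =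
      (1 - ρ) * muSym pm K - thetaConst ρ pm N K * ∑ i, l i := by
    rw [thetaConst, if_pos hKN]
    field_simp
    ring
  have hon := rK_le_onProb hp hp1 (levelSet q 0)
  rw [hε, hd']
  rcases Nat.lt_or_ge K (levelSet q 0).card with hc | hc
  · have h2 := weighted_drift_ge h0 h1 hp hp1 hρ1 hl hd
      ((Finset.card_le_univ (levelSet q 0)).trans (Fintype.card_fin N).le)
    have h3 : rK pm (K + 1) ≤ onProb p (levelSet q 0) := (rK_mono h0 h1 hc).trans hon
    have h4 : thetaConst ρ pm N K * ((∑ i, (q i : ℝ)) * (rK pm (K + 1) - ∑ i, l i)) ≤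
        thetaConst ρ pm N K * ((∑ i, (q i : ℝ)) * (onProb p (levelSet q 0) - ∑ i, l i)) := by
      gcongr
    have h5 : thetaConst ρ pm N K * ((∑ i, (q i : ℝ)) * (rK pm (K + 1) - ∑ i, l i)) =
        ((1 - ρ) * (muSym pm K - muSym pm N) - thetaConst ρ pm N K * ∑ i, l i) *
          ∑ i, (q i : ℝ) := by
      rw [← hθ']
      ring
    linarith
  · have h2 := weighted_drift_ge h0 h1 hp hp1 hρ1 hl hd hc
    have h3 : thetaConst ρ pm N K * ((∑ i, (q i : ℝ)) * (0 - ∑ i, l i)) ≤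
        thetaConst ρ pm N K * ((∑ i, (q i : ℝ)) * (onProb p (levelSet q 0) - ∑ i, l i)) := by
      have := (rK_nonneg h0 h1 _).trans hon
      gcongr
    linarith

end DriftAlgebra

/-! ### One-step expectation of the quadratic potential. -/

/-- The quadratic `x² / 2 + (1 / 2 - a) x`. -/
noncomputable def quad (a x : ℝ) : ℝ := x ^ 2 / 2 + (1 / 2 - a) * x

/-- The function is `x (x + 1 - 2 a) / 2`, which may be negative between `0` and `1`; integrality of
`x` is essential. -/
theorem quad_nonneg {a : ℝ} (ha : a ≤ 1) (x : ℕ) : 0 ≤ quad a x := by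
  unfold quad
  rcases Nat.eq_zero_or_pos x with rfl | hx
  · simp
  · have : (1 : ℝ) ≤ x := by exact_mod_cast hx
    nlinarith

/-- The linear term of `quad` is tuned to make the drift exact: since `D ^ 2 = D`, the terms in `D`
free of `x` combine to `a * D - A * D`, whose mean vanishes by independence. -/
theorem quad_step {Ω : Type*} [MeasurableSpace Ω] {P : Measure Ω} [IsProbabilityMeasure P]
    {A D : Ω → ℕ} (hA : MemLp (fun ω => (A ω : ℝ)) 2 P) (hD : Measurable D) (hD1 : ∀ ω, D ω ≤ 1)
    (hind : IndepFun A D P) (x : ℕ) (hDx : ∀ ω, D ω ≤ x) :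
    Integrable (fun ω => quad (∫ ω, (A ω : ℝ) ∂P) ((x - D ω + A ω : ℕ) : ℝ)) P ∧
    ∫ ω, quad (∫ ω, (A ω : ℝ) ∂P) ((x - D ω + A ω : ℕ) : ℝ) ∂P =
      quad (∫ ω, (A ω : ℝ) ∂P) x + 1 / 2 * ∫ ω, (A ω : ℝ) ^ 2 ∂P + 1 / 2 * ∫ ω, (A ω : ℝ) ∂P -
        (∫ ω, (A ω : ℝ) ∂P) ^ 2 - x * (∫ ω, (D ω : ℝ) ∂P - ∫ ω, (A ω : ℝ) ∂P) := by
  set a := ∫ ω, (A ω : ℝ) ∂P with ha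
  have hDm : Measurable fun ω => (D ω : ℝ) :=
    (measurable_of_countable (fun n : ℕ => (n : ℝ))).comp hD
  have hDi : Integrable (fun ω => (D ω : ℝ)) P := by
    refine Integrable.of_bound hDm.aestronglyMeasurable 1 (Eventually.of_forall fun ω => ?_)
    rw [Real.norm_natCast]
    exact_mod_cast hD1 ω
  have hAi : Integrable (fun ω => (A ω : ℝ)) P := hA.integrable one_le_two
  have hA2 : Integrable (fun ω => (A ω : ℝ) ^ 2) P := hA.integrable_sq
  have hind' : IndepFun (fun ω => (A ω : ℝ)) (fun ω => (D ω : ℝ)) P :=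
    hind.comp (measurable_of_countable (fun n : ℕ => (n : ℝ)))
      (measurable_of_countable (fun n : ℕ => (n : ℝ)))
  have hAD : Integrable (fun ω => (A ω : ℝ) * D ω) P := hind'.integrable_mul hAi hDi
  have hADval : ∫ ω, (A ω : ℝ) * D ω ∂P = a * ∫ ω, (D ω : ℝ) ∂P :=
    hind'.integral_fun_mul_eq_mul_integral hAi.aestronglyMeasurable hDi.aestronglyMeasurable
  have hpt : ∀ ω, quad a ((x - D ω + A ω : ℕ) : ℝ) = quad a x + (a - x) * D ω +
      (x + 1 / 2 - a) * A ω + 1 / 2 * (A ω : ℝ) ^ 2 - (A ω : ℝ) * D ω := by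
    intro ω
    have h2 : (D ω : ℝ) ^ 2 = D ω := by
      have := hD1 ω
      interval_cases D ω <;> norm_num
    unfold quad
    rw [Nat.cast_add, Nat.cast_sub (hDx ω)]
    linear_combination h2 / 2
  simp only [hpt]
  have i1 : Integrable (fun ω => quad a x + (a - x) * D ω) P :=
    (integrable_const _).add (hDi.const_mul _)
  have i2 : Integrable (fun ω => quad a x + (a - x) * D ω + (x + 1 / 2 - a) * A ω) P :=
    i1.add (hAi.const_mul (x + 1 / 2 - a))
  have i3 : Integrable (fun ω => quad a x + (a - x) * D ω + (x + 1 / 2 - a) * A ω +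
      1 / 2 * (A ω : ℝ) ^ 2) P := i2.add (hA2.const_mul (1 / 2))
  refine ⟨i3.sub hAD, ?_⟩
  rw [integral_sub i3 hAD, integral_add i2 (hA2.const_mul _), integral_add i1 (hAi.const_mul _),
    integral_add (integrable_const _) (hDi.const_mul _), integral_const_mul, integral_const_mul,
    integral_const_mul, hADval]
  simp only [integral_const, probReal_univ, smul_eq_mul]
  rw [← ha]
  ring

/-! ### The max-weight rule and its drift. -/

/-- A max-weight rule: a measurable selection of a link with the largest product of backlog and
channel state. -/
structure IsMaxWeightRule {N : ℕ} (g : (Fin N → ℕ) → (Fin N → Bool) → ℝ → Fin N) : Prop where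
  meas : ∀ (q : Fin N → ℕ) (s : Fin N → Bool), Measurable (g q s)
  isMax : ∀ (q : Fin N → ℕ) (s : Fin N → Bool) (u : ℝ) (j : Fin N),
    q j * (s j).toNat ≤ q (g q s u) * (s (g q s u)).toNat

/-- The number of packets served from queue `i` in one slot. -/
def lcqServed {N : ℕ} (g : (Fin N → ℕ) → (Fin N → Bool) → ℝ → Fin N) (q : Fin N → ℕ)
    (s : Fin N → Bool) (u : ℝ) (i : Fin N) : ℕ :=
  min (q i) (linkRate (some (g q s u)) s i)

/-- The backlogs after one slot. -/
def lcqStep {N : ℕ} (g : (Fin N → ℕ) → (Fin N → Bool) → ℝ → Fin N) (q : Fin N → ℕ)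
    (e : (Fin N → ℕ) × (Fin N → Bool) × ℝ) (i : Fin N) : ℕ :=
  q i - lcqServed g q e.2.1 e.2.2 i + e.1 i

section Served

variable {N : ℕ} {g : (Fin N → ℕ) → (Fin N → Bool) → ℝ → Fin N}

theorem lcqServed_le_one (q : Fin N → ℕ) (s : Fin N → Bool) (u : ℝ) (i : Fin N) :
    lcqServed g q s u i ≤ 1 := (min_le_right _ _).trans (linkRate_le_one _ _ _)

theorem lcqServed_le (q : Fin N → ℕ) (s : Fin N → Bool) (u : ℝ) (i : Fin N) :
    lcqServed g q s u i ≤ q i := min_le_left _ _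

theorem sum_lcqStep (q : Fin N → ℕ) (e : (Fin N → ℕ) × (Fin N → Bool) × ℝ) :
    ∑ i, lcqStep g q e i = ∑ i, q i - ∑ i, lcqServed g q e.2.1 e.2.2 i + ∑ i, e.1 i := by
  simp only [lcqStep, Finset.sum_add_distrib]
  rw [Finset.sum_tsub_distrib _ fun i _ => lcqServed_le q e.2.1 e.2.2 i]

variable (hg : IsMaxWeightRule g)
include hg

theorem measurable_lcqServed (q : Fin N → ℕ) (i : Fin N) :
    Measurable fun x : (Fin N → Bool) × ℝ => lcqServed g q x.1 x.2 i := by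
  refine measurable_from_prod_countable_right fun s => ?_
  exact (measurable_of_countable fun j : Fin N => min (q i) (linkRate (some j) s i)).comp
    (hg.meas q s)

theorem measurable_lcqStep (q : Fin N → ℕ) : Measurable (lcqStep g q) := by
  refine measurable_pi_lambda _ fun i => Measurable.add ?_ ?_
  · exact measurable_const.sub ((measurable_lcqServed hg q i).comp measurable_snd)
  · exact (measurable_pi_apply i).comp measurable_fst

theorem sum_mul_lcqServed (q : Fin N → ℕ) (s : Fin N → Bool) (u : ℝ) :
    ∑ i, q i * lcqServed g q s u i =
      ∑ v ∈ Finset.range (∑ i, q i), if ∃ i ∈ levelSet q v, s i = true then 1 else 0 := by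
  rw [← weight_eq_sum_levelSet q s (g q s u) (hg.isMax q s u),
    Finset.sum_eq_single (g q s u)]
  · simp only [lcqServed, linkRate, if_true]
    cases s (g q s u)
    · simp
    · rcases Nat.eq_zero_or_pos (q (g q s u)) with h | h
      · simp [h]
      · simp [Nat.min_eq_right h]
  · intro i _ hi
    simp [lcqServed, linkRate, hi.symm]
  · simp

/-- Max-weight never idles when a nonempty queue is ON: a positive product exists, so the maximal
one is positive. Level `0` is the set of nonempty queues. -/
theorem sum_lcqServed (q : Fin N → ℕ) (s : Fin N → Bool) (u : ℝ) :
    ∑ i, lcqServed g q s u i = if ∃ i ∈ levelSet q 0, s i = true then 1 else 0 := by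
  rw [Finset.sum_eq_single (g q s u)]
  · have hmax := hg.isMax q s u
    simp only [lcqServed, linkRate, if_true]
    by_cases hex : ∃ i ∈ levelSet q 0, s i = true
    · rw [if_pos hex]
      obtain ⟨i, hi, hs⟩ := hex
      have h2 := hmax i
      have h3 := mem_levelSet.1 hi
      rw [hs] at h2
      have h4 : 0 < q (g q s u) * (s (g q s u)).toNat := lt_of_lt_of_le (by simpa using h3) h2
      have h5 := pos_of_mul_pos_left h4 (Nat.zero_le _)
      have h6 := pos_of_mul_pos_right h4 (Nat.zero_le _)
      have h7 := Bool.toNat_le (s (g q s u))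
      omega
    · rw [if_neg hex]
      push Not at hex
      cases hs : s (g q s u)
      · simp
      · have := hex (g q s u)
        rw [mem_levelSet] at this
        have : q (g q s u) = 0 := by
          by_contra hne
          exact this (Nat.pos_of_ne_zero hne) hs
        simp [this]
  · intro i _ hi
    simp [lcqServed, linkRate, hi.symm]
  · simp

end Served

namespace OnOffSystem

variable {N : ℕ} {Ω : Type*} [MeasurableSpace Ω] (sys : OnOffSystem N Ω)

/-- The Lyapunov function of the drift argument. -/
noncomputable def potential (θ : ℝ) (q : Fin N → ℕ) : ℝ :=
  ∑ i, quad (sys.lam i) (q i) + θ * quad sys.lamTot (∑ i, q i : ℕ)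

theorem integral_exists_on (M : Finset (Fin N)) :
    Integrable (fun ω => (((if ∃ i ∈ M, sys.S i 0 ω = true then 1 else 0 : ℕ)) : ℝ)) sys.P ∧
    ∫ ω, (((if ∃ i ∈ M, sys.S i 0 ω = true then 1 else 0 : ℕ)) : ℝ) ∂sys.P = onProb sys.p M := by
  have := sys.isProb
  have hm : MeasurableSet {ω | ∃ i ∈ M, sys.S i 0 ω = true} := by
    have : {ω | ∃ i ∈ M, sys.S i 0 ω = true} = ⋃ i ∈ M, sys.S i 0 ⁻¹' {true} := by ext; simp
    rw [this]
    exact Finset.measurableSet_biUnion _ fun i _ =>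
      sys.measurable_S i 0 (measurableSet_singleton true)
  have heq : (fun ω => (((if ∃ i ∈ M, sys.S i 0 ω = true then 1 else 0 : ℕ)) : ℝ)) =
      {ω | ∃ i ∈ M, sys.S i 0 ω = true}.indicator 1 := by
    funext ω
    simp [Set.indicator]
  rw [heq]
  exact ⟨(integrable_const (1 : ℝ)).indicator hm,
    (integral_indicator_one hm).trans (sys.prob_exists_on M 0)⟩

variable {g : (Fin N → ℕ) → (Fin N → Bool) → ℝ → Fin N} (hg : IsMaxWeightRule g)
include hg

theorem measurable_served (q : Fin N → ℕ) (i : Fin N) :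
    Measurable fun ω => lcqServed g q (sys.noise 0 ω).2.1 (sys.noise 0 ω).2.2 i := by
  have := (sys.isDrivingNoise.measurable 0)
  exact (measurable_lcqServed hg q i).comp this.snd

theorem integrable_served (q : Fin N → ℕ) (i : Fin N) :
    Integrable (fun ω => (lcqServed g q (sys.noise 0 ω).2.1 (sys.noise 0 ω).2.2 i : ℝ)) sys.P := by
  have := sys.isProb
  refine Integrable.of_bound ((measurable_of_countable (fun n : ℕ => (n : ℝ))).comp
    (sys.measurable_served hg q i)).aestronglyMeasurable 1 (Eventually.of_forall fun ω => ?_)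
  rw [Real.norm_natCast]
  exact_mod_cast lcqServed_le_one q _ _ i

theorem sum_mul_integral_served (q : Fin N → ℕ) :
    ∑ i, (q i : ℝ) * ∫ ω, (lcqServed g q (sys.noise 0 ω).2.1 (sys.noise 0 ω).2.2 i : ℝ) ∂sys.P =
      ∑ v ∈ Finset.range (∑ i, q i), onProb sys.p (levelSet q v) := by
  simp only [← integral_const_mul]
  rw [← integral_finsetSum _ fun i _ => (sys.integrable_served hg q i).const_mul _]
  have h := fun ω => congrArg (Nat.cast (R := ℝ))
    (sum_mul_lcqServed hg q (sys.noise 0 ω).2.1 (sys.noise 0 ω).2.2)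
  simp only [Nat.cast_sum, Nat.cast_mul] at h
  simp only [h]
  refine (integral_finsetSum _ fun v _ => (sys.integral_exists_on (levelSet q v)).1).trans ?_
  exact Finset.sum_congr rfl fun v _ => (sys.integral_exists_on (levelSet q v)).2

theorem sum_integral_served (q : Fin N → ℕ) :
    ∑ i, ∫ ω, (lcqServed g q (sys.noise 0 ω).2.1 (sys.noise 0 ω).2.2 i : ℝ) ∂sys.P =
      onProb sys.p (levelSet q 0) := by
  rw [← integral_finsetSum _ fun i _ => sys.integrable_served hg q i]
  have h := fun ω => congrArg (Nat.cast (R := ℝ))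
    (sum_lcqServed hg q (sys.noise 0 ω).2.1 (sys.noise 0 ω).2.2)
  simp only [Nat.cast_sum] at h
  simp only [h]
  exact (sys.integral_exists_on (levelSet q 0)).2

/-- `quad_step` applies to each queue and also to the total backlog, because at most one packet is
served in total. The constants collected are exactly `B_θ`. -/
theorem integral_potential (θ : ℝ) (q : Fin N → ℕ) :
    Integrable (fun ω => sys.potential θ (lcqStep g q (sys.noise 0 ω))) sys.P ∧
    ∫ ω, sys.potential θ (lcqStep g q (sys.noise 0 ω)) ∂sys.P =
      sys.potential θ q + sys.bConst θ -
        (∑ i, (q i : ℝ) *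
          (∫ ω, (lcqServed g q (sys.noise 0 ω).2.1 (sys.noise 0 ω).2.2 i : ℝ) ∂sys.P - sys.lam i) +
        θ * ((∑ i, (q i : ℝ)) *
          (∑ i, ∫ ω, (lcqServed g q (sys.noise 0 ω).2.1 (sys.noise 0 ω).2.2 i : ℝ) ∂sys.P -
            ∑ i, sys.lam i))) := by
  have := sys.isProb
  have hind := sys.indepFun_arrivals 0
  have h1 : ∀ i, _ := fun i => quad_step (sys.memLp_A i 0) (sys.measurable_served hg q i)
    (fun ω => lcqServed_le_one q _ _ i)
    (hind.comp (φ := fun x : Fin N → ℕ => x i) (measurable_pi_apply i)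
      (measurable_lcqServed hg q i)) (q i) (fun ω => lcqServed_le q _ _ i)
  have hAtot : ∫ ω, ((∑ i, sys.A i 0 ω : ℕ) : ℝ) ∂sys.P = sys.lamTot := by
    simp only [Nat.cast_sum]
    rw [integral_finsetSum _ fun i _ => sys.integrable_A i 0]
    rfl
  have hDtot : ∫ ω, ((∑ i, lcqServed g q (sys.noise 0 ω).2.1 (sys.noise 0 ω).2.2 i : ℕ) : ℝ)
      ∂sys.P = ∑ i, ∫ ω, (lcqServed g q (sys.noise 0 ω).2.1 (sys.noise 0 ω).2.2 i : ℝ) ∂sys.P := by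
    simp only [Nat.cast_sum]
    rw [integral_finsetSum _ fun i _ => sys.integrable_served hg q i]
  have hA2 : ∫ ω, ((∑ i, sys.A i 0 ω : ℕ) : ℝ) ^ 2 ∂sys.P = sys.secondMomentTot := by
    simp only [Nat.cast_sum]
    rfl
  have h2 := quad_step (P := sys.P) (A := fun ω => ∑ i, sys.A i 0 ω)
    (D := fun ω => ∑ i, lcqServed g q (sys.noise 0 ω).2.1 (sys.noise 0 ω).2.2 i)
    (by simpa only [Nat.cast_sum] using memLp_finsetSum _ fun i _ => sys.memLp_A i 0)
    (Finset.measurable_sum _ fun i _ => sys.measurable_served hg q i)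
    (fun ω => by rw [sum_lcqServed hg]; split_ifs <;> simp)
    (hind.comp (φ := fun x : Fin N → ℕ => ∑ i, x i) (by fun_prop)
      (Finset.measurable_sum _ fun i _ => measurable_lcqServed hg q i)) (∑ i, q i)
    (fun ω => Finset.sum_le_sum fun i _ => lcqServed_le q _ _ i)
  rw [hAtot, hDtot, hA2] at h2
  have hlam : ∀ i, ∫ ω, (sys.A i 0 ω : ℝ) ∂sys.P = sys.lam i := fun i => rfl
  have hsec : ∀ i, ∫ ω, (sys.A i 0 ω : ℝ) ^ 2 ∂sys.P = sys.secondMoment i := fun i => rfl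
  simp only [hlam, hsec] at h1
  have hstep : ∀ ω, sys.potential θ (lcqStep g q (sys.noise 0 ω)) =
      ∑ i, quad (sys.lam i)
        ((q i - lcqServed g q (sys.noise 0 ω).2.1 (sys.noise 0 ω).2.2 i + sys.A i 0 ω : ℕ) : ℝ) +
      θ * quad sys.lamTot ((∑ i, q i -
        ∑ i, lcqServed g q (sys.noise 0 ω).2.1 (sys.noise 0 ω).2.2 i + ∑ i, sys.A i 0 ω : ℕ) : ℝ) := by
    intro ω
    unfold potential
    rw [sum_lcqStep]
    rfl
  simp only [hstep]
  have i1 := integrable_finsetSum Finset.univ fun i _ => (h1 i).1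
  refine ⟨i1.add (h2.1.const_mul θ), ?_⟩
  rw [integral_add i1 (h2.1.const_mul θ), integral_finsetSum _ fun i _ => (h1 i).1,
    integral_const_mul, h2.2]
  simp only [(h1 _).2]
  simp only [potential, bConst, Finset.sum_add_distrib, Finset.sum_sub_distrib, ← Finset.mul_sum]
  rw [← lamTot]
  push_cast
  ring

end OnOffSystem

/-! ### From drift to bounds on time averages. -/

/-- A drift condition bounds time averages. -/
theorem IsDrivingNoise.timeAverage_le {Ω E : Type*} [mΩ : MeasurableSpace Ω] [MeasurableSpace E]
    {P : Measure Ω} [IsProbabilityMeasure P] {𝓕 : ℕ → MeasurableSpace Ω} {ξ : ℕ → Ω → E}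
    {κ : Measure (ℕ → E)} {σ : Type*} [MeasurableSpace σ] [MeasurableSingletonClass σ]
    [Countable σ] {F : σ → E → σ} {X₀ : Ω → σ} {w V : σ → ℝ≥0∞} {b m : ℝ≥0∞}
    (h : IsDrivingNoise P 𝓕 ξ κ) (hF : ∀ q, Measurable (F q)) (hX₀ : Measurable[𝓕 0] X₀)
    (hV : ∀ q, w q + ∫⁻ ω, V (F q (ξ 0 ω)) ∂P ≤ V q + b) (h0 : ∫⁻ ω, V (X₀ ω) ∂P ≠ ⊤)
    (hm : Tendsto (slotAverage fun t => ∫⁻ ω, w (chainPath F (X₀ ω) (ξ · ω) t) ∂P) atTop (𝓝 m)) :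
    m ≤ b := by
  have hXm := h.measurable_path' hF hX₀
  have hVm : Measurable fun x : σ × E => V (F x.1 x.2) :=
    (measurable_of_countable V).comp (measurable_from_prod_countable_right hF)
  have hstep : ∀ t, ∫⁻ ω, w (chainPath F (X₀ ω) (ξ · ω) t) ∂P +
      ∫⁻ ω, V (chainPath F (X₀ ω) (ξ · ω) (t + 1)) ∂P ≤
      ∫⁻ ω, V (chainPath F (X₀ ω) (ξ · ω) t) ∂P + b := by
    intro t
    have h1 := h.lintegral_future t (h.measurable_path hF hX₀ le_rfl)
      (G := fun q e => V (F q (e 0)))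
      (hVm.comp (measurable_fst.prodMk ((measurable_pi_apply 0).comp measurable_snd)))
    have h2 : ∀ q, ∫⁻ e, V (F q (e 0)) ∂κ = ∫⁻ ω, V (F q (ξ 0 ω)) ∂P := by
      intro q
      have hm : Measurable fun e : ℕ → E => V (F q (e 0)) :=
        hVm.comp (measurable_const.prodMk (measurable_pi_apply 0))
      rw [← h.law 0, lintegral_map hm (h.measurable_future 0)]
    simp only [h2] at h1
    have h3 : ∫⁻ ω, V (chainPath F (X₀ ω) (ξ · ω) (t + 1)) ∂P = _ := h1
    have hwm : Measurable fun ω => w (chainPath F (X₀ ω) (ξ · ω) t) :=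
      (measurable_of_countable w).comp (hXm t)
    rw [h3, ← lintegral_add_left hwm]
    calc _ ≤ ∫⁻ ω, (V (chainPath F (X₀ ω) (ξ · ω) t) + b) ∂P := lintegral_mono fun ω => hV _
      _ = _ := by
        rw [lintegral_add_right _ measurable_const]
        simp
  -- The drift inequalities telescope; the final potential is nonnegative and is dropped after
  -- division by `T`.
  have hsum : ∀ T : ℕ, ∑ t ∈ Finset.range T, ∫⁻ ω, w (chainPath F (X₀ ω) (ξ · ω) t) ∂P +
      ∫⁻ ω, V (chainPath F (X₀ ω) (ξ · ω) T) ∂P ≤ ∫⁻ ω, V (X₀ ω) ∂P + T * b := by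
    intro T
    induction T with
    | zero => simp [chainPath]
    | succ T ih =>
      rw [Finset.sum_range_succ, add_assoc]
      push_cast
      calc _ ≤ ∑ t ∈ Finset.range T, ∫⁻ ω, w (chainPath F (X₀ ω) (ξ · ω) t) ∂P +
            (∫⁻ ω, V (chainPath F (X₀ ω) (ξ · ω) T) ∂P + b) :=
          add_le_add_right (hstep T) _
        _ ≤ ∫⁻ ω, V (X₀ ω) ∂P + T * b + b := by rw [← add_assoc]; gcongr
        _ = _ := by ring
  have hup : Tendsto (fun T : ℕ => (∫⁻ ω, V (X₀ ω) ∂P) / (T : ℝ≥0∞) + b) atTop (𝓝 b) := by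
    have h1 : Tendsto (fun T : ℕ => (∫⁻ ω, V (X₀ ω) ∂P) / (T : ℝ≥0∞)) atTop (𝓝 0) :=
      (ENNReal.Tendsto.const_div ENNReal.tendsto_nat_nhds_top (Or.inr h0)).trans (by simp)
    simpa using h1.add_const b
  refine le_of_tendsto_of_tendsto hm hup ?_
  filter_upwards [eventually_gt_atTop 0] with T hT
  have hT' : (T : ℝ≥0∞) ≠ 0 := by exact_mod_cast hT.ne'
  unfold slotAverage
  calc _ ≤ (∫⁻ ω, V (X₀ ω) ∂P + T * b) / T :=
        ENNReal.div_le_div_right (le_self_add.trans (hsum T)) _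
    _ = _ := by rw [ENNReal.add_div, mul_comm, ENNReal.mul_div_cancel_right hT' (by simp)]

/-! ### Positive recurrence of the empty state under LCQ. -/

namespace OnOffSystem

variable {N : ℕ} {Ω : Type*} [MeasurableSpace Ω] (sys : OnOffSystem N Ω)

theorem p_le_one (i : Fin N) : sys.p i ≤ 1 := by
  have := sys.isProb
  rw [← sys.prob_on i 0]
  exact measureReal_le_one

theorem pMin_le (i : Fin N) : sys.pMin ≤ sys.p i :=
  ciInf_le (Set.finite_range _).bddBelow i

theorem pos_of_pMin_pos (h : 0 < sys.pMin) : 0 < N := by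
  rcases Nat.eq_zero_or_pos N with rfl | hN
  · simp [pMin] at h
  · exact hN

/-- An integer valued variable that is almost surely nonzero has mean at least `1`. -/
theorem prob_no_arrival_pos (i : Fin N) (h : sys.lam i < 1) :
    0 < sys.P {ω | sys.A i 0 ω = 0} := by
  have := sys.isProb
  by_contra! hle
  have hae : ∀ᵐ ω ∂sys.P, 1 ≤ (sys.A i 0 ω : ℝ) := by
    have h1 : ∀ᵐ ω ∂sys.P, ¬ sys.A i 0 ω = 0 := by
      rw [ae_iff]
      simpa using hle
    filter_upwards [h1] with ω hω
    exact_mod_cast Nat.one_le_iff_ne_zero.2 hω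
  have h2 := integral_mono_ae (integrable_const (1 : ℝ)) (sys.integrable_A i 0) hae
  rw [sys.integral_A i 0] at h2
  simp at h2
  linarith

/-- With positive probability, no packet arrives and all channels are ON. -/
theorem prob_idle_pos (hp : 0 < sys.pMin) (hl : ∀ i, sys.lam i < 1) :
    0 < sys.P.real {ω | (∀ i, sys.A i 0 ω = 0) ∧ ∀ i, sys.S i 0 ω = true} := by
  have := sys.isProb
  have hA : sys.P (⋂ i ∈ Finset.univ, sys.A i 0 ⁻¹' {0}) ≠ 0 := by
    have hind : iIndepFun (fun i => sys.A i 0) sys.P :=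
      sys.indep_A.precomp (g := fun i : Fin N => (i, 0)) fun i j h => (Prod.mk.inj h).1
    rw [hind.measure_inter_preimage_eq_mul Finset.univ fun i _ => measurableSet_singleton 0]
    exact Finset.prod_ne_zero_iff.2 fun i _ => (sys.prob_no_arrival_pos i (hl i)).ne'
  have hS : sys.P (⋂ i ∈ Finset.univ, sys.S i 0 ⁻¹' {true}) ≠ 0 := by
    have hind : iIndepFun (fun i => sys.S i 0) sys.P :=
      sys.indep_S.precomp (g := fun i : Fin N => (i, 0)) fun i j h => (Prod.mk.inj h).1
    rw [hind.measure_inter_preimage_eq_mul Finset.univ fun i _ => measurableSet_singleton true]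
    refine Finset.prod_ne_zero_iff.2 fun i _ h0 => ?_
    have h1 := sys.prob_on i 0
    rw [measureReal_def] at h1
    have h2 := sys.pMin_le i
    have h3 : sys.P {ω | sys.S i 0 ω = true} = 0 := h0
    rw [h3] at h1
    simp at h1
    linarith
  have hset : {ω | (∀ i, sys.A i 0 ω = 0) ∧ ∀ i, sys.S i 0 ω = true} =
      (fun ω i => sys.A i 0 ω) ⁻¹' {0} ∩
      (fun ω => ((fun i => sys.S i 0 ω), sys.U 0 ω)) ⁻¹' ({fun _ => true} ×ˢ Set.univ) := by
    ext ω
    simp [funext_iff]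
  have hA' : (fun ω i => sys.A i 0 ω) ⁻¹' {0} = ⋂ i ∈ Finset.univ, sys.A i 0 ⁻¹' {0} := by
    ext ω
    simp [funext_iff]
  have hS' : (fun ω => ((fun i => sys.S i 0 ω), sys.U 0 ω)) ⁻¹' ({fun _ => true} ×ˢ Set.univ) =
      ⋂ i ∈ Finset.univ, sys.S i 0 ⁻¹' {true} := by
    ext ω
    simp [funext_iff]
  rw [measureReal_def, hset, (sys.indepFun_arrivals 0).measure_inter_preimage_eq_mul _ _
    (measurableSet_singleton _) ((measurableSet_singleton _).prod MeasurableSet.univ), hA', hS']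
  exact ENNReal.toReal_pos (mul_ne_zero hA hS)
    (ENNReal.mul_ne_top (measure_ne_top _ _) (measure_ne_top _ _))

variable {g : (Fin N → ℕ) → (Fin N → Bool) → ℝ → Fin N}

/-- Identifies the backlogs with the abstract chain; truncated subtraction of the link rate equals
subtraction of the packets actually served. -/
theorem chainPath_lcqStep
    (hsel : ∀ t ω, sys.sel t ω =
      some (g (fun i => sys.Q i t ω) (fun i => sys.S i t ω) (sys.U t ω))) (ω : Ω) (t : ℕ) :
    chainPath (lcqStep g) (fun i => sys.Q i 0 ω) (sys.noise · ω) t = fun i => sys.Q i t ω := by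
  induction t with
  | zero => rfl
  | succ t ih =>
    funext i
    rw [chainPath, ih, sys.dynamics, hsel]
    simp only [lcqStep, lcqServed, noise]
    omega

theorem integrable_quad_natCast {P : Measure Ω} [IsProbabilityMeasure P] {X : Ω → ℕ}
    (hX : MemLp (fun ω => (X ω : ℝ)) 2 P) (a : ℝ) : Integrable (fun ω => quad a (X ω)) P :=
  (hX.integrable_sq.div_const 2).add ((hX.integrable one_le_two).const_mul _)

theorem integrable_potential_init (θ : ℝ) :
    Integrable (fun ω => sys.potential θ fun i => sys.Q i 0 ω) sys.P := by
  have := sys.isProb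
  refine (integrable_finsetSum _ fun i _ => integrable_quad_natCast (sys.memLp_init i) _).add
    ((integrable_quad_natCast ?_ _).const_mul θ)
  simpa only [Nat.cast_sum] using memLp_finsetSum _ fun i _ => sys.memLp_init i

theorem potential_nonneg {θ : ℝ} (hθ : 0 ≤ θ) (hl : ∀ i, sys.lam i ≤ 1) (hl' : sys.lamTot ≤ 1)
    (q : Fin N → ℕ) : 0 ≤ sys.potential θ q :=
  add_nonneg (Finset.sum_nonneg fun i _ => quad_nonneg (hl i) _)
    (mul_nonneg hθ (quad_nonneg hl' _))

theorem measurable_lcqStep_noise (hg : IsMaxWeightRule g) (q : Fin N → ℕ) :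
    Measurable fun ω => lcqStep g q (sys.noise 0 ω) :=
  (measurable_lcqStep hg q).comp (sys.isDrivingNoise.measurable 0)

theorem integrable_pow_step (hg : IsMaxWeightRule g) (q : Fin N → ℕ) {η : ℝ} (h0 : 0 ≤ η)
    (h1 : η ≤ 1) :
    Integrable (fun ω => η ^ (∑ i, lcqStep g q (sys.noise 0 ω) i)) sys.P := by
  have := sys.isProb
  refine Integrable.of_bound (((measurable_of_countable fun x : Fin N → ℕ => η ^ (∑ i, x i)).comp
    (sys.measurable_lcqStep_noise hg q)).aestronglyMeasurable) 1 (Eventually.of_forall fun ω => ?_)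
  rw [Real.norm_of_nonneg (pow_nonneg h0 _)]
  exact pow_le_one₀ h0 h1

/-- The mean of `η ^ q_tot` grows off the empty state, as the total backlog decreases with positive
probability. -/
theorem integral_pow_step_ge (hg : IsMaxWeightRule g) {q : Fin N → ℕ} (hq : q ≠ 0) {η : ℝ}
    (h0 : 0 ≤ η) (h1 : η ≤ 1) :
    sys.P.real {ω | (∀ i, sys.A i 0 ω = 0) ∧ ∀ i, sys.S i 0 ω = true} * η ^ (∑ i, q i - 1) ≤
      ∫ ω, η ^ (∑ i, lcqStep g q (sys.noise 0 ω) i) ∂sys.P := by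
  have := sys.isProb
  set G := {ω | (∀ i, sys.A i 0 ω = 0) ∧ ∀ i, sys.S i 0 ω = true} with hG
  have hGm : MeasurableSet G := by
    have : G = (⋂ i, sys.A i 0 ⁻¹' {0}) ∩ ⋂ i, sys.S i 0 ⁻¹' {true} := by
      ext ω
      simp [hG]
    rw [this]
    exact (MeasurableSet.iInter fun i => sys.measurable_A i 0 (measurableSet_singleton _)).inter
      (MeasurableSet.iInter fun i => sys.measurable_S i 0 (measurableSet_singleton _))
  have h2 : ∫ ω, G.indicator (fun _ => η ^ (∑ i, q i - 1)) ω ∂sys.P =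
      sys.P.real G * η ^ (∑ i, q i - 1) := by
    rw [integral_indicator_const _ hGm, smul_eq_mul]
  rw [← h2]
  refine integral_mono ((integrable_const _).indicator hGm) (sys.integrable_pow_step hg q h0 h1)
    fun ω => ?_
  by_cases hω : ω ∈ G
  · obtain ⟨j, hj⟩ := Function.ne_iff.1 hq
    have hex : ∃ i ∈ levelSet q 0, (sys.noise 0 ω).2.1 i = true :=
      ⟨j, mem_levelSet.2 (Nat.pos_of_ne_zero hj), hω.2 j⟩
    have hA : ∑ i, (sys.noise 0 ω).1 i = 0 := Finset.sum_eq_zero fun i _ => hω.1 i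
    rw [Set.indicator_of_mem hω, sum_lcqStep, sum_lcqServed hg, if_pos hex, hA, add_zero]
  · rw [Set.indicator_of_notMem hω]
    exact pow_nonneg h0 _

/-- The quadratic potential has negative drift only for large backlogs, while the cycle argument
needs it at every state but `0`. The bounded correction `M * (1 - η ^ q_tot)` supplies it at small
backlogs, because from any nonempty state the backlog drops by one with probability at least `δ`. -/
theorem exists_hitting_lyapunov (hg : IsMaxWeightRule g) (hp : 0 < sys.pMin)
    (hl : ∀ i, sys.lam i < 1) (hl' : sys.lamTot ≤ 1) {ε : ℝ} (hε : 0 < ε)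
    (hdrift : ∀ q : Fin N → ℕ, ε * ∑ i, (q i : ℝ) ≤ ∑ i, (q i : ℝ) *
      (∫ ω, (lcqServed g q (sys.noise 0 ω).2.1 (sys.noise 0 ω).2.2 i : ℝ) ∂sys.P - sys.lam i)) :
    ∃ V : (Fin N → ℕ) → ℝ, (∀ q, 0 ≤ V q) ∧
      (∀ q, Integrable (fun ω => V (lcqStep g q (sys.noise 0 ω))) sys.P) ∧
      (∀ q, q ≠ 0 → 1 + ε / 2 * ∑ i, (q i : ℝ) + ∫ ω, V (lcqStep g q (sys.noise 0 ω)) ∂sys.P ≤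
        V q) ∧
      Integrable (fun ω => V fun i => sys.Q i 0 ω) sys.P := by
  have := sys.isProb
  set δ := sys.P.real {ω | (∀ i, sys.A i 0 ω = 0) ∧ ∀ i, sys.S i 0 ω = true} with hδ
  have hδ0 : 0 < δ := sys.prob_idle_pos hp hl
  have hδ1 : δ ≤ 1 := measureReal_le_one
  -- With this `η`, the mean of `η ^ q_tot` after a step is at least `δ * η ^ (q_tot - 1) = 2 * η ^
  -- q_tot`, so the correction falls by at least `M * η ^ q_tot`.
  set η := δ / 2 with hη
  have hη0 : 0 < η := by positivity
  have hη1 : η ≤ 1 := by rw [hη]; linarith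
  set B := sys.bConst 0 with hB
  -- Beyond total backlog `R`, half of the quadratic drift already exceeds `|B| + 1`; up to `R`, the
  -- constant `M` makes the correction do so.
  obtain ⟨R, hR⟩ := exists_nat_ge ((|B| + 1) / (ε / 2))
  rw [div_le_iff₀ (by positivity)] at hR
  set M := (|B| + 1) / η ^ R with hM
  have hM0 : 0 < M := by positivity
  refine ⟨fun q => sys.potential 0 q + M * (1 - η ^ (∑ i, q i)), fun q => ?_, fun q => ?_,
    fun q hq => ?_, ?_⟩
  · exact add_nonneg (sys.potential_nonneg le_rfl (fun i => (hl i).le) hl' q)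
      (mul_nonneg hM0.le (sub_nonneg.2 (pow_le_one₀ hη0.le hη1)))
  · exact (sys.integral_potential hg 0 q).1.add
      (((integrable_const 1).sub (sys.integrable_pow_step hg q hη0.le hη1)).const_mul M)
  · have hi1 := sys.integral_potential hg 0 q
    have hi2 := sys.integrable_pow_step hg q hη0.le hη1
    have hi3 : Integrable (fun ω => 1 - η ^ (∑ i, lcqStep g q (sys.noise 0 ω) i)) sys.P :=
      (integrable_const 1).sub hi2
    rw [integral_add hi1.1 (hi3.const_mul M), hi1.2, integral_const_mul,
      integral_sub (integrable_const 1) hi2]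
    simp only [integral_const, probReal_univ, smul_eq_mul, mul_one, zero_mul, add_zero]
    have h2 := sys.integral_pow_step_ge hg hq hη0.le hη1
    have hd := hdrift q
    have hpos : 0 < ∑ i, q i := by
      obtain ⟨j, hj⟩ := Function.ne_iff.1 hq
      exact (Nat.pos_of_ne_zero hj).trans_le (le_sum_coords q j)
    have hpow : δ * η ^ (∑ i, q i - 1) = 2 * η ^ (∑ i, q i) := by
      obtain ⟨n, hn⟩ := Nat.exists_eq_succ_of_ne_zero hpos.ne'
      rw [hn, Nat.succ_sub_one, pow_succ, hη]
      ring
    rw [hpow] at h2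
    have h3 := mul_le_mul_of_nonneg_left h2 hM0.le
    have hBabs := le_abs_self B
    have hcast : (∑ i, (q i : ℝ)) = ((∑ i, q i : ℕ) : ℝ) := by push_cast; rfl
    have key : |B| + 1 ≤ M * η ^ (∑ i, q i) + ε / 2 * ∑ i, (q i : ℝ) := by
      rcases le_total (∑ i, q i) R with hle | hle
      · have h4 : η ^ R ≤ η ^ (∑ i, q i) := pow_le_pow_of_le_one hη0.le hη1 hle
        have h5 : |B| + 1 = M * η ^ R := by
          rw [hM]
          field_simp
        have h6 := mul_le_mul_of_nonneg_left h4 hM0.le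
        have h7 : 0 ≤ ε / 2 * ∑ i, (q i : ℝ) :=
          mul_nonneg (by positivity) (Finset.sum_nonneg fun i _ => Nat.cast_nonneg _)
        linarith
      · have h4 : (R : ℝ) ≤ ∑ i, (q i : ℝ) := by
          rw [hcast]
          exact_mod_cast hle
        have h5 : (R : ℝ) * (ε / 2) ≤ (∑ i, (q i : ℝ)) * (ε / 2) := by gcongr
        have h6 : 0 ≤ M * η ^ (∑ i, q i) := by positivity
        linarith
    linarith
  · have hm : Measurable fun ω => η ^ (∑ i, sys.Q i 0 ω) :=
      (measurable_of_countable fun n : ℕ => η ^ n).comp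
        (Finset.measurable_sum _ fun i _ => sys.measurable_init i)
    have hint : Integrable (fun ω => η ^ (∑ i, sys.Q i 0 ω)) sys.P := by
      refine Integrable.of_bound hm.aestronglyMeasurable 1 (Eventually.of_forall fun ω => ?_)
      rw [Real.norm_of_nonneg (pow_nonneg hη0.le _)]
      exact pow_le_one₀ hη0.le hη1
    exact (sys.integrable_potential_init 0).add (((integrable_const 1).sub hint).const_mul M)

end OnOffSystem

/-! ### Existence of the averages and the explicit bounds. -/

namespace OnOffSystem

variable {N : ℕ} {Ω : Type*} [MeasurableSpace Ω] (sys : OnOffSystem N Ω)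
  {g : (Fin N → ℕ) → (Fin N → Bool) → ℝ → Fin N}

/-- The constant is the expected potential one step after the empty state, where service is zero,
and the potential is nonnegative. -/
theorem bConst_nonneg (hg : IsMaxWeightRule g) {θ : ℝ} (hθ : 0 ≤ θ) (hl : ∀ i, sys.lam i ≤ 1)
    (hl' : sys.lamTot ≤ 1) : 0 ≤ sys.bConst θ := by
  have h1 := (sys.integral_potential hg θ 0).2
  have h2 : 0 ≤ ∫ ω, sys.potential θ (lcqStep g 0 (sys.noise 0 ω)) ∂sys.P :=
    integral_nonneg fun ω => sys.potential_nonneg hθ hl hl' _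
  rw [h1] at h2
  simpa [potential, quad] using h2

theorem tendsto_arrivals :
    ∀ᵐ ω ∂sys.P, Tendsto (fun T : ℕ =>
      ((∑ i, ∑ s ∈ Finset.range T, sys.A i s ω : ℕ) : ℝ≥0∞) / T) atTop
      (𝓝 (ENNReal.ofReal sys.lamTot)) := by
  have hcast : Measurable fun n : ℕ => (n : ℝ≥0∞) := measurable_of_countable _
  have h : ∀ i, ∀ᵐ ω ∂sys.P, Tendsto (fun T : ℕ =>
      (∑ s ∈ Finset.range T, (sys.A i s ω : ℝ≥0∞)) / T) atTop
      (𝓝 (ENNReal.ofReal (sys.lam i))) := by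
    intro i
    rw [← sys.lintegral_A i 0]
    refine strong_law_ae_ennreal (fun s ω => (sys.A i s ω : ℝ≥0∞))
      (fun s => hcast.comp (sys.measurable_A i s)) (by rw [sys.lintegral_A]; simp) ?_
      fun s => (sys.identDistrib_A i s).comp hcast
    intro s t hst
    refine (sys.indep_A.indepFun (i := (i, s)) (j := (i, t)) ?_).comp hcast hcast
    simpa using hst
  filter_upwards [ae_all_iff.2 h] with ω hω
  have := tendsto_finsetSum Finset.univ fun i _ => hω i
  rw [← ENNReal.ofReal_sum_of_nonneg fun i _ => sys.lam_nonneg i] at this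
  refine this.congr fun T => ?_
  push_cast
  simp only [div_eq_mul_inv, Finset.sum_mul]

/-- Time averages under a max-weight rule: existence, the bounds given by drift conditions, and
Little's law. -/
theorem exists_timeAverages (hg : IsMaxWeightRule g)
    (hsel : ∀ t ω, sys.sel t ω =
      some (g (fun i => sys.Q i t ω) (fun i => sys.S i t ω) (sys.U t ω)))
    (hp : 0 < sys.pMin) (hl : ∀ i, sys.lam i < 1) (hl' : sys.lamTot ≤ 1) {ε₀ : ℝ} (hε₀ : 0 < ε₀)
    (hdrift : ∀ q : Fin N → ℕ, ε₀ * ∑ i, (q i : ℝ) ≤ ∑ i, (q i : ℝ) *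
      (∫ ω, (lcqServed g q (sys.noise 0 ω).2.1 (sys.noise 0 ω).2.2 i : ℝ) ∂sys.P - sys.lam i)) :
    ∃ Qbar : Fin N → ℝ≥0, (∀ i, sys.HasTimeAverage i (Qbar i)) ∧
      (∀ θ ε : ℝ, 0 ≤ θ → 0 ≤ ε → (∀ q : Fin N → ℕ, ε * ∑ i, (q i : ℝ) ≤
        ∑ i, (q i : ℝ) * (∫ ω, (lcqServed g q (sys.noise 0 ω).2.1 (sys.noise 0 ω).2.2 i : ℝ) ∂sys.P
          - sys.lam i) +
        θ * ((∑ i, (q i : ℝ)) *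
          (∑ i, ∫ ω, (lcqServed g q (sys.noise 0 ω).2.1 (sys.noise 0 ω).2.2 i : ℝ) ∂sys.P -
            ∑ i, sys.lam i))) → ε * ∑ i, (Qbar i : ℝ) ≤ sys.bConst θ) ∧
      (0 < sys.lamTot → sys.HasAverageDelay (Real.toNNReal ((∑ i, (Qbar i : ℝ)) / sys.lamTot))) := by
  have := sys.isProb
  obtain ⟨V, hV0, hVi, hVd, hVinit⟩ :=
    sys.exists_hitting_lyapunov hg hp hl hl' hε₀ hdrift
  have hpath := sys.chainPath_lcqStep hsel
  have hlint : ∀ (W : (Fin N → ℕ) → ℝ) q, (∀ q, 0 ≤ W q) →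
      Integrable (fun ω => W (lcqStep g q (sys.noise 0 ω))) sys.P →
      ∫⁻ ω, ENNReal.ofReal (W (lcqStep g q (sys.noise 0 ω))) ∂sys.P =
        ENNReal.ofReal (∫ ω, W (lcqStep g q (sys.noise 0 ω)) ∂sys.P) := fun W q h0 hi =>
    (ofReal_integral_eq_lintegral_ofReal hi (Eventually.of_forall fun ω => h0 _)).symm
  have hsum0 : ∀ q : Fin N → ℕ, 0 ≤ ∑ i, (q i : ℝ) := fun q =>
    Finset.sum_nonneg fun i _ => Nat.cast_nonneg _
  -- The weight `1 + ε₀ / 2 * q_tot` dominates the constant `1`, controlling cycle lengths, and up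
  -- to the factor `2 / ε₀` each single backlog.
  obtain ⟨⟨π, hπ0, hπ, hvisit⟩, havg⟩ := sys.isDrivingNoise.exists_timeAverage
    (w := fun q => ENNReal.ofReal (1 + ε₀ / 2 * ∑ i, (q i : ℝ)))
    (V := fun q => ENNReal.ofReal (V q)) (z := 0)
    (measurable_lcqStep hg) sys.measurable_init_history
    (fun q => by
      rw [← ENNReal.ofReal_one]
      exact ENNReal.ofReal_le_ofReal
        (le_add_of_nonneg_right (mul_nonneg (by positivity) (hsum0 q))))
    ENNReal.ofReal_ne_top (fun q => ENNReal.ofReal_ne_top)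
    (fun q hq => by
      have h1 : 0 ≤ ∫ ω, V (lcqStep g q (sys.noise 0 ω)) ∂sys.P :=
        integral_nonneg fun ω => hV0 _
      rw [hlint V q hV0 (hVi q), ← ENNReal.ofReal_add
        (add_nonneg zero_le_one (mul_nonneg (by positivity) (hsum0 q))) h1]
      exact ENNReal.ofReal_le_ofReal (hVd q hq))
    (by
      rw [hlint V 0 hV0 (hVi 0)]
      exact ENNReal.ofReal_ne_top)
    (by
      rw [← ofReal_integral_eq_lintegral_ofReal hVinit (Eventually.of_forall fun ω => hV0 _)]
      exact ENNReal.ofReal_ne_top)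
  have hex : ∀ i, ∃ m : ℝ≥0, sys.HasTimeAverage i m := by
    intro i
    obtain ⟨m, hm1, hm2⟩ := havg (fun q => (q i : ℝ≥0∞)) (ENNReal.ofReal (2 / ε₀))
      ENNReal.ofReal_ne_top (fun q => by
        rw [← ENNReal.ofReal_mul (by positivity), ← ENNReal.ofReal_natCast]
        refine ENNReal.ofReal_le_ofReal ?_
        have h1 : (q i : ℝ) ≤ ∑ i, (q i : ℝ) := by exact_mod_cast le_sum_coords q i
        have h2 : 2 / ε₀ * (1 + ε₀ / 2 * ∑ i, (q i : ℝ)) = 2 / ε₀ + ∑ i, (q i : ℝ) := by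
          field_simp
        rw [h2]
        have : 0 ≤ 2 / ε₀ := by positivity
        linarith)
    simp only [hpath] at hm1 hm2
    exact ⟨m, hm1, hm2⟩
  choose Qbar hQbar using hex
  refine ⟨Qbar, hQbar, fun θ ε hθ hε hdr => ?_, fun hpos => ?_⟩
  · have hli : ∀ i, sys.lam i ≤ 1 := fun i => (hl i).le
    have hB := sys.bConst_nonneg hg hθ hli hl'
    have hpot0 := sys.potential_nonneg hθ hli hl'
    have hlim : Tendsto (slotAverage fun t => ∫⁻ ω, ENNReal.ofReal ε *
        ∑ i, (chainPath (lcqStep g) (fun i => sys.Q i 0 ω) (sys.noise · ω) t i : ℝ≥0∞) ∂sys.P)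
        atTop (𝓝 (ENNReal.ofReal ε * ∑ i, (Qbar i : ℝ≥0∞))) := by
      have h1 := ENNReal.Tendsto.const_mul (a := ENNReal.ofReal ε)
        (tendsto_finsetSum Finset.univ fun i _ => (hQbar i).1) (Or.inr ENNReal.ofReal_ne_top)
      refine h1.congr fun T => ?_
      simp only [hpath, slotAverage, div_eq_mul_inv]
      rw [← Finset.sum_mul, Finset.sum_comm, ← mul_assoc, Finset.mul_sum]
      congr 1
      refine Finset.sum_congr rfl fun t _ => ?_
      rw [lintegral_const_mul _ (Finset.measurable_sum _ fun i _ => sys.measurable_natCast_Q i t),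
        lintegral_finsetSum _ fun i _ => sys.measurable_natCast_Q i t]
    have hle := sys.isDrivingNoise.timeAverage_le (F := lcqStep g)
      (w := fun q => ENNReal.ofReal ε * ∑ i, (q i : ℝ≥0∞))
      (V := fun q => ENNReal.ofReal (sys.potential θ q)) (b := ENNReal.ofReal (sys.bConst θ))
      (measurable_lcqStep hg) sys.measurable_init_history
      (fun q => by
        have hi := sys.integral_potential hg θ q
        have hcast : ENNReal.ofReal ε * ∑ i, (q i : ℝ≥0∞) =
            ENNReal.ofReal (ε * ∑ i, (q i : ℝ)) := by
          rw [ENNReal.ofReal_mul hε, ENNReal.ofReal_sum_of_nonneg fun _ _ => Nat.cast_nonneg _]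
          simp
        have h1 : 0 ≤ ∫ ω, sys.potential θ (lcqStep g q (sys.noise 0 ω)) ∂sys.P :=
          integral_nonneg fun ω => hpot0 _
        rw [hlint _ q hpot0 hi.1, hcast, ← ENNReal.ofReal_add (mul_nonneg hε (hsum0 q)) h1,
          ← ENNReal.ofReal_add (hpot0 q) hB]
        refine ENNReal.ofReal_le_ofReal ?_
        rw [hi.2]
        linarith [hdr q])
      (by
        rw [← ofReal_integral_eq_lintegral_ofReal (sys.integrable_potential_init θ)
          (Eventually.of_forall fun ω => hpot0 _)]
        exact ENNReal.ofReal_ne_top) hlim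
    have hcast : ENNReal.ofReal ε * ∑ i, (Qbar i : ℝ≥0∞) =
        ENNReal.ofReal (ε * ∑ i, (Qbar i : ℝ)) := by
      rw [ENNReal.ofReal_mul hε, ENNReal.ofReal_sum_of_nonneg fun _ _ => NNReal.coe_nonneg _]
      simp
    rw [hcast] at hle
    exact (ENNReal.ofReal_le_ofReal_iff hB).1 hle
  · have hval : ((Real.toNNReal ((∑ i, (Qbar i : ℝ)) / sys.lamTot) : ℝ≥0) : ℝ≥0∞) =
        (∑ i, (Qbar i : ℝ≥0∞)) / ENNReal.ofReal sys.lamTot := by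
      change ENNReal.ofReal _ = _
      rw [ENNReal.ofReal_div_of_pos hpos,
        ENNReal.ofReal_sum_of_nonneg fun _ _ => NNReal.coe_nonneg _]
      simp
    unfold HasAverageDelay
    rw [hval]
    filter_upwards [hvisit, sys.tendsto_arrivals, ae_all_iff.2 fun i => (hQbar i).2]
      with ω h1 h2 h3
    simp only [hpath] at h1
    exact sys.tendsto_averageDelay hπ0 hπ (by simpa using hpos) ENNReal.ofReal_ne_top h1.1 h1.2 h3 h2

theorem HasTimeAverage.stronglyStable {sys : OnOffSystem N Ω} {i : Fin N} {m : ℝ≥0}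
    (h : sys.HasTimeAverage i m) : sys.StronglyStable i := by
  unfold StronglyStable
  rw [h.1.limsup_eq]
  exact ENNReal.coe_lt_top

theorem onProb_le_one (M : Finset (Fin N)) : onProb sys.p M ≤ 1 := by
  have := sys.isProb
  rw [← sys.prob_exists_on M 0]
  exact measureReal_le_one

theorem lamTot_nonneg : 0 ≤ sys.lamTot := Finset.sum_nonneg fun i _ => sys.lam_nonneg i

/-- The delay bound for the max-weight policy. -/
theorem lcq_bounds (hlcq : sys.IsLCQ) (hp : 0 < sys.pMin) (hp1 : sys.pMin < 1) {ρ : ℝ}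
    (hρ : 0 < ρ) (hρ1 : ρ < 1) (hl : sys.lam ∈ ρ • capacityRegion sys.p) {K : ℕ} (hK : 1 ≤ K)
    (hKl : sys.lamTot < rK sys.pMin (K + 1)) :
    (∀ i, sys.StronglyStable i) ∧
    (∃ Qbar : Fin N → ℝ≥0, (∀ i, sys.HasTimeAverage i (Qbar i)) ∧
      ∑ i, (Qbar i : ℝ) ≤ sys.backlogBound ρ K) ∧
    (0 < sys.lamTot → ∃ Wbar : ℝ≥0, sys.HasAverageDelay Wbar ∧
      (Wbar : ℝ) ≤ sys.delayBound ρ K) := by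
  obtain ⟨g, hgm, hgmax, hsel⟩ := hlcq
  have hg : IsMaxWeightRule g := ⟨hgm, hgmax⟩
  have hN : 1 ≤ N := sys.pos_of_pMin_pos hp
  have hcap := sum_le_of_mem_smul_capacityRegion hρ.le hl
  have hon : ∀ M : Finset (Fin N), ∑ i ∈ M, sys.lam i ≤ ρ := fun M =>
    (hcap M).trans (mul_le_of_le_one_right hρ.le (sys.onProb_le_one M))
  have hlam : ∀ i, sys.lam i < 1 := fun i => by
    have := hon {i}
    simp only [Finset.sum_singleton] at this
    linarith
  have hlamTot : sys.lamTot ≤ 1 := (hon Finset.univ).trans hρ1.le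
  have hmuN := muSym_pos hp hp1 hN
  have h1ρ : 0 < 1 - ρ := by linarith
  set ε₀ := (1 - ρ) * muSym sys.pMin N with hε₀
  have hε₀pos : 0 < ε₀ := mul_pos h1ρ hmuN
  have hdrift : ∀ q : Fin N → ℕ, ε₀ * ∑ i, (q i : ℝ) ≤ ∑ i, (q i : ℝ) *
      (∫ ω, (lcqServed g q (sys.noise 0 ω).2.1 (sys.noise 0 ω).2.2 i : ℝ) ∂sys.P - sys.lam i) :=
    fun q => weighted_drift_ge hp hp1 sys.pMin_le sys.p_le_one hρ1 hcap
      (sys.sum_mul_integral_served hg q)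
      ((Finset.card_le_univ (levelSet q 0)).trans (Fintype.card_fin N).le)
  obtain ⟨Qbar, hQ, hbound, hdelay⟩ :=
    sys.exists_timeAverages hg hsel hp hlam hlamTot hε₀pos hdrift
  have hB0 := sys.bConst_nonneg hg le_rfl (fun i => (hlam i).le) hlamTot
  have hrN := rK_pos hp hp1 hN
  have hN' : (0 : ℝ) < N := by exact_mod_cast hN
  have hK' : (0 : ℝ) < K := by exact_mod_cast hK
  -- The case `θ = 0` with `n = N`.
  have hsecond : ∑ i, (Qbar i : ℝ) ≤ N * sys.bConst 0 / (rK sys.pMin N * (1 - ρ)) := by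
    have h1 := hbound 0 ε₀ le_rfl hε₀pos.le fun q => by
      rw [zero_mul, add_zero]
      exact hdrift q
    rw [le_div_iff₀ (mul_pos hrN h1ρ)]
    rw [hε₀, muSym_eq] at h1
    have h2 : (∑ i, (Qbar i : ℝ)) * (rK sys.pMin N * (1 - ρ)) =
        N * ((1 - ρ) * (rK sys.pMin N / N) * ∑ i, (Qbar i : ℝ)) := by
      field_simp
    rw [h2]
    exact mul_le_mul_of_nonneg_left h1 hN'.le
  have hfirst : ∑ i, (Qbar i : ℝ) ≤ sys.backlogBound ρ K := by
    unfold backlogBound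
    rcases Nat.lt_or_ge K N with hKN | hKN
    · have hr := rK_pos hp hp1 (k := K + 1) (by omega)
      have hθ : 0 ≤ thetaConst ρ sys.pMin N K := by
        rw [thetaConst, if_pos hKN]
        exact div_nonneg (mul_nonneg h1ρ.le (sub_nonneg.2 (muSym_anti hp hp1 hK hKN.le))) hr.le
      set D := muSym sys.pMin N * sys.lamTot +
        muSym sys.pMin K * (rK sys.pMin (K + 1) - sys.lamTot) with hD
      have hDpos : 0 < D := add_pos_of_nonneg_of_pos (mul_nonneg hmuN.le sys.lamTot_nonneg)
        (mul_pos (muSym_pos hp hp1 hK) (by linarith))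
      have hεpos : 0 < (1 - ρ) / rK sys.pMin (K + 1) * D := mul_pos (div_pos h1ρ hr) hDpos
      have h1 := hbound (thetaConst ρ sys.pMin N K) ((1 - ρ) / rK sys.pMin (K + 1) * D) hθ
        hεpos.le fun q => weighted_drift_ge_of_card_lt hp hp1 sys.pMin_le sys.p_le_one hρ1 hcap
          (sys.sum_mul_integral_served hg q) (sys.sum_integral_served hg q) hK hKN
      have h2 : K * sys.bConst (thetaConst ρ sys.pMin N K) *
          cConst ρ sys.pMin sys.lamTot N K / (1 - ρ) ^ 2 =
          sys.bConst (thetaConst ρ sys.pMin N K) / ((1 - ρ) / rK sys.pMin (K + 1) * D) := by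
        -- Shows that `C` is the balanced drift coefficient in disguise: `K C / (1 - ρ) ^ 2` is its
        -- reciprocal.
        have hden : rK sys.pMin N * K * sys.lamTot / (N * (1 - ρ)) +
            rK sys.pMin K * (rK sys.pMin (K + 1) - sys.lamTot) / (1 - ρ) = K * D / (1 - ρ) := by
          rw [hD, muSym_eq, muSym_eq]
          field_simp
        rw [cConst, if_pos hKN, hden]
        field_simp
      rw [h2, le_div_iff₀ hεpos, mul_comm]
      exact h1
    · rw [thetaConst, if_neg (not_lt.2 hKN), cConst, if_neg (not_lt.2 hKN)]
      -- For `K ≥ N` the claim is weaker than the `N`-dependent bound, as `N ≤ K` and `(1 - ρ) ^ 2 ≤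
      -- 1 - ρ`.
      refine hsecond.trans ?_
      rw [div_le_div_iff₀ (mul_pos hrN h1ρ) (by positivity)]
      have h2 : (N : ℝ) ≤ K := by exact_mod_cast hKN
      have h3 : (1 - ρ) ^ 2 ≤ 1 - ρ := by nlinarith
      calc N * sys.bConst 0 * (1 - ρ) ^ 2 ≤ K * sys.bConst 0 * (1 - ρ) := by gcongr
        _ = _ := by field_simp
  refine ⟨fun i => (hQ i).stronglyStable, ⟨Qbar, hQ, hfirst⟩, fun hpos => ⟨_, hdelay hpos, ?_⟩⟩
  rw [Real.coe_toNNReal _ (div_nonneg (Finset.sum_nonneg fun i _ => NNReal.coe_nonneg _) hpos.le)]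
  refine le_min ?_ ?_
  · have h1 := div_le_div_of_nonneg_right hfirst hpos.le
    rw [backlogBound, div_div, mul_comm (_ ^ 2)] at h1
    exact h1
  · have h1 := div_le_div_of_nonneg_right hsecond hpos.le
    rw [div_div, mul_comm _ sys.lamTot, ← mul_assoc] at h1
    exact h1

/-! ### Orders of magnitude for the logarithmic choice of `K`. -/

/-- Variances add over the independent queues, and the subtracted squares of the individual means
are dropped. This lets part (2) assume only a bound on the sum of the second moments. -/
theorem secondMomentTot_le :
    sys.secondMomentTot ≤ ∑ i, sys.secondMoment i + sys.lamTot ^ 2 := by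
  have := sys.isProb
  have hind : ∀ i j, i ≠ j → IndepFun (fun ω => (sys.A i 0 ω : ℝ)) (fun ω => (sys.A j 0 ω : ℝ))
      sys.P := fun i j hij =>
    (sys.indep_A.indepFun (i := (i, 0)) (j := (j, 0)) (by simpa using hij)).comp
      (measurable_of_countable (fun n : ℕ => (n : ℝ)))
      (measurable_of_countable (fun n : ℕ => (n : ℝ)))
  have h1 := IndepFun.variance_sum (s := Finset.univ) (X := fun i ω => (sys.A i 0 ω : ℝ))
    (fun i _ => sys.memLp_A i 0) (fun i _ j _ hij => hind i j hij)
  have h2 : MemLp (∑ i, fun ω => (sys.A i 0 ω : ℝ)) 2 sys.P :=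
    memLp_finsetSum' _ fun i _ => sys.memLp_A i 0
  rw [variance_eq_sub h2, Finset.sum_congr rfl fun i _ => variance_eq_sub (sys.memLp_A i 0)] at h1
  have h3 : ∫ ω, (∑ i, fun ω => (sys.A i 0 ω : ℝ)) ω ∂sys.P = sys.lamTot := by
    simp only [Finset.sum_apply]
    rw [integral_finsetSum _ fun i _ => sys.integrable_A i 0]
    rfl
  have h4 : ∫ ω, ((∑ i, fun ω => (sys.A i 0 ω : ℝ)) ^ 2) ω ∂sys.P = sys.secondMomentTot := by
    simp only [Pi.pow_apply, Finset.sum_apply]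
    rfl
  have h5 : ∀ i, ∫ ω, ((fun ω => (sys.A i 0 ω : ℝ)) ^ 2) ω ∂sys.P = sys.secondMoment i :=
    fun i => rfl
  rw [h3, h4] at h1
  simp only [h5, Finset.sum_sub_distrib] at h1
  have h6 : 0 ≤ ∑ i, (∫ ω, (sys.A i 0 ω : ℝ) ∂sys.P) ^ 2 :=
    Finset.sum_nonneg fun i _ => sq_nonneg _
  linarith

theorem bConst_le {b θ : ℝ} (hθ : 0 ≤ θ) (hθ1 : θ ≤ 1) (hb : 0 ≤ b)
    (hsec : ∑ i, sys.secondMoment i ≤ b * sys.lamTot) :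
    sys.bConst θ ≤ (1 + b) * sys.lamTot := by
  have h1 := sys.secondMomentTot_le
  have h2 : 0 ≤ ∑ i, sys.lam i ^ 2 := Finset.sum_nonneg fun i _ => sq_nonneg _
  have h3 : sys.secondMomentTot + sys.lamTot - 2 * sys.lamTot ^ 2 ≤ (1 + b) * sys.lamTot := by
    nlinarith [sq_nonneg sys.lamTot]
  have h4 : 0 ≤ (1 + b) * sys.lamTot := mul_nonneg (by linarith) sys.lamTot_nonneg
  have h5 : θ / 2 * (sys.secondMomentTot + sys.lamTot - 2 * sys.lamTot ^ 2) ≤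
      1 / 2 * ((1 + b) * sys.lamTot) :=
    (mul_le_mul_of_nonneg_left h3 (by linarith)).trans
      (mul_le_mul_of_nonneg_right (by linarith) h4)
  unfold bConst
  linarith

end OnOffSystem

section LogK

variable {pm ρ : ℝ} (h0 : 0 < pm) (h1 : pm < 1) (hρ1 : ρ < 1)
include h0 h1 hρ1

/-- `K + 1` is at least the logarithm of `2 / (1 - ρ)` to the base `1 / (1 - pm)`, so `(1 - pm) ^ (K
+ 1) ≤ (1 - ρ) / 2`. The `2` leaves half of the gap `1 - ρ` between `ρ` and `r_{K+1}`. -/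
theorem one_add_div_two_le_rK_logK : (1 + ρ) / 2 ≤ rK pm (logK ρ pm + 1) := by
  have ha : 0 < Real.log (1 / (1 - pm)) :=
    Real.log_pos (by rw [lt_div_iff₀ (by linarith)]; linarith)
  set x := Real.log (2 / (1 - ρ)) / Real.log (1 / (1 - pm)) with hx
  have hK : x ≤ (logK ρ pm + 1 : ℕ) := by
    refine (Nat.le_ceil x).trans ?_
    have := le_max_right 1 (⌈x⌉₊ - 1)
    have h2 : ⌈x⌉₊ - 1 ≤ logK ρ pm := this
    exact_mod_cast (by omega : ⌈x⌉₊ ≤ logK ρ pm + 1)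
  rw [hx, div_le_iff₀ ha, ← Real.log_pow] at hK
  have h2 : 2 / (1 - ρ) ≤ (1 / (1 - pm)) ^ (logK ρ pm + 1) := by
    refine (Real.log_le_log_iff ?_ ?_).1 hK
    · exact div_pos two_pos (by linarith)
    · exact pow_pos (div_pos one_pos (by linarith)) _
  have hpow : 0 < (1 - pm) ^ (logK ρ pm + 1) := pow_pos (by linarith) _
  rw [one_div, inv_pow, ← one_div, div_le_div_iff₀ (by linarith) hpow] at h2
  unfold rK
  linarith

/-- Since `ρ ≥ ρ₀`, the logarithm of `1 / (1 - ρ)` is bounded below by a positive constant, and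
additive constants are absorbed into multiples of it. -/
theorem logK_le {ρ₀ : ℝ} (hρ₀0 : 0 < ρ₀) (hρ₀ : ρ₀ ≤ ρ) :
    (logK ρ pm : ℝ) ≤ (1 / Real.log (1 / (1 - ρ₀)) +
      (1 + Real.log 2 / Real.log (1 / (1 - ρ₀))) / Real.log (1 / (1 - pm))) *
        Real.log (1 / (1 - ρ)) := by
  have ha : 0 < Real.log (1 / (1 - pm)) :=
    Real.log_pos (by rw [lt_div_iff₀ (by linarith)]; linarith)
  have hL0 : 0 < Real.log (1 / (1 - ρ₀)) :=
    Real.log_pos (by rw [lt_div_iff₀ (by linarith)]; linarith)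
  have hL : Real.log (1 / (1 - ρ₀)) ≤ Real.log (1 / (1 - ρ)) := by
    refine Real.log_le_log (div_pos one_pos (by linarith)) ?_
    exact one_div_le_one_div_of_le (by linarith) (by linarith)
  have hsplit : Real.log (2 / (1 - ρ)) = Real.log 2 + Real.log (1 / (1 - ρ)) := by
    rw [← Real.log_mul two_ne_zero (div_pos one_pos (by linarith)).ne']
    congr 1
    ring
  set a := Real.log (1 / (1 - pm))
  set L0 := Real.log (1 / (1 - ρ₀))
  set L := Real.log (1 / (1 - ρ))
  have hlog2 : 0 < Real.log 2 := Real.log_pos one_lt_two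
  have h2 : (logK ρ pm : ℝ) ≤ 1 + (Real.log 2 + L) / a := by
    rw [← hsplit]
    have hx : 0 ≤ Real.log (2 / (1 - ρ)) / a := by
      rw [hsplit]
      exact div_nonneg (by linarith) ha.le
    unfold logK
    rw [Nat.cast_max]
    refine max_le (by simpa using hx) ?_
    have h3 := Nat.ceil_lt_add_one hx
    have h4 : ((⌈Real.log (2 / (1 - ρ)) / a⌉₊ - 1 : ℕ) : ℝ) ≤
        (⌈Real.log (2 / (1 - ρ)) / a⌉₊ : ℝ) := by exact_mod_cast Nat.sub_le _ _
    linarith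
  have h3 : 1 ≤ L / L0 := (one_le_div hL0).2 hL
  have h4 : Real.log 2 ≤ Real.log 2 / L0 * L := by
    rw [div_mul_eq_mul_div, mul_div_assoc]
    exact le_mul_of_one_le_right hlog2.le h3
  calc (logK ρ pm : ℝ) ≤ 1 + (Real.log 2 + L) / a := h2
    _ ≤ L / L0 + (Real.log 2 / L0 * L + L) / a := by gcongr
    _ = _ := by ring

end LogK

theorem thetaConst_mem {pm ρ : ℝ} (h0 : 0 < pm) (h1 : pm < 1) (hρ0 : 0 < ρ) (hρ1 : ρ < 1)
    (N : ℕ) {K : ℕ} (hK : 1 ≤ K) : 0 ≤ thetaConst ρ pm N K ∧ thetaConst ρ pm N K ≤ 1 := by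
  unfold thetaConst
  split_ifs with hKN
  · have hr := rK_pos h0 h1 (k := K + 1) (by omega)
    have hanti := muSym_anti h0 h1 hK hKN.le
    refine ⟨div_nonneg (mul_nonneg (by linarith) (by linarith)) hr.le, ?_⟩
    rw [div_le_one hr]
    have h2 : muSym pm K ≤ rK pm K := by
      rw [muSym_eq]
      exact div_le_self (rK_nonneg h0 h1 K) (by exact_mod_cast hK)
    have h3 : rK pm K ≤ rK pm (K + 1) := rK_mono h0 h1 (Nat.le_succ K)
    have h4 := muSym_nonneg h0 h1 N
    calc (1 - ρ) * (muSym pm K - muSym pm N) ≤ 1 * (muSym pm K - muSym pm N) :=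
          mul_le_mul_of_nonneg_right (by linarith) (by linarith)
      _ ≤ _ := by linarith
  · exact ⟨le_rfl, zero_le_one⟩

/-- In the denominator of `C`, the second term alone is at least `pm / 2`: the factor `r_{K+1} - l ≥
(1 - ρ) / 2` cancels the division by `1 - ρ`. -/
theorem cConst_mem {pm ρ l : ℝ} (h0 : 0 < pm) (h1 : pm < 1) (hρ1 : ρ < 1)
    (hl0 : 0 ≤ l) (hl : l ≤ ρ) {N K : ℕ} (hN : 1 ≤ N) (hK : 1 ≤ K)
    (hr : (1 + ρ) / 2 ≤ rK pm (K + 1)) : 0 ≤ cConst ρ pm l N K ∧ cConst ρ pm l N K ≤ 2 / pm := by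
  unfold cConst
  split_ifs with hKN
  · have h1ρ : 0 < 1 - ρ := by linarith
    have h2 : 0 ≤ rK pm N * K * l / (N * (1 - ρ)) :=
      div_nonneg (mul_nonneg (mul_nonneg (rK_nonneg h0 h1 N) (Nat.cast_nonneg K)) hl0)
        (mul_nonneg (Nat.cast_nonneg N) h1ρ.le)
    have h3 : pm / 2 ≤ rK pm K * (rK pm (K + 1) - l) / (1 - ρ) := by
      rw [le_div_iff₀ h1ρ]
      calc pm / 2 * (1 - ρ) = pm * ((1 - ρ) / 2) := by ring
        _ ≤ rK pm K * (rK pm (K + 1) - l) :=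
          mul_le_mul (le_rK h0 h1 hK) (by linarith) (by linarith) (rK_nonneg h0 h1 K)
    refine ⟨div_nonneg (rK_nonneg h0 h1 _) (by linarith), ?_⟩
    rw [div_le_div_iff₀ (by linarith) h0]
    have h4 := rK_le_one h1 (K + 1)
    calc rK pm (K + 1) * pm ≤ 1 * pm := by gcongr
      _ = 2 * (pm / 2) := by ring
      _ ≤ _ := by linarith
  · have h2 := le_rK h0 h1 hN
    refine ⟨div_nonneg zero_le_one (rK_nonneg h0 h1 N), ?_⟩
    rw [div_le_div_iff₀ (by linarith) h0]
    linarith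

namespace OnOffSystem

/-- The delay bound is of order `min (log (1 / (1 - ρ)) / (1 - ρ) ^ 2) (N / (1 - ρ))`. -/
theorem delayBound_le {N : ℕ} {Ω : Type*} [MeasurableSpace Ω] (sys : OnOffSystem N Ω)
    (hp : 0 < sys.pMin) (hp1 : sys.pMin < 1) {ρ b c L : ℝ} (hρ0 : 0 < ρ) (hρ1 : ρ < 1)
    (hb : 0 ≤ b) (hl0 : 0 < sys.lamTot) (hl : sys.lamTot ≤ ρ)
    (hsec : ∑ i, sys.secondMoment i ≤ b * sys.lamTot) {K : ℕ} (hK : 1 ≤ K)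
    (hr : (1 + ρ) / 2 ≤ rK sys.pMin (K + 1)) (hKc : (K : ℝ) ≤ c * L) :
    sys.delayBound ρ K ≤ min (c * (1 + b) * (2 / sys.pMin) * L / (1 - ρ) ^ 2)
      ((1 + b) / sys.pMin * N / (1 - ρ)) := by
  have hN : 1 ≤ N := sys.pos_of_pMin_pos hp
  have h1ρ : 0 < 1 - ρ := by linarith
  obtain ⟨hθ0, hθ1⟩ := thetaConst_mem hp hp1 hρ0 hρ1 N hK
  obtain ⟨hC0, hC1⟩ := cConst_mem hp hp1 hρ1 hl0.le hl hN hK hr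
  have hB := sys.bConst_le hθ0 hθ1 hb hsec
  have hB0 := sys.bConst_le le_rfl zero_le_one hb hsec
  refine min_le_min ?_ ?_
  · rw [div_le_div_iff₀ (by positivity) (by positivity)]
    have h2 : K * sys.bConst (thetaConst ρ sys.pMin N K) * cConst ρ sys.pMin sys.lamTot N K ≤
        c * L * ((1 + b) * sys.lamTot) * (2 / sys.pMin) := by
      have h3 : 0 ≤ (1 + b) * sys.lamTot := by positivity
      calc _ ≤ K * ((1 + b) * sys.lamTot) * cConst ρ sys.pMin sys.lamTot N K := by gcongr
        _ ≤ _ := by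
          have h4 : 0 ≤ c * L := (Nat.cast_nonneg K).trans hKc
          gcongr
    calc _ ≤ c * L * ((1 + b) * sys.lamTot) * (2 / sys.pMin) * (1 - ρ) ^ 2 := by gcongr
      _ = _ := by ring
  · have hrN := le_rK hp hp1 hN
    have hrN0 := rK_pos hp hp1 hN
    calc N * sys.bConst 0 / (sys.lamTot * rK sys.pMin N * (1 - ρ))
        ≤ N * ((1 + b) * sys.lamTot) / (sys.lamTot * rK sys.pMin N * (1 - ρ)) := by gcongr
      _ = (1 + b) * N / (rK sys.pMin N * (1 - ρ)) := by field_simp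
      _ ≤ (1 + b) * N / (sys.pMin * (1 - ρ)) := by gcongr
      _ = _ := by field_simp

end OnOffSystem

/-! ### The delay bound for LCQ. -/

theorem mainTheorem1 :
    -- Stability, the backlog bound and the delay bound for every admissible `K`.
    (∀ (N : ℕ) (Ω : Type*) [MeasurableSpace Ω] (sys : OnOffSystem N Ω), sys.IsLCQ →
      0 < sys.pMin → sys.pMin < 1 →
      ∀ ρ : ℝ, 0 < ρ → ρ < 1 → sys.lam ∈ ρ • capacityRegion sys.p →
      ∀ K : ℕ, 1 ≤ K → 1 - (1 - sys.pMin) ^ (K + 1) > sys.lamTot →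
        (∀ i, sys.StronglyStable i) ∧
        (∃ Qbar : Fin N → ℝ≥0, (∀ i, sys.HasTimeAverage i (Qbar i)) ∧
          ∑ i, (Qbar i : ℝ) ≤ sys.backlogBound ρ K) ∧
        (0 < sys.lamTot → ∃ Wbar : ℝ≥0, sys.HasAverageDelay Wbar ∧
          (Wbar : ℝ) ≤ sys.delayBound ρ K)) ∧
    -- With `K` of order `log (1 / (1 - ρ))`, the delay bound is
    -- `O(log (1 / (1 - ρ)) / (1 - ρ) ^ 2)` and `O(N / (1 - ρ))`, with constants that
    -- do not depend on `N` or `ρ`.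
    (∀ pmin β ρ₀ : ℝ, 0 < pmin → pmin < 1 → 0 < ρ₀ → ρ₀ < 1 →
      ∃ c₀ c₁ c₂ : ℝ, 0 < c₀ ∧ 0 < c₁ ∧ 0 < c₂ ∧
      ∀ (N : ℕ) (Ω : Type*) [MeasurableSpace Ω] (sys : OnOffSystem N Ω), sys.IsLCQ →
        sys.pMin = pmin → 0 < sys.lamTot → ∑ i, sys.secondMoment i ≤ β * sys.lamTot →
        ∀ ρ : ℝ, ρ₀ ≤ ρ → ρ < 1 → sys.lam ∈ ρ • capacityRegion sys.p →
          1 - (1 - pmin) ^ (logK ρ pmin + 1) > sys.lamTot ∧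
          (logK ρ pmin : ℝ) ≤ c₀ * Real.log (1 / (1 - ρ)) ∧
          ∃ Wbar : ℝ≥0, sys.HasAverageDelay Wbar ∧
            (Wbar : ℝ) ≤ sys.delayBound ρ (logK ρ pmin) ∧
            sys.delayBound ρ (logK ρ pmin) ≤
              min (c₁ * Real.log (1 / (1 - ρ)) / (1 - ρ) ^ 2) (c₂ * N / (1 - ρ))) := by
  refine ⟨fun N Ω _ sys hlcq hp hp1 ρ hρ hρ1 hl K hK hKl =>
    sys.lcq_bounds hlcq hp hp1 hρ hρ1 hl hK hKl, fun pmin β ρ₀ hp hp1 hρ₀ hρ₀1 => ?_⟩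
  have ha : 0 < Real.log (1 / (1 - pmin)) :=
    Real.log_pos (by rw [lt_div_iff₀ (by linarith)]; linarith)
  have hL0 : 0 < Real.log (1 / (1 - ρ₀)) :=
    Real.log_pos (by rw [lt_div_iff₀ (by linarith)]; linarith)
  have hlog2 : 0 < Real.log 2 := Real.log_pos one_lt_two
  set c₀ := 1 / Real.log (1 / (1 - ρ₀)) +
    (1 + Real.log 2 / Real.log (1 / (1 - ρ₀))) / Real.log (1 / (1 - pmin)) with hc₀
  have hc₀pos : 0 < c₀ := by positivity
  -- The absolute value of `β` keeps the constants positive for every real `β`; it only weakens the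
  -- moment hypothesis.
  refine ⟨c₀, c₀ * (1 + |β|) * (2 / pmin), (1 + |β|) / pmin, hc₀pos, by positivity,
    by positivity, ?_⟩
  intro N Ω _ sys hlcq hpm hlpos hsec ρ hρ hρ1 hl
  subst hpm
  have hρ0 : 0 < ρ := hρ₀.trans_le hρ
  have hK : 1 ≤ logK ρ sys.pMin := le_max_left _ _
  have hr := one_add_div_two_le_rK_logK hp hp1 hρ1
  have hKc := logK_le hp hp1 hρ1 hρ₀ hρ
  have hlρ : sys.lamTot ≤ ρ := (sum_le_of_mem_smul_capacityRegion hρ0.le hl Finset.univ).trans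
    (mul_le_of_le_one_right hρ0.le (sys.onProb_le_one _))
  -- Strictness comes from `λ_tot ≤ ρ < (1 + ρ) / 2 ≤ r_{K+1}`.
  have hKl : sys.lamTot < rK sys.pMin (logK ρ sys.pMin + 1) := by linarith
  obtain ⟨Wbar, hW, hWle⟩ := (sys.lcq_bounds hlcq hp hp1 hρ0 hρ1 hl hK hKl).2.2 hlpos
  refine ⟨hKl, hKc, Wbar, hW, hWle, ?_⟩
  exact sys.delayBound_le hp hp1 hρ0 hρ1 (abs_nonneg β) hlpos hlρ
    (hsec.trans (mul_le_mul_of_nonneg_right (le_abs_self β) hlpos.le)) hK hr hKc
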